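/- **Notation.** A *20-pod* (icosapod) $\Pi=(\vec p,\vec P,\vec d)$ consists of platform points $p_1,\dots,p_{20}\in\mathbb R^3$, base points $P_1,\dots,P_{20}\in\mathbb R^3$ and leg lengths $d_1,\dots,d_{20}>0$. Its configurations are the direct isometries $\sigma$ of $\mathbb R^3$ with $\|\sigma(p_i)-P_i\|=d_i$ for all $i$; its mobility is the dimension of this real algebraic set, and it is mobile if the mobility is at least $1$. A *mobile icosapod* is a 20-pod of mobility exactly one such that adding any further leg $(a,b,d)\in\mathbb R^3\times\mathbb R^3\times\mathbb R_{>0}$ (different from its legs) makes the mobility drop below one. Let $X\subset\mathbb P^{16}_{\mathbb C}$, with coordinates $(h:M:x:y:r)$ ($M$ a $3\times3$ matrix, $x,y$ vectors), be defined by $MM^t=M^tM=h^2\,\mathrm{id}$, $\det M=h^3$, $M^ty+hx=0$, $Mx+hy=0$, $\langle x,x\rangle=\langle y,y\rangle=rh$, and let $X_{\rm inv}\subset X$ be the subvariety $M=M^t$, $x=y$, $\operatorname{tr}M+h=0$ (the compactified set of rotations by $180^\circ$ about lines). On the dual space $\check{\mathbb P}^{16}_{\mathbb C}$ with coordinates $(z,l)$,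 $z=(z_{ij})_{0\le i,j\le3}$, the bilinear sphere condition is $$lh+z_{00}r-2\sum_{i}z_{i0}x_i-2\sum_j z_{0j}y_j-2\sum_{i,j=1}^3 m_{ij}z_{ji}=0 .$$ A leg with platform point $a$, base point $b$ and length $d$ is the point $z_{ij}=a_ib_j$ $(a_0=b_0=1)$, $l=\langle a,a\rangle+\langle b,b\rangle-d^2$. Let $Y=\{(z:l): z_{ij}=a_ib_j \text{ for some } a,b\in\mathbb C^4\}$. The leg set $L_C$ of a curve $C\subset X$ is the set of all complex points of $Y$ that satisfy the sphere condition with every point of $C$. The set $K_\Pi$ is the set of points of $X$ that satisfy the sphere conditions of all legs of $\Pi$. Let $E=\operatorname{diag}(0,1,1,1)$ and $p_e=(z=E,\ l=-2)$. For a $4$-dimensional real space $A$ of symmetric $4\times4$ matrices, the quartic spectrahedron of $A$ is the set of positive semidefinite matrices in $A$ ($A$ is required to contain a positive definite matrix), and the symmetroid is the quartic surface $\det=0$ in $\mathbb P(A_{\mathbb C})$. The spectrahedron has type $(a,b)$ if the symmetroid has exactly ten complex singular points, all of them double points given by matrices of rank $2$, of which exactly $a$ are real and exactly $b$ are real and lie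 on the spectrahedron. If $E\in A$, *Borel's construction* from $A$ chooses a real $4$-dimensional space $\tilde\Gamma$ of pairs $(z,l)$ with $z$ symmetric, containing $p_e$ and projected isomorphically onto $A$ by forgetting $l$, and takes $C\subset X_{\rm inv}$ to be the set of points of $X_{\rm inv}$ that satisfy the bilinear sphere condition with every element of $\tilde\Gamma$. A 20-pod $\Pi$ arises from $A$ by Borel's construction if, for some such $\tilde\Gamma$, $C$ is a curve (of complex dimension one), $L_C$ consists of exactly $20$ points, which are the $20$ legs of $\Pi$, and $K_\Pi=C$. **Theorem.** There are a $4$-dimensional real space $A$ of symmetric $4\times4$ matrices that contains $E$ and defines a quartic spectrahedron of type $(10,0)$, and a mobile icosapod $\Pi$ (all of whose $20$ legs thus have real base and platform points) which arises from $A$ by Borel's construction. In particular $\Pi$ is line-symmetric: $K_\Pi\subset X_{\rm inv}$, and every configuration of $\Pi$ is a rotation by $180^\circ$ about a line. Moreover, $\Pi$ can be chosen so that its first six legs have the following rational coordinates: $$P_1=p_4=\left(-\tfrac{19493}{142100},-\tfrac{2088}{94325},-\tfrac{24}{9625}\right),\quad p_1=P_4=\left(-\tfrac{36411}{267844},-\tfrac{1608}{177793},\tfrac{504}{25399}\right),$$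 $$P_2=p_5=\left(-\tfrac{269}{5000},\tfrac{39}{1000},\tfrac{17}{500}\right),\quad p_2=P_5=\left(-\tfrac{47}{368},-\tfrac{12}{1771},\tfrac{21}{1265}\right),$$ $$P_3=p_6=\left(-\tfrac{1863}{14645},-\tfrac{106851}{1555400},\tfrac{2509}{222200}\right),\quad p_3=P_6=\left(-\tfrac{15185}{112462},-\tfrac{120}{149303},\tfrac{48}{3047}\right),$$ $$d_1^2=d_4^2=\tfrac{1081643179736912972309543483891375692}{276669953748621822688942197018838171875},\quad d_2^2=d_5^2=\tfrac{219482305781081742844809989061}{29002829339836395492656900000000},$$ $$d_3^2=d_6^2=\tfrac{4185335506762812187908674782558830797}{636621874987061375644008358435317156000},$$ and so that the rotation by $180^\circ$ about the line through $(-\tfrac1{10},0,0)$ in direction $(1,\tfrac{7003716944}{10000000000},\tfrac8{10})$ is one of its configurations. -/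

import Mathlib

open scoped LinearAlgebra.Projectivization Matrix ENNReal

namespace Icosapod

noncomputable section

/-! ### Pods and their configuration sets -/

/-- Euclidean 3-space. -/
abbrev E3 := EuclideanSpace ℝ (Fin 3)

/-- Pairs `(M, y)` of a real `3 × 3` matrix (as a function of two indices) and a vector. A direct
isometry `v ↦ M v + y` is such a pair with `M` in `SO(3)`. -/
abbrev Pose := (Fin 3 → Fin 3 → ℝ) × (Fin 3 → ℝ)

/-- The image of the point `a` under `v ↦ M v + y`. -/
def Pose.act (σ : Pose) (a : E3) : E3 :=
  WithLp.toLp 2 (Matrix.of σ.1 *ᵥ a.ofLp + σ.2)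

/-- The group of direct isometries of 3-space, as a subset of `ℝ^9 × ℝ^3`. -/
def SE3 : Set Pose := {σ | Matrix.of σ.1 ∈ Matrix.specialOrthogonalGroup (Fin 3) ℝ}

/-- The rotation by 180 degrees around the line through `q` with direction `u` (for `u ≠ 0`):
`v ↦ 2 (q + (⟪v - q, u⟫ / ⟪u, u⟫) u) - v`. -/
def halfTurn (q u : Fin 3 → ℝ) : Pose :=
  (fun i j => 2 * u i * u j / (u ⬝ᵥ u) - (if i = j then 1 else 0),
   fun i => 2 * q i - 2 * (q ⬝ᵥ u) / (u ⬝ᵥ u) * u i)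

/-- An `n`-pod: real platform points, real base points, positive leg lengths. -/
structure Pod (n : ℕ) where
  platform : Fin n → E3
  base : Fin n → E3
  length : Fin n → ℝ
  length_pos : ∀ i, 0 < length i

/-- The set of admissible configurations of a pod. -/
def Pod.config {n : ℕ} (P : Pod n) : Set Pose :=
  {σ | σ ∈ SE3 ∧ ∀ i, ‖σ.act (P.platform i) - P.base i‖ = P.length i}

/-- The mobility of a pod: the dimension of its configuration set. This is a real algebraic subset
of `ℝ^12`, and for such sets the Hausdorff dimension is the dimension as a real algebraic set. -/
def Pod.mobility {n : ℕ} (P : Pod n) : ℝ≥0∞ := dimH P.config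

/-- A pod is mobile if its configuration set has dimension at least one. -/
def Pod.IsMobile {n : ℕ} (P : Pod n) : Prop := 1 ≤ P.mobility

/-- The pod with one additional leg. -/
def Pod.addLeg {n : ℕ} (P : Pod n) (a b : E3) (d : ℝ) (hd : 0 < d) : Pod (n + 1) where
  platform := Fin.snoc (α := fun _ => E3) P.platform a
  base := Fin.snoc (α := fun _ => E3) P.base b
  length := Fin.snoc (α := fun _ => ℝ) P.length d
  length_pos := by
    intro i
    refine Fin.lastCases ?_ (fun j => ?_) i
    · simpa using hd
    · simpa using P.length_pos j

/-- A mobile icosapod: a 20-pod of mobility one to which no (new) leg can be added without losing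
mobility. -/
def Pod.IsMobileIcosapod (P : Pod 20) : Prop :=
  P.mobility = 1 ∧
    ∀ (a b : E3) (d : ℝ) (hd : 0 < d),
      (∀ i, ¬ (P.platform i = a ∧ P.base i = b ∧ P.length i = d)) →
        ¬ (P.addLeg a b d hd).IsMobile

/-! ### The compactification of the group of direct isometries, and the leg space -/

/-- The vector space with coordinates `(h, M, x, y, r)`. -/
abbrev MotionSpace (K : Type) :=
  K × Matrix (Fin 3) (Fin 3) K × (Fin 3 → K) × (Fin 3 → K) × K

/-- The vector space with coordinates `(z, l)`, `z = (z_ij)` for `0 ≤ i, j ≤ 3`. -/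
abbrev LegSpace (K : Type) := Matrix (Fin 4) (Fin 4) K × K

/-- The bilinear sphere condition. For `z_ij = a_i b_j` with `a_0 = b_0 = 1`,
`l = ⟨a, a⟩ + ⟨b, b⟩ - d^2` and `(1, M, x, y, r)` the coordinates of an isometry `σ`, its vanishing
says `‖σ a - b‖^2 = d^2`. -/
def bsc {K : Type} [CommRing K] : MotionSpace K → LegSpace K → K
  | (h, M, x, y, r), (z, l) =>
    l * h + z 0 0 * r - 2 * ∑ i : Fin 3, z i.succ 0 * x i - 2 * ∑ j : Fin 3, z 0 j.succ * y j
      - 2 * ∑ i : Fin 3, ∑ j : Fin 3, M i j * z j.succ i.succ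

/-- The equations of the compactification `X` of the group of direct isometries. -/
def IsInX : MotionSpace ℂ → Prop
  | (h, M, x, y, r) =>
    M * Mᵀ = h ^ 2 • (1 : Matrix (Fin 3) (Fin 3) ℂ) ∧
    Mᵀ * M = h ^ 2 • (1 : Matrix (Fin 3) (Fin 3) ℂ) ∧
    M.det = h ^ 3 ∧
    Mᵀ *ᵥ y + h • x = 0 ∧ M *ᵥ x + h • y = 0 ∧
    x ⬝ᵥ x = r * h ∧ y ⬝ᵥ y = r * h

/-- The compactification `X` in 16-dimensional complex projective space. -/
def X : Set (ℙ ℂ (MotionSpace ℂ)) := {p | IsInX p.rep}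

/-- The linear equations `M = Mᵀ`, `x = y`, `m_11 + m_22 + m_33 + h = 0`. -/
def IsInvolutory : MotionSpace ℂ → Prop
  | (h, M, x, y, _) => M = Mᵀ ∧ x = y ∧ M.trace + h = 0

/-- The subvariety of `X` compactifying the set of rotations by 180 degrees around lines. -/
def Xinv : Set (ℙ ℂ (MotionSpace ℂ)) := {p | p ∈ X ∧ IsInvolutory p.rep}

/-- The cone over the Segre variety of pairs of points in projective 3-space. -/
def Y : Set (ℙ ℂ (LegSpace ℂ)) :=
  {p | ∃ a b : Fin 4 → ℂ, p.rep.1 = Matrix.vecMulVec a b}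

/-- The leg set of a curve in `X`: all complex points of `Y` whose sphere condition holds on `C`. -/
def legSet (C : Set (ℙ ℂ (MotionSpace ℂ))) : Set (ℙ ℂ (LegSpace ℂ)) :=
  {q | q ∈ Y ∧ ∀ p ∈ C, bsc p.rep q.rep = 0}

/-- A (Zariski closed) subset of projective space has dimension one: it is infinite, and some
linear subspace of codimension at most two does not meet it. -/
def IsOneDimensional (C : Set (ℙ ℂ (MotionSpace ℂ))) : Prop :=
  C.Infinite ∧ ∃ f g : MotionSpace ℂ →ₗ[ℂ] ℂ, ∀ p ∈ C, ¬ (f p.rep = 0 ∧ g p.rep = 0)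

/-- A real vector of the leg space as a complex vector. -/
def LegSpace.toComplex (w : LegSpace ℝ) : LegSpace ℂ := (w.1.map (fun t => (t : ℂ)), (w.2 : ℂ))

/-- The coordinates `(z, l)` of the leg with platform point `a`, base point `b`, length `d`. -/
def legVector (a b : E3) (d : ℝ) : LegSpace ℝ :=
  (Matrix.vecMulVec (Matrix.vecCons 1 a.ofLp) (Matrix.vecCons 1 b.ofLp),
    ‖a‖ ^ 2 + ‖b‖ ^ 2 - d ^ 2)

theorem legVector_toComplex_ne_zero (a b : E3) (d : ℝ) : (legVector a b d).toComplex ≠ 0 := by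
  intro h
  have h1 := congrFun (congrFun (congrArg Prod.fst h) 0) 0
  simp [LegSpace.toComplex, legVector] at h1

/-- The point of `Y` given by the `i`-th leg of a pod. -/
def Pod.legPoint {n : ℕ} (P : Pod n) (i : Fin n) : ℙ ℂ (LegSpace ℂ) :=
  Projectivization.mk ℂ (legVector (P.platform i) (P.base i) (P.length i)).toComplex
    (legVector_toComplex_ne_zero _ _ _)

/-- The compactified configuration space `K_Π`: the points of `X` that satisfy the sphere
conditions of all legs. -/
def Pod.compactConfig {n : ℕ} (P : Pod n) : Set (ℙ ℂ (MotionSpace ℂ)) :=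
  {p | p ∈ X ∧
    ∀ i, bsc p.rep (legVector (P.platform i) (P.base i) (P.length i)).toComplex = 0}

/-! ### Quartic spectrahedra -/

/-- Real symmetric `4 × 4` matrices live in this space. -/
abbrev Mat4 (K : Type) := Matrix (Fin 4) (Fin 4) K

/-- The matrix `E = diag(0, 1, 1, 1)`. -/
def matE : Mat4 ℝ := Matrix.diagonal ![0, 1, 1, 1]

/-- `A` defines a quartic spectrahedron (the set of positive semidefinite matrices in `A`): it is a
4-dimensional space of symmetric matrices, and the spectrahedron has interior points at which the
determinant is nonzero. -/
structure IsQuarticSpectrahedron (A : Submodule ℝ (Mat4 ℝ)) : Prop where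
  finrank_eq : Module.finrank ℝ A = 4
  symm : ∀ N ∈ A, N.IsSymm
  exists_posDef : ∃ N ∈ A, N.PosDef

/-- The complexification of `A`. -/
def complexSpan (A : Submodule ℝ (Mat4 ℝ)) : Submodule ℂ (Mat4 ℂ) :=
  Submodule.span ℂ ((fun N : Mat4 ℝ => N.map (fun t => (t : ℂ))) '' (A : Set (Mat4 ℝ)))

/-- The determinant, restricted to the complexification of `A`, vanishes at `N` to order at least
`m`. -/
def SymmetroidMultGE (A : Submodule ℝ (Mat4 ℝ)) (m : ℕ) (N : Mat4 ℂ) : Prop :=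
  ∀ B ∈ complexSpan A,
    (Polynomial.X : Polynomial ℂ) ^ m ∣
      (N.map (fun t => Polynomial.C t)
        + (Polynomial.X : Polynomial ℂ) • B.map (fun t => Polynomial.C t)).det

/-- The complex singular points of the symmetroid `det = 0` in the projectivization of `A`. -/
def symmetroidSing (A : Submodule ℝ (Mat4 ℝ)) : Set (ℙ ℂ (Mat4 ℂ)) :=
  {p | p.rep ∈ complexSpan A ∧ SymmetroidMultGE A 2 p.rep}

/-- The real matrix `N` represents the point `p`. -/
def RepresentedBy (p : ℙ ℂ (Mat4 ℂ)) (N : Mat4 ℝ) : Prop :=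
  ∃ c : ℂ, p.rep = c • N.map (fun t => (t : ℂ))

/-- The spectrahedron defined by `A` has type `(a, b)`: the symmetroid has exactly ten complex
singular points, all of which are double points given by matrices of rank two; exactly `a` of them
are real, and exactly `b` are (real and) contained in the spectrahedron. -/
structure HasType (A : Submodule ℝ (Mat4 ℝ)) (a b : ℕ) : Prop where
  ten : (symmetroidSing A).encard = 10
  double : ∀ p ∈ symmetroidSing A, ¬ SymmetroidMultGE A 3 p.rep ∧ p.rep.rank = 2
  real : {p ∈ symmetroidSing A | ∃ N ∈ A, RepresentedBy p N}.encard = a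
  semidef : {p ∈ symmetroidSing A | ∃ N ∈ A, RepresentedBy p N ∧ N.PosSemidef}.encard = b

/-! ### Borel's construction -/

/-- The point `p_e`, dual to the hyperplane `m_11 + m_22 + m_33 + h = 0`. -/
def pE : LegSpace ℝ := (matE, -2)

/-- `G` is a real 3-space of symmetric elements `(z, l)` in the projectivized leg space which passes
through `p_e` and projects isomorphically, forgetting `l`, to the Borel subspace given by `A`. -/
structure IsBorelLift (A : Submodule ℝ (Mat4 ℝ)) (G : Submodule ℝ (LegSpace ℝ)) : Prop where
  finrank_eq : Module.finrank ℝ G = 4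
  symm : ∀ w ∈ G, w.1.IsSymm
  pE_mem : pE ∈ G
  map_eq : G.map (LinearMap.fst ℝ (Mat4 ℝ) ℝ) = A

/-- The intersection of the variety `Xinv` with the linear subspace dual to `G` with respect to the
bilinear sphere condition. -/
def borelCurve (G : Submodule ℝ (LegSpace ℝ)) : Set (ℙ ℂ (MotionSpace ℂ)) :=
  {p | p ∈ Xinv ∧ ∀ w ∈ G, bsc p.rep w.toComplex = 0}

/-- The pod `P` arises by Borel's construction from the Borel subspace given by `A`: for some `G`
over it, the associated set `C` is a curve, its leg set (over the complex numbers) consists of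
exactly the legs of `P`, and these are pairwise distinct; and `C` is the compactified
configuration space of `P`. -/
def Pod.IsBorelFrom {n : ℕ} (P : Pod n) (A : Submodule ℝ (Mat4 ℝ)) : Prop :=
  ∃ G : Submodule ℝ (LegSpace ℝ), IsBorelLift A G ∧
    IsOneDimensional (borelCurve G) ∧
    legSet (borelCurve G) = Set.range P.legPoint ∧
    Function.Injective P.legPoint ∧
    P.compactConfig = borelCurve G

/-! ### The explicit rational data -/

/-- Base points of the first six legs. -/
def exBase : Fin 6 → E3 :=
  ![!₂[-19493 / 142100, -2088 / 94325, -24 / 9625],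
    !₂[-269 / 5000, 39 / 1000, 17 / 500],
    !₂[-1863 / 14645, -106851 / 1555400, 2509 / 222200],
    !₂[-36411 / 267844, -1608 / 177793, 504 / 25399],
    !₂[-47 / 368, -12 / 1771, 21 / 1265],
    !₂[-15185 / 112462, -120 / 149303, 48 / 3047]]

/-- Platform points of the first six legs. -/
def exPlatform : Fin 6 → E3 :=
  ![!₂[-36411 / 267844, -1608 / 177793, 504 / 25399],
    !₂[-47 / 368, -12 / 1771, 21 / 1265],
    !₂[-15185 / 112462, -120 / 149303, 48 / 3047],
    !₂[-19493 / 142100, -2088 / 94325, -24 / 9625],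
    !₂[-269 / 5000, 39 / 1000, 17 / 500],
    !₂[-1863 / 14645, -106851 / 1555400, 2509 / 222200]]

/-- Squared lengths of the first six legs. -/
def exSqLength : Fin 6 → ℝ :=
  ![1081643179736912972309543483891375692 / 276669953748621822688942197018838171875,
    219482305781081742844809989061 / 29002829339836395492656900000000,
    4185335506762812187908674782558830797 / 636621874987061375644008358435317156000,
    1081643179736912972309543483891375692 / 276669953748621822688942197018838171875,
    219482305781081742844809989061 / 29002829339836395492656900000000,
    4185335506762812187908674782558830797 / 636621874987061375644008358435317156000]

/-- The initial position: the half-turn about the line through `(-1/10, 0, 0)` in direction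
`(1, 7003716944/10000000000, 8/10)`. -/
def exInitial : Pose := halfTurn ![-1 / 10, 0, 0] ![1, 7003716944 / 10000000000, 8 / 10]

end

end Icosapod

/-!
The icosapod is built from an explicit web of quadrics. The space `theWeb` is spanned by `E` and the
matrices `a bᵀ + b aᵀ` of the three given pairs of legs, and the coordinate `l` of these legs
defines its lift `theLift` to the leg space.

**Nodes and legs.** The symmetroid of the web has ten singular points, the matrices of rank two;
each is `a bᵀ + b aᵀ` for real points `a ≠ b`, so that it is not semidefinite, and gives the two
legs `(a, b)` and `(b, a)`. Three of the nodes are the given rational ones, the other seven are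
obtained from rational approximations by a Newton–Kantorovich argument (`exists_zero_near`, `node`).
That there are no further singular points follows from two facts about the web, each reduced to the
invertibility of an integer matrix modulo a small prime. The quadrics of the web have no common
zero, since products of quadrics of the web with cubics span all quintic forms
(`eq_zero_of_forall_web`); hence the adjugate vanishes at a singular point. And on the set of
matrices of rank at most two every function agrees with a polynomial of degree at most two in three
variables, so that there are at most ten of them (`functional_eq_zero`, `not_eleven`).

**The configuration curve.** The twenty sphere conditions span the linear equations of `X_inv`
together with the conditions of the lifted web, because six of the lines `ab` have linearly
independent Plücker coordinates and four of the nodes are linearly independent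
(`involutory_of_legs`). Hence `K_Π` is the curve of Borel's construction, and every configuration is
a half-turn. For a half-turn with direction `u`, the sphere conditions determine the translation
rationally from `u`, and `u` lies on a plane sextic (`turn_mem_config_iff`, `sexticForm`). The
mobility is at most one because the sextic is locally a Lipschitz graph outside of finitely many
points, and at least one because the sextic changes sign near the given direction (`dimH_config_le`,
`one_le_dimH_config`). The complex curve does not meet the codimension two subspace `h = m₁₁ = 0`
(`borelCurve_avoids`), which bounds its dimension by one.

**No further legs.** The sextic is irreducible: by Ruppert's argument, a factorization would give a
closed differential form with denominator the sextic, hence a solution of a linear system that is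
seen to be regular modulo `11` (`ruppert_trivial`, `irreducible_sextic`). Modulo the lifted web, the
sphere condition of any further leg becomes a plane cubic, which is nonzero and so has only finitely
many points in common with the sextic (`eq_zero_of_legCubic`, `finite_common_zeros`). A leg that is
satisfied by infinitely many configurations therefore has its symmetric part over the web; this
symmetric part has rank two, so it is one of the ten nodes, and the leg is one of the twenty
(`exists_liftMap_of_infinite`, `exists_leg_of_symProd`). This gives both the leg set of the curve
and the maximality of the icosapod.
-/

namespace Icosapod

/-! ### The web of quadrics spanned by `E` and the three given legs -/

/-- The rational coefficients of the web: on the four-dimensional space `A`, the entries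
`03, 12, 13, 22, 23, 33` of a symmetric matrix are linear in its entries `00, 01, 02`, up to adding
the entry `11` to the entries `22` and `33`. Row `k` has the coefficients of the `k`-th of these six
linear forms. -/
def webCoeff : Fin 6 → Fin 3 → ℚ :=
  ![![298530006856601058373 / 4381598560591460264375, 15763186564737775926 / 35052788484731682115, -544309916823989477 / 4345387002239464725],
    ![-1286560914928834428549 / 2846286424960212587738000, -1366283181602557287 / 392591231028994839688, -1132545020109057734 / 8401081537662965135],
    ![-6945267041486687565341 / 1016530866057218781335000, -1214633412376593091 / 28042230787785345692, 1477711874006336507 / 84010815376629651350],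
    ![96740235569913001264305903 / 6355757586936154708418954000, 15433095140816182501361 / 62618301349124676930236, 43055768238389472044 / 56278845220804203439365],
    ![-100244881626409127541 / 337383089165542440356875, -6953353893372560502 / 2699064713324339522855, 268817721800087904 / 15933085674878037325],
    ![12340029067421301877669851 / 648546692544505582491730000, 12406491619088432496067 / 44727358106517626378740, -397422478497452447564 / 40199175157717288170975]]

/-- The coefficients of the entries `00, 01, 02` in the linear form that gives the coordinate `l` on
the lift of the web to the leg space; the entry `11` has coefficient `-2`. -/
def liftCoeff : Fin 3 → ℚ :=
  ![-90437232416511110801233445470045030518471613 / 1652962878121170122698172984735299482765898125,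
    -60028947285660823215016712962024688713708 / 65141394211671728973327014176760570749395,
    -7908406088222782557808852515461881316384 / 234186003984109108292539265842073126247825]

section Web

variable {K : Type} [Field K]

/-- The `k`-th of the six linear forms with coefficients `webCoeff`. -/
def webForm (k : Fin 6) (t x y : K) : K :=
  (webCoeff k 0 : K) * t + (webCoeff k 1 : K) * x + (webCoeff k 2 : K) * y

/-- The element of the web with entries `00, 01, 02, 11` equal to `t, x, y, e`. -/
def web (v : Fin 4 → K) : Mat4 K :=
  !![v 0, v 1, v 2, webForm 0 (v 0) (v 1) (v 2);
     v 1, v 3, webForm 1 (v 0) (v 1) (v 2), webForm 2 (v 0) (v 1) (v 2);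
     v 2, webForm 1 (v 0) (v 1) (v 2), v 3 + webForm 3 (v 0) (v 1) (v 2),
       webForm 4 (v 0) (v 1) (v 2);
     webForm 0 (v 0) (v 1) (v 2), webForm 2 (v 0) (v 1) (v 2), webForm 4 (v 0) (v 1) (v 2),
       v 3 + webForm 5 (v 0) (v 1) (v 2)]

/-- The coordinate `l` of the lift of `web v` to the leg space. -/
def webLift (v : Fin 4 → K) : K :=
  (liftCoeff 0 : K) * v 0 + (liftCoeff 1 : K) * v 1 + (liftCoeff 2 : K) * v 2 - 2 * v 3

/-- The parametrization of the web as a linear map. -/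
def webMap : (Fin 4 → K) →ₗ[K] Mat4 K where
  toFun := web
  map_add' v w := by
    ext i j; fin_cases i <;> fin_cases j <;> simp [web, webForm] <;> ring
  map_smul' c v := by
    ext i j; fin_cases i <;> fin_cases j <;> simp [web, webForm] <;> ring

/-- The parametrization of the lifted web as a linear map. -/
def liftMap : (Fin 4 → K) →ₗ[K] LegSpace K where
  toFun v := (web v, webLift v)
  map_add' v w := by
    refine Prod.ext (webMap.map_add v w) ?_
    simp [webLift]; ring
  map_smul' c v := by
    refine Prod.ext (webMap.map_smul c v) ?_
    simp [webLift]; ring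

@[simp] theorem webMap_apply (v : Fin 4 → K) : webMap v = web v := rfl

@[simp] theorem liftMap_apply (v : Fin 4 → K) : liftMap v = (web v, webLift v) := rfl

theorem web_injective : Function.Injective (web : (Fin 4 → K) → Mat4 K) := by
  intro v w h
  have e (i j) : web v i j = web w i j := by rw [h]
  have h0 := e 0 0
  have h1 := e 0 1
  have h2 := e 0 2
  have h3 := e 1 1
  simp [web] at h0 h1 h2 h3
  funext i; fin_cases i <;> simpa

theorem web_isSymm (v : Fin 4 → K) : (web v).IsSymm := by
  ext i j; fin_cases i <;> fin_cases j <;> simp [web]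

theorem mem_range_webMap {N : Mat4 K} (hs : N.IsSymm)
    (h03 : N 0 3 = webForm 0 (N 0 0) (N 0 1) (N 0 2))
    (h12 : N 1 2 = webForm 1 (N 0 0) (N 0 1) (N 0 2))
    (h13 : N 1 3 = webForm 2 (N 0 0) (N 0 1) (N 0 2))
    (h22 : N 2 2 = N 1 1 + webForm 3 (N 0 0) (N 0 1) (N 0 2))
    (h23 : N 2 3 = webForm 4 (N 0 0) (N 0 1) (N 0 2))
    (h33 : N 3 3 = N 1 1 + webForm 5 (N 0 0) (N 0 1) (N 0 2)) :
    web ![N 0 0, N 0 1, N 0 2, N 1 1] = N := by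
  have e (i j) : N i j = N j i := hs.apply j i
  ext i j
  fin_cases i <;> fin_cases j <;>
    simp [web, h03, h12, h13, h22, h23, h33, e 1 0, e 2 0, e 2 1, e 3 0, e 3 1, e 3 2]

end Web

/-- The four-dimensional space of symmetric matrices. -/
noncomputable def theWeb : Submodule ℝ (Mat4 ℝ) := LinearMap.range webMap

/-- Its lift to the leg space. -/
noncomputable def theLift : Submodule ℝ (LegSpace ℝ) := LinearMap.range liftMap

theorem web_matE : web ![0, 0, 0, 1] = matE := by
  ext i j; fin_cases i <;> fin_cases j <;> simp [web, webForm, matE]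

theorem finrank_theWeb : Module.finrank ℝ theWeb = 4 := by
  rw [theWeb, LinearMap.finrank_range_of_inj web_injective]; simp

theorem isBorelLift_theLift : IsBorelLift theWeb theLift where
  finrank_eq := by
    rw [theLift, LinearMap.finrank_range_of_inj]
    · simp
    · intro v w h
      exact web_injective (congrArg Prod.fst h)
  symm := by rintro _ ⟨v, rfl⟩; exact web_isSymm v
  pE_mem := by
    refine ⟨![0, 0, 0, 1], Prod.ext web_matE ?_⟩
    simp [webLift, pE]
  map_eq := by
    ext N; simp [theLift, theWeb]

/-- Matrices in the web with dominant `E`-part are positive definite once the entry `00` is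
positive. -/
theorem isQuarticSpectrahedron_theWeb : IsQuarticSpectrahedron theWeb where
  finrank_eq := finrank_theWeb
  symm := by rintro _ ⟨v, rfl⟩; exact web_isSymm v
  exists_posDef := by
    refine ⟨web ![1, 0, 0, 1], ⟨_, rfl⟩, ?_⟩
    refine Matrix.PosDef.of_dotProduct_mulVec_pos ?_ ?_
    · have := web_isSymm (![1, 0, 0, 1] : Fin 4 → ℝ)
      rwa [Matrix.IsHermitian, Matrix.conjTranspose_eq_transpose_of_trivial]
    · intro x hx
      have hx' : 0 < x 0 ^ 2 + x 1 ^ 2 + x 2 ^ 2 + x 3 ^ 2 := by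
        by_contra hcon
        apply hx
        have h0 : x 0 = 0 := by nlinarith [sq_nonneg (x 0), sq_nonneg (x 1), sq_nonneg (x 2), sq_nonneg (x 3)]
        have h1 : x 1 = 0 := by nlinarith [sq_nonneg (x 0), sq_nonneg (x 1), sq_nonneg (x 2), sq_nonneg (x 3)]
        have h2 : x 2 = 0 := by nlinarith [sq_nonneg (x 0), sq_nonneg (x 1), sq_nonneg (x 2), sq_nonneg (x 3)]
        have h3 : x 3 = 0 := by nlinarith [sq_nonneg (x 0), sq_nonneg (x 1), sq_nonneg (x 2), sq_nonneg (x 3)]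
        funext i; fin_cases i <;> simpa
      simp [web, webForm, webCoeff, Matrix.mulVec, dotProduct, Fin.sum_univ_four]
      nlinarith [sq_nonneg (x 0 + x 3), sq_nonneg (x 0 - x 3), sq_nonneg (x 1 + x 2), sq_nonneg (x 1 - x 2),
        sq_nonneg (x 1 + x 3), sq_nonneg (x 1 - x 3), sq_nonneg (x 2 + x 3), sq_nonneg (x 2 - x 3),
        sq_nonneg (x 0), sq_nonneg (x 1), sq_nonneg (x 2), sq_nonneg (x 3)]

theorem map_ofReal_web (v : Fin 4 → ℝ) :
    (web v).map (fun t => (t : ℂ)) = web (fun i => (v i : ℂ)) := by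
  ext i j; fin_cases i <;> fin_cases j <;> simp [web, webForm]

theorem ofReal_webLift (v : Fin 4 → ℝ) : ((webLift v : ℝ) : ℂ) = webLift (fun i => (v i : ℂ)) := by
  simp [webLift]

theorem complexSpan_theWeb : complexSpan theWeb = LinearMap.range (webMap (K := ℂ)) := by
  apply le_antisymm
  · rw [complexSpan, Submodule.span_le]
    rintro _ ⟨_, ⟨v, rfl⟩, rfl⟩
    exact ⟨fun i => (v i : ℂ), (map_ofReal_web v).symm⟩
  · rintro _ ⟨v, rfl⟩
    have hv : v = ∑ i, v i • (fun j => ((Pi.single i 1 : Fin 4 → ℝ) j : ℂ)) := by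
      funext j; fin_cases j <;> simp [Fin.sum_univ_four]
    rw [hv, map_sum]
    refine Submodule.sum_mem _ fun i _ => ?_
    rw [map_smul]
    exact Submodule.smul_mem _ _ (Submodule.subset_span ⟨_, ⟨_, rfl⟩, map_ofReal_web _⟩)

/-! ### Real legs over the web: a Newton–Kantorovich argument -/

section System

variable {K : Type} [Field K]

/-- For `w = (a, b)` with `a, b ∈ K ^ 3`: the six equations that say that the matrix
`(1, a) (1, b)ᵀ + (1, b) (1, a)ᵀ` lies in the web. -/
def legSystem (w : Fin 6 → K) : Fin 6 → K :=
  ![w 2 + w 5 - webForm 0 2 (w 0 + w 3) (w 1 + w 4),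
    w 0 * w 4 + w 1 * w 3 - webForm 1 2 (w 0 + w 3) (w 1 + w 4),
    w 0 * w 5 + w 2 * w 3 - webForm 2 2 (w 0 + w 3) (w 1 + w 4),
    2 * w 1 * w 4 - 2 * w 0 * w 3 - webForm 3 2 (w 0 + w 3) (w 1 + w 4),
    w 1 * w 5 + w 2 * w 4 - webForm 4 2 (w 0 + w 3) (w 1 + w 4),
    2 * w 2 * w 5 - 2 * w 0 * w 3 - webForm 5 2 (w 0 + w 3) (w 1 + w 4)]

/-- The homogeneous quadratic part of `legSystem`. -/
def legQuad (w : Fin 6 → K) : Fin 6 → K :=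
  ![0, w 0 * w 4 + w 1 * w 3, w 0 * w 5 + w 2 * w 3, 2 * w 1 * w 4 - 2 * w 0 * w 3,
    w 1 * w 5 + w 2 * w 4, 2 * w 2 * w 5 - 2 * w 0 * w 3]

/-- The Jacobian matrix of `legSystem`. -/
def legJacobian (w : Fin 6 → K) : Matrix (Fin 6) (Fin 6) K :=
  !![-webForm 0 0 1 0, -webForm 0 0 0 1, 1, -webForm 0 0 1 0, -webForm 0 0 0 1, 1;
     w 4 - webForm 1 0 1 0, w 3 - webForm 1 0 0 1, 0,
       w 1 - webForm 1 0 1 0, w 0 - webForm 1 0 0 1, 0;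
     w 5 - webForm 2 0 1 0, -webForm 2 0 0 1, w 3,
       w 2 - webForm 2 0 1 0, -webForm 2 0 0 1, w 0;
     -2 * w 3 - webForm 3 0 1 0, 2 * w 4 - webForm 3 0 0 1, 0,
       -2 * w 0 - webForm 3 0 1 0, 2 * w 1 - webForm 3 0 0 1, 0;
     -webForm 4 0 1 0, w 5 - webForm 4 0 0 1, w 4,
       -webForm 4 0 1 0, w 2 - webForm 4 0 0 1, w 1;
     -2 * w 3 - webForm 5 0 1 0, -webForm 5 0 0 1, 2 * w 5,
       -2 * w 0 - webForm 5 0 1 0, -webForm 5 0 0 1, 2 * w 2]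

theorem legSystem_add (w d : Fin 6 → K) :
    legSystem (w + d) = legSystem w + legJacobian w *ᵥ d + legQuad d := by
  funext i
  fin_cases i <;>
    simp [legSystem, legJacobian, legQuad, webForm, dotProduct,
      Fin.sum_univ_succ] <;> ring

end System

theorem legSystem_cast (w : Fin 6 → ℚ) (i : Fin 6) :
    legSystem (fun j => (w j : ℝ)) i = (legSystem w i : ℚ) := by
  fin_cases i <;> simp [legSystem, webForm]

theorem legJacobian_cast (w : Fin 6 → ℚ) :
    legJacobian (fun j => (w j : ℝ)) = (legJacobian w).map (fun t => (t : ℝ)) := by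
  ext i j
  fin_cases i <;> fin_cases j <;> simp [legJacobian, webForm]

theorem abs_mul_sub_mul_le {ρ m a b a' b' : ℝ} (hb : |b| ≤ ρ) (ha' : |a'| ≤ ρ)
    (h1 : |a - a'| ≤ m) (h2 : |b - b'| ≤ m) : |a * b - a' * b'| ≤ 2 * (ρ * m) := by
  have hρ : 0 ≤ ρ := (abs_nonneg _).trans hb
  have hm : 0 ≤ m := (abs_nonneg _).trans h1
  calc |a * b - a' * b'| = |(a - a') * b + a' * (b - b')| := by ring_nf
    _ ≤ |(a - a') * b| + |a' * (b - b')| := abs_add_le _ _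
    _ = |a - a'| * |b| + |a'| * |b - b'| := by rw [abs_mul, abs_mul]
    _ ≤ m * ρ + ρ * m := by gcongr
    _ = 2 * (ρ * m) := by ring

theorem abs_legQuad_sub_le {ρ m : ℝ} {d d' : Fin 6 → ℝ} (hd : ∀ i, |d i| ≤ ρ)
    (hd' : ∀ i, |d' i| ≤ ρ) (h : ∀ i, |d i - d' i| ≤ m) (i : Fin 6) :
    |legQuad d i - legQuad d' i| ≤ 8 * ρ * m := by
  have key (j k : Fin 6) : |d j * d k - d' j * d' k| ≤ 2 * (ρ * m) :=
    abs_mul_sub_mul_le (hd k) (hd' j) (h j) (h k)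
  have hpos : 0 ≤ ρ * m := by have := (abs_nonneg _).trans (key 0 0); linarith
  have k1 := abs_le.1 (key 0 4)
  have k2 := abs_le.1 (key 1 3)
  have k3 := abs_le.1 (key 0 5)
  have k4 := abs_le.1 (key 2 3)
  have k5 := abs_le.1 (key 1 4)
  have k6 := abs_le.1 (key 0 3)
  have k7 := abs_le.1 (key 1 5)
  have k8 := abs_le.1 (key 2 4)
  have k9 := abs_le.1 (key 2 5)
  rw [abs_le]
  fin_cases i <;> simp [legQuad] <;> first | linarith | (constructor <;> linarith)

/-- A matrix close to the identity in the row sum norm is invertible. -/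
theorem det_ne_zero_of_near_one {n : ℕ} (A : Matrix (Fin n) (Fin n) ℝ)
    (h : ∀ i, ∑ j, |(1 - A) i j| < 1) : A.det ≠ 0 := by
  apply det_ne_zero_of_sum_row_lt_diag
  intro i
  have hi := h i
  rw [← Finset.add_sum_erase _ _ (Finset.mem_univ i)] at hi
  have h1 : ∑ j ∈ Finset.univ.erase i, |(1 - A) i j| = ∑ j ∈ Finset.univ.erase i, ‖A i j‖ := by
    refine Finset.sum_congr rfl fun j hj => ?_
    rw [Matrix.sub_apply, Matrix.one_apply_ne (Finset.ne_of_mem_erase hj).symm, zero_sub, abs_neg,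
      Real.norm_eq_abs]
  rw [h1, Matrix.sub_apply, Matrix.one_apply_eq] at hi
  rw [Real.norm_eq_abs (A i i)]
  have h2 : 1 - A i i ≤ |1 - A i i| := le_abs_self _
  have h3 : A i i ≤ |A i i| := le_abs_self _
  linarith

/-- Newton–Kantorovich for `legSystem`: if `P` is an approximate inverse of the Jacobian matrix at
an approximate zero `w`, then there is a zero near `w`. -/
theorem exists_zero_near {w : Fin 6 → ℚ} {P : Matrix (Fin 6) (Fin 6) ℚ} {ρ : ℚ} (hρ : 0 ≤ ρ)
    (h1 : ∀ i, |(P *ᵥ legSystem w) i| ≤ ρ / 2)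
    (h2 : ∀ i, ∑ j, |(1 - P * legJacobian w) i j| + 8 * ρ * ∑ k, |P i k| ≤ 1 / 2) :
    ∃ z : Fin 6 → ℝ, legSystem z = 0 ∧ ∀ i, |z i - w i| ≤ ρ := by
  set W : Fin 6 → ℝ := fun j => (w j : ℝ) with hW
  set Q : Matrix (Fin 6) (Fin 6) ℝ := P.map (fun t => (t : ℝ)) with hQ
  have hρ' : (0 : ℝ) ≤ ρ := by exact_mod_cast hρ
  have g1 : ∀ i, |(Q *ᵥ legSystem W) i| ≤ ρ / 2 := by
    intro i
    have := h1 i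
    have e : (Q *ᵥ legSystem W) i = (((P *ᵥ legSystem w) i : ℚ) : ℝ) := by
      simp [Matrix.mulVec, dotProduct, hQ, hW, legSystem_cast]
    rw [e]; exact_mod_cast this
  have g2 : ∀ i, ∑ j, |(1 - Q * legJacobian W) i j| + 8 * ρ * ∑ k, |Q i k| ≤ 1 / 2 := by
    intro i
    have := h2 i
    have e (j) : (1 - Q * legJacobian W) i j = (((1 - P * legJacobian w) i j : ℚ) : ℝ) := by
      simp [Matrix.mul_apply, hQ, hW, legJacobian_cast, Matrix.one_apply, apply_ite]
    have e' : ((∑ j, |(1 - P * legJacobian w) i j| + 8 * ρ * ∑ k, |P i k| : ℚ) : ℝ) ≤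
        ((1 / 2 : ℚ) : ℝ) := by exact_mod_cast this
    push_cast at e'
    simp only [e]
    simpa [hQ] using e'
  have hdet : Q.det ≠ 0 := by
    have : (Q * legJacobian W).det ≠ 0 := by
      apply det_ne_zero_of_near_one
      intro i
      have := g2 i
      have h0 : 0 ≤ 8 * (ρ : ℝ) * ∑ k, |Q i k| := by positivity
      linarith
    rw [Matrix.det_mul] at this
    exact left_ne_zero_of_mul this
  set T : (Fin 6 → ℝ) → (Fin 6 → ℝ) := fun d => d - Q *ᵥ legSystem (W + d) with hT
  have hTdiff (d d' : Fin 6 → ℝ) : T d - T d' =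
      (1 - Q * legJacobian W) *ᵥ (d - d') - Q *ᵥ (legQuad d - legQuad d') := by
    simp only [hT, legSystem_add, Matrix.mulVec_add, Matrix.mulVec_sub, Matrix.sub_mulVec,
      Matrix.one_mulVec, Matrix.mulVec_mulVec]
    abel
  have hlip {d d' : Fin 6 → ℝ} (hd : ∀ i, |d i| ≤ ρ) (hd' : ∀ i, |d' i| ≤ ρ) {m : ℝ}
      (hm : ∀ i, |d i - d' i| ≤ m) (i : Fin 6) : |T d i - T d' i| ≤ m / 2 := by
    have hm0 : 0 ≤ m := (abs_nonneg _).trans (hm 0)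
    have e : T d i - T d' i = ∑ j, (1 - Q * legJacobian W) i j * (d j - d' j)
        - ∑ k, Q i k * (legQuad d k - legQuad d' k) := by
      have := congrFun (hTdiff d d') i
      simpa [Matrix.mulVec, dotProduct] using this
    rw [e]
    calc _ ≤ |∑ j, (1 - Q * legJacobian W) i j * (d j - d' j)|
          + |∑ k, Q i k * (legQuad d k - legQuad d' k)| := abs_sub _ _
      _ ≤ ∑ j, |(1 - Q * legJacobian W) i j| * m + ∑ k, |Q i k| * (8 * ρ * m) := by
        refine add_le_add ((Finset.abs_sum_le_sum_abs _ _).trans ?_)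
          ((Finset.abs_sum_le_sum_abs _ _).trans ?_)
        · refine Finset.sum_le_sum fun j _ => ?_
          rw [abs_mul]; exact mul_le_mul_of_nonneg_left (hm j) (abs_nonneg _)
        · refine Finset.sum_le_sum fun j _ => ?_
          rw [abs_mul]
          exact mul_le_mul_of_nonneg_left (abs_legQuad_sub_le hd hd' hm j) (abs_nonneg _)
      _ = (∑ j, |(1 - Q * legJacobian W) i j| + 8 * ρ * ∑ k, |Q i k|) * m := by
        rw [← Finset.sum_mul, ← Finset.sum_mul]; ring
      _ ≤ 1 / 2 * m := mul_le_mul_of_nonneg_right (g2 i) hm0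
      _ = m / 2 := by ring
  have hball (d : Fin 6 → ℝ) : d ∈ Metric.closedBall (0 : Fin 6 → ℝ) ρ ↔ ∀ i, |d i| ≤ ρ := by
    rw [mem_closedBall_zero_iff, pi_norm_le_iff_of_nonneg hρ']; rfl
  have hmaps : Set.MapsTo T (Metric.closedBall 0 ρ) (Metric.closedBall 0 ρ) := by
    intro d hd
    rw [hball] at hd ⊢
    intro i
    have h3 := hlip hd (d' := 0) (by simpa using hρ') (m := ρ) (by simpa using hd) i
    have h4 : |T 0 i| ≤ ρ / 2 := by simpa [hT] using g1 i
    calc |T d i| = |(T d i - T 0 i) + T 0 i| := by ring_nf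
      _ ≤ |T d i - T 0 i| + |T 0 i| := abs_add_le _ _
      _ ≤ ρ := by linarith
  have hcontr : ContractingWith (1 / 2) (hmaps.restrict T _ _) := by
    refine ⟨by norm_num, LipschitzWith.of_dist_le_mul fun d d' => ?_⟩
    rw [Subtype.dist_eq, Subtype.dist_eq, dist_eq_norm, dist_eq_norm]
    refine (pi_norm_le_iff_of_nonneg (by positivity)).2 fun i => ?_
    have h5 := hlip ((hball _).1 d.2) ((hball _).1 d'.2) (m := ‖(d : Fin 6 → ℝ) - (d' : Fin 6 → ℝ)‖)
      (fun i => norm_le_pi_norm ((d : Fin 6 → ℝ) - (d' : Fin 6 → ℝ)) i) i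
    have h6 : ((1 / 2 : NNReal) : ℝ) * ‖(d : Fin 6 → ℝ) - (d' : Fin 6 → ℝ)‖ = ‖(d : Fin 6 → ℝ) - (d' : Fin 6 → ℝ)‖ / 2 := by
      push_cast; ring
    rw [h6]; exact h5
  obtain ⟨d, hd, hfix, -⟩ := hcontr.exists_fixedPoint' (x := 0)
    (Metric.isClosed_closedBall.isComplete) hmaps (by simpa using hρ') (edist_ne_top _ _)
  refine ⟨W + d, ?_, fun i => by simpa [hW] using (hball d).1 hd i⟩
  have hz : Q *ᵥ legSystem (W + d) = 0 := by
    have : d - Q *ᵥ legSystem (W + d) = d := hfix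
    simpa using this
  exact Matrix.eq_zero_of_mulVec_eq_zero hdet hz

/-! ### The ten pairs of legs -/

/-- Ten approximate zeros of `legSystem`, in units of `10⁻¹²`; the first three are the given
rational legs. -/
def nodeApprox : Fin 10 → Fin 6 → ℤ :=
  ![![-135941070175, -9044225588, 19843300917, -137178043631, -22136231116, -2493506494],
    ![-127717391304, -6775832863, 16600790514, -53800000000, 39000000000, 34000000000],
    ![-135023385677, -803734687, 15753199869, -127210652100, -68696798251, 11291629163],
    ![-134847748252, -6891845390, 16703989050, -144468923246, -38345680589, -380416749],
    ![-129316353390, 24919281344, -12387640035, -135199250339, 4777807806, 25980804243],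
    ![-133800088371, 1429669598, 16442027872, -111821417928, -81329227213, 19376029686],
    ![-116983387989, -424892598, 1187473436, -128445539043, -2647251212, 25093665696],
    ![-127882243117, 2779452895, 17373061166, -100092965404, -29900824850, 19769432706],
    ![-112537325178, -1418816410, 6241698493, -125977592063, -2757940284, 23287026026],
    ![-108454434621, -2125022406, 10813083711, -125082125558, -2679213787, 21032999590]]

/-- Approximate inverses, in units of `1 / 10`, of the Jacobian matrices at the last seven
approximate zeros. -/
def nodeInverse : Fin 7 → Fin 6 → Fin 6 → ℤ :=
  ![![![-32, -232, -265, -11, 171, -83],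
      ![90, -398, 679, -43, -202, -5],
      ![-60, 253, -431, 16, -203, 15],
      ![74, 539, 818, 236, -1174, 850],
      ![-456, 2304, -3080, -112, -299, 1143],
      ![135, -354, 980, 105, -185, 187]],
    ![![70, 558, 542, -20, 65, 59],
      ![-106, -1067, -726, 449, 569, 94],
      ![32, 413, 209, -110, -52, 133],
      ![-20, 200, -149, -14, 16, -7],
      ![-10, -131, -97, 137, -137, -43],
      ![15, 79, 70, 21, 34, -116]],
    ![![100, -176, 796, -19, 224, 176],
      ![124, -38, 979, -61, 274, 198],
      ![55, -18, 427, -2, -3, 65],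
      ![1120, -411, 8790, -11, 2448, 1599],
      ![-532, -773, -3671, -58, -885, 1269],
      ![555, -144, 4220, 4, 1281, 549]],
    ![![-159, 857, -1366, 2233, 826, -289],
      ![60, 363, 511, -643, 473, 145],
      ![-224, 657, -1925, 2289, 741, -218],
      ![-163, 500, -1404, 1390, 498, -313],
      ![14, 306, 122, -113, -293, 16],
      ![80, -130, 600, -566, -168, -73]],
    ![![-46, 132, -455, 40, -434, -318],
      ![24, 48, 225, -125, 207, 107],
      ![14, 46, 93, 11, -232, -34],
      ![157, 164, 1262, 109, 1077, 29],
      ![-440, 1561, -4002, 682, -3663, -1773],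
      ![98, -114, 743, -14, 954, 113]],
    ![![468, -1431, 4362, -4116, -1775, 1650],
      ![-76, 669, -720, 726, 1228, -236],
      ![481, -1904, 4525, -4952, -2279, 1988],
      ![142, -612, 1328, -1739, -756, 494],
      ![2, 287, 21, 7, -359, -6],
      ![-188, 865, -1878, 2227, 1032, -993]],
    ![![-187, 1070, -2087, 2603, 2024, -1643],
      ![41, 102, 438, -518, 1088, 386],
      ![-258, 924, -2751, 2562, 1781, -1701],
      ![-31, 61, -338, 77, 108, -272],
      ![-8, 306, -81, 108, -469, -78],
      ![166, -466, 1616, -1305, -900, 801]]]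

/-- Platform and base point of the given legs `1, 2, 3`. -/
def rationalNode : Fin 3 → Fin 6 → ℚ :=
  ![![-36411 / 267844, -1608 / 177793, 504 / 25399, -19493 / 142100, -2088 / 94325, -24 / 9625],
    ![-47 / 368, -12 / 1771, 21 / 1265, -269 / 5000, 39 / 1000, 17 / 500],
    ![-15185 / 112462, -120 / 149303, 48 / 3047, -1863 / 14645, -106851 / 1555400, 2509 / 222200]]

/-- At the seven irrational nodes, the first hypothesis of `exists_zero_near` holds with radius
`10⁻⁹`. -/
theorem newton_residual : ∀ (k : Fin 7) (i : Fin 6),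
    |(Matrix.of (fun i j => (nodeInverse k i j : ℚ) / 10) *ᵥ
      legSystem (fun j => (nodeApprox (Fin.natAdd 3 k) j : ℚ) / 10 ^ 12)) i|
      ≤ (1 / 10 ^ 9) / 2 := by
  decide +kernel

/-- At the seven irrational nodes, the second hypothesis of `exists_zero_near` holds with radius
`10⁻⁹`. -/
theorem newton_derivative : ∀ (k : Fin 7) (i : Fin 6),
    ∑ j, |(1 - Matrix.of (fun i j => (nodeInverse k i j : ℚ) / 10) *
      legJacobian (fun j => (nodeApprox (Fin.natAdd 3 k) j : ℚ) / 10 ^ 12) :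
        Matrix (Fin 6) (Fin 6) ℚ) i j|
      + 8 * (1 / 10 ^ 9) * ∑ j, |(nodeInverse k i j : ℚ) / 10| ≤ 1 / 2 := by
  decide +kernel

theorem legSystem_rationalNode : ∀ (k : Fin 3) (i : Fin 6), legSystem (rationalNode k) i = 0 := by
  decide +kernel

theorem rationalNode_near : ∀ (k : Fin 3) (i : Fin 6),
    |rationalNode k i - (nodeApprox (Fin.castAdd 7 k) i : ℚ) / 10 ^ 12| ≤ 1 / 10 ^ 9 := by
  decide +kernel

theorem exists_node (k : Fin 10) : ∃ z : Fin 6 → ℝ, legSystem z = 0 ∧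
    (∀ i, |z i - (nodeApprox k i : ℝ) / 10 ^ 12| ≤ 1 / 10 ^ 9) ∧
    ∀ j : Fin 3, k = Fin.castAdd 7 j → z = fun i => (rationalNode j i : ℝ) := by
  refine Fin.addCases (m := 3) (n := 7) (fun j => ?_) (fun j => ?_) k
  · refine ⟨fun i => (rationalNode j i : ℝ), ?_, fun i => ?_, fun j' hj => ?_⟩
    · funext i
      rw [legSystem_cast, legSystem_rationalNode]; simp
    · have := rationalNode_near j i
      rw [← Rat.cast_le (K := ℝ)] at this
      push_cast at this
      exact this
    · rw [Fin.castAdd_injective 3 7 hj]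
  · obtain ⟨z, hz, hn⟩ := exists_zero_near (by norm_num) (newton_residual j) (newton_derivative j)
    refine ⟨z, hz, fun i => by simpa using hn i, fun j' hj => ?_⟩
    have := congrArg Fin.val hj
    simp at this
    omega

/-- Ten pairs `(a, b)` of points of 3-space, as vectors of length six: the legs `(a, b)` and
`(b, a)` are the legs of the icosapod. -/
noncomputable def node (k : Fin 10) : Fin 6 → ℝ := (exists_node k).choose

theorem legSystem_node (k : Fin 10) : legSystem (node k) = 0 := (exists_node k).choose_spec.1

theorem node_near (k : Fin 10) (i : Fin 6) :
    |node k i - (nodeApprox k i : ℝ) / 10 ^ 12| ≤ 1 / 10 ^ 9 := (exists_node k).choose_spec.2.1 i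

theorem node_rational (j : Fin 3) : node (Fin.castAdd 7 j) = fun i => (rationalNode j i : ℝ) :=
  (exists_node _).choose_spec.2.2 j rfl

/-- The approximate first coordinates differ by more than twice the error `10⁻⁹`. -/
theorem newton_separation : ∀ p q : Fin 10 × Fin 2, p ≠ q →
    3 * 10 ^ 3 ≤ |nodeApprox p.1 (![0, 3] p.2) - nodeApprox q.1 (![0, 3] q.2)| := by
  decide +kernel

/-- The first coordinates of the twenty points that occur are pairwise distinct. -/
theorem node_first_injective :
    Function.Injective fun p : Fin 10 × Fin 2 => node p.1 (![0, 3] p.2) := by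
  intro p q h
  by_contra hne
  have h1 := newton_separation p q hne
  have hp := node_near p.1 (![0, 3] p.2)
  have hq := node_near q.1 (![0, 3] q.2)
  simp only at h
  rw [h] at hp
  have h2 : (3 * 10 ^ 3 : ℝ) ≤ |(nodeApprox p.1 (![0, 3] p.2) : ℝ) - nodeApprox q.1 (![0, 3] q.2)| := by
    exact_mod_cast h1
  rw [abs_le] at hp hq
  rw [le_abs] at h2
  rcases h2 with h2 | h2 <;> linarith [hp.1, hp.2, hq.1, hq.2]

/-- The sums of the approximate first coordinates of a pair differ by more than four times the error
`10⁻⁹`. -/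
theorem newton_sum_separation : ∀ k l : Fin 10, k ≠ l →
    5 * 10 ^ 3 ≤ |nodeApprox k 0 + nodeApprox k 3 - (nodeApprox l 0 + nodeApprox l 3)| := by
  decide +kernel

/-- The nodes are distinguished by the entry `01` of the matrix `a bᵀ + b aᵀ`. -/
theorem node_sum_injective : Function.Injective fun k : Fin 10 => node k 0 + node k 3 := by
  intro k l h
  by_contra hne
  have h1 := newton_sum_separation k l hne
  have a1 := abs_le.1 (node_near k 0)
  have a2 := abs_le.1 (node_near k 3)
  have a3 := abs_le.1 (node_near l 0)
  have a4 := abs_le.1 (node_near l 3)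
  simp only at h
  have h2 : (5 * 10 ^ 3 : ℝ) ≤ |(nodeApprox k 0 : ℝ) + nodeApprox k 3
      - (nodeApprox l 0 + nodeApprox l 3)| := by
    exact_mod_cast h1
  rw [le_abs] at h2
  rcases h2 with h2 | h2 <;> linarith [a1.1, a1.2, a2.1, a2.2, a3.1, a3.2, a4.1, a4.2]

/-! ### Invertibility of integer matrices modulo a prime -/

/-- The scalar product of two lists. -/
def listDot : List ℕ → List ℕ → ℕ
  | a :: s, b :: t => a * b + listDot s t
  | _, _ => 0

theorem listDot_eq_sum (s t : List ℕ) :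
    ∀ n, s.length ≤ n → listDot s t = ∑ k ∈ Finset.range n, s.getD k 0 * t.getD k 0 := by
  induction s generalizing t with
  | nil => intro n _; simp [listDot]
  | cons a s ih =>
    intro n hn
    cases t with
    | nil => simp [listDot]
    | cons b t =>
      obtain ⟨m, rfl⟩ : ∃ m, n = m + 1 := ⟨n - 1, by simp at hn; omega⟩
      rw [Finset.sum_range_succ', listDot, ih t m (by simpa using hn)]
      simp [add_comm]

/-- The square matrix with rows `B` is inverse, modulo `p`, to the one with columns `A`. -/
def IsModInverse (p n : ℕ) (B A : List (List ℕ)) : Prop :=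
  ∀ i < n, (B.getD i []).length ≤ n ∧
    ∀ j < n, listDot (B.getD i []) (A.getD j []) % p = if i = j then 1 else 0

instance (p n : ℕ) (B A : List (List ℕ)) : Decidable (IsModInverse p n B A) := by
  unfold IsModInverse; infer_instance

/-- An integer matrix that is invertible modulo `p > 1` is injective in characteristic zero. -/
theorem IsModInverse.eq_zero {p n : ℕ} {B A : List (List ℕ)} (h : IsModInverse p n B A)
    (hp : 1 < p) {K : Type} [Field K] [CharZero K] {a : Fin n → Fin n → ℤ}
    (ha : ∀ i j : Fin n, a i j ≡ ((A.getD j []).getD i 0 : ℕ) [ZMOD p]) {m : Fin n → K}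
    (hm : ∀ i, ∑ j, (a i j : K) * m j = 0) : m = 0 := by
  have : Fact (1 < p) := ⟨hp⟩
  set b : Matrix (Fin n) (Fin n) ℤ := fun i j => ((B.getD i []).getD j 0 : ℕ) with hb
  have key : (b * Matrix.of a).map (Int.castRingHom (ZMod p)) = 1 := by
    ext i j
    obtain ⟨hl, hj⟩ := h i i.2
    have h1 := hj j j.2
    rw [listDot_eq_sum _ _ n hl] at h1
    have h2 : (((∑ k ∈ Finset.range n, (B.getD i []).getD k 0 * (A.getD j []).getD k 0 : ℕ)) :
        ZMod p) = if i = j then 1 else 0 := by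
      rw [← ZMod.natCast_mod, h1]
      simp [apply_ite, Fin.ext_iff]
    rw [Matrix.one_apply, ← h2, Matrix.map_apply, Matrix.mul_apply, map_sum, Nat.cast_sum,
      Finset.sum_range]
    refine Finset.sum_congr rfl fun k _ => ?_
    have h3 := (ZMod.intCast_eq_intCast_iff _ _ _).2 (ha k j)
    simp only [hb, Matrix.of_apply, map_mul, eq_intCast, Nat.cast_mul, h3]
    push_cast; rfl
  have hdet : (Matrix.of a).det ≠ 0 := by
    intro h0
    have h4 := congrArg Matrix.det key
    rw [← RingHom.mapMatrix_apply, ← RingHom.map_det, Matrix.det_mul, h0, mul_zero, map_zero,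
      Matrix.det_one] at h4
    exact zero_ne_one h4
  have hdet' : ((Matrix.of a).map (Int.castRingHom K)).det ≠ 0 := by
    rw [← RingHom.mapMatrix_apply, ← RingHom.map_det]
    simpa using hdet
  refine Matrix.eq_zero_of_mulVec_eq_zero hdet' ?_
  funext i
  simpa [Matrix.mulVec, dotProduct] using hm i

/-! ### Bivariate polynomials of bounded degree -/

open MvPolynomial

/-- The exponents `(i, j)` of the monomials `x ^ i * y ^ j` of degree at most `d`. -/
def triangle (d : ℕ) : Finset (ℕ × ℕ) :=
  {m ∈ Finset.range (d + 1) ×ˢ Finset.range (d + 1) | m.1 + m.2 ≤ d}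

/-- The polynomial of degree at most `d` with the given coefficients. In the ring
`MvPolynomial (Fin 2) ℝ`, the variable `X 1` is `x`, and `X 0` is `y`. -/
noncomputable def ofTriangle (d : ℕ) (c : ℕ → ℕ → ℝ) : MvPolynomial (Fin 2) ℝ :=
  ∑ m ∈ triangle d, C (c m.1 m.2) * MvPolynomial.X 1 ^ m.1 * MvPolynomial.X 0 ^ m.2

/-- The exponent of `x ^ i * y ^ j`. -/
noncomputable def expo (i j : ℕ) : Fin 2 →₀ ℕ := Finsupp.single 1 i + Finsupp.single 0 j

theorem expo_eq_iff (i j : ℕ) (n : Fin 2 →₀ ℕ) : expo i j = n ↔ i = n 1 ∧ j = n 0 := by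
  constructor
  · rintro rfl; simp [expo]
  · rintro ⟨rfl, rfl⟩
    ext k; fin_cases k <;> simp [expo]

theorem C_mul_X_pow_mul_X_pow (c : ℝ) (i j : ℕ) :
    (C c * MvPolynomial.X 1 ^ i * MvPolynomial.X 0 ^ j : MvPolynomial (Fin 2) ℝ) = monomial (expo i j) c := by
  rw [X_pow_eq_monomial, X_pow_eq_monomial, C_mul_monomial, monomial_mul]
  simp [expo]

theorem mem_triangle {d : ℕ} {m : ℕ × ℕ} : m ∈ triangle d ↔ m.1 + m.2 ≤ d := by
  simp [triangle]; omega

theorem coeff_ofTriangle (d : ℕ) (c : ℕ → ℕ → ℝ) (n : Fin 2 →₀ ℕ) :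
    coeff n (ofTriangle d c) = if n 1 + n 0 ≤ d then c (n 1) (n 0) else 0 := by
  simp only [ofTriangle, coeff_sum, C_mul_X_pow_mul_X_pow, coeff_monomial, expo_eq_iff]
  split_ifs with h
  · rw [Finset.sum_eq_single (n 1, n 0)]
    · simp
    · intro m _ hm
      rw [if_neg]
      rintro ⟨h1, h2⟩
      exact hm (Prod.ext h1 h2)
    · intro hm; exact absurd (mem_triangle.2 h) hm
  · refine Finset.sum_eq_zero fun m hm => if_neg ?_
    rintro ⟨h1, h2⟩
    have := mem_triangle.1 hm
    omega

theorem eq_ofTriangle {d : ℕ} {r : MvPolynomial (Fin 2) ℝ} (h : r.totalDegree ≤ d) :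
    r = ofTriangle d fun i j => coeff (expo i j) r := by
  ext n
  rw [coeff_ofTriangle]
  have e : expo (n 1) (n 0) = n := (expo_eq_iff _ _ _).2 ⟨rfl, rfl⟩
  simp only [e]
  split_ifs with hn
  · rfl
  · apply coeff_eq_zero_of_totalDegree_lt
    refine lt_of_le_of_lt h ?_
    rw [← Finsupp.degree_apply, Finsupp.degree_eq_sum]
    simp [Fin.sum_univ_two]; omega

theorem eval_ofTriangle (d : ℕ) (c : ℕ → ℕ → ℝ) (x y : ℝ) :
    eval ![y, x] (ofTriangle d c) = ∑ m ∈ triangle d, c m.1 m.2 * (x ^ m.1 * y ^ m.2) := by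
  simp [ofTriangle, mul_assoc]

theorem eval_pderiv_one_ofTriangle (d : ℕ) (c : ℕ → ℕ → ℝ) (x y : ℝ) :
    eval ![y, x] (pderiv 1 (ofTriangle d c)) =
      ∑ m ∈ triangle d, c m.1 m.2 * (m.1 * x ^ (m.1 - 1) * y ^ m.2) := by
  simp only [ofTriangle, map_sum]
  refine Finset.sum_congr rfl fun m _ => ?_
  simp [Derivation.leibniz, Derivation.leibniz_pow, pderiv_X]
  ring

theorem eval_pderiv_zero_ofTriangle (d : ℕ) (c : ℕ → ℕ → ℝ) (x y : ℝ) :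
    eval ![y, x] (pderiv 0 (ofTriangle d c)) =
      ∑ m ∈ triangle d, c m.1 m.2 * (x ^ m.1 * (m.2 * y ^ (m.2 - 1))) := by
  simp only [ofTriangle, map_sum]
  refine Finset.sum_congr rfl fun m _ => ?_
  simp [Derivation.leibniz, Derivation.leibniz_pow, pderiv_X]
  ring

/-! ### The plane sextic and Ruppert's criterion -/

/-- The coefficients of the sextic: the entry `j` of row `i` is the coefficient of
`x ^ i * y ^ j`. -/
def sexticData : List (List ℤ) :=
  [[-127973006086987052423979504960450899131190606556482448279517963922941365314220096373510,
    3324306344879081365866121930322275702290209064347857028458386581775140823639391256759080,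
    -3654461989042698991883531311237811379841811311766645782043970530474380585312187533002015,
    5232399827343261532617773598657178412131594599060600806112002491790101139836671995636780,
    -6544195352694031709324835349470152747888976999697590036795883676941559001223086325046760,
    1831018266659014905825968340219972015419907262434361242318548726512595982021028165400800,
    -3017112273547423625913895397099943172344226059583087562004333678274000669841111235136000],
   [243059842863223156790060358905540868815922805967658695893890016543782768603217047653412,
    -813532606013480695689906248308766701581825506390688887259520126887960497329671720668862,
    641004066007435793309722650162789258178255862021634619262989890325635650866266662553594,
    -1877601954626949503590111996783636332450695246105676530731820056529917092895411737742692,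
    477453495960501479026329872233074789191040957973277229170826774821121963446332074185232,
    -930411067652214456538150887527430262087773821745364209365539456870477612175969462964480],
   [1325319859111226723423280307750479643898299644632730632502250686983041863526164908399915,
    6316365332384300524946464550964359118527665943293438927641882150386870436634061715155240,
    -5874104081128155405000377602229110292286176396155565756189236652175344260922173932598655,
    5077994637939189377394827692610789626076931997321015028208061370414780818547294620516160,
    -6951797769681701275546214268580887764327951229258970581961660728045972091080378169043200],
   [-267958571703846685751109560925332744995140013833891404217726669591792447717445189209846,
    -1551748339594592801619030679163507393896275608061842411272441784635190767536207860976642,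
    91420138192607595146312895432002919769844608451454230794576426986513047406754075019424,
    -1480969392159733116333701079497036277646754624996879500453422637974218989710805302005760],
   [2342178167002308039742763729713417544722191740367770137584920852372622526037929011923425,
    3092457418357799939045015410734139388244526126992679002631386702357994257969578057496160,
    -3438880950323818520405901647651410974411972244355540420370652272994124241552880483347200],
   [-1085575363046576046090971391190800160647532467465071716992352987336657081283195849257008,
    -870041555650430353410694851247319062045596936921499493385962441179475972491356521345280],
   [123647578953093434196747087248005393579007525308684248873860665753410868396030000000000]]

/-- The coefficient of `x ^ i * y ^ j` in the sextic. -/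
def sexticCoeff (i j : ℕ) : ℤ := (sexticData.getD i []).getD j 0

/-- The plane sextic, a plane model of the configuration curve. -/
noncomputable def sextic : MvPolynomial (Fin 2) ℝ := ofTriangle 6 fun i j => (sexticCoeff i j : ℝ)

/-- The values of the sextic and of its two partial derivatives at an integral point. -/
def sexticValues (x y : ℤ) : ℤ × ℤ × ℤ :=
  (∑ m ∈ triangle 6, sexticCoeff m.1 m.2 * (x ^ m.1 * y ^ m.2),
   ∑ m ∈ triangle 6, sexticCoeff m.1 m.2 * (m.1 * x ^ (m.1 - 1) * y ^ m.2),
   ∑ m ∈ triangle 6, sexticCoeff m.1 m.2 * (x ^ m.1 * (m.2 * y ^ (m.2 - 1))))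

/-- The unknowns of Ruppert's linear system: the coefficients of the monomials `x ^ i * y ^ j` of
the polynomials `r` (marked `true`) and `s` (marked `false`). The coefficient of `y ^ 5` in `s` is
left out. -/
def ruppertIndex : List (Bool × ℕ × ℕ) :=
  [(true, 0, 0), (true, 0, 1), (true, 0, 2), (true, 0, 3), (true, 0, 4), (true, 0, 5),
   (true, 1, 0), (true, 1, 1), (true, 1, 2), (true, 1, 3), (true, 1, 4), (true, 2, 0),
   (true, 2, 1), (true, 2, 2), (true, 2, 3), (true, 3, 0), (true, 3, 1), (true, 3, 2),
   (true, 4, 0), (true, 4, 1), (true, 5, 0), (false, 0, 0), (false, 0, 1), (false, 0, 2),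
   (false, 0, 3), (false, 0, 4), (false, 1, 0), (false, 1, 1), (false, 1, 2), (false, 1, 3),
   (false, 1, 4), (false, 2, 0), (false, 2, 1), (false, 2, 2), (false, 2, 3), (false, 3, 0),
   (false, 3, 1), (false, 3, 2), (false, 4, 0), (false, 4, 1), (false, 5, 0)]

/-- Integral points at which Ruppert's equation is evaluated. -/
def ruppertPoints : List (ℕ × ℕ) :=
  [(0, 0), (0, 1), (0, 2), (0, 3), (0, 4), (0, 5), (0, 6), (0, 7), (0, 8), (1, 0),
   (1, 1), (1, 2), (1, 3), (1, 4), (1, 5), (1, 6), (1, 7), (1, 8), (1, 9), (2, 0),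
   (2, 1), (2, 2), (2, 3), (2, 4), (2, 5), (2, 6), (2, 7), (2, 8), (3, 0), (3, 1),
   (3, 2), (3, 3), (3, 4), (3, 5), (3, 6), (3, 7), (4, 0), (4, 1), (4, 2), (4, 3),
   (5, 0)]

/-- The values of the sextic and its partial derivatives at `ruppertPoints`, modulo `11`. -/
def ruppertValues : List (ℕ × ℕ × ℕ) :=
  [(6, 0, 0), (6, 9, 9), (8, 1, 5), (4, 3, 2), (0, 9, 2), (1, 2, 0), (1, 9, 0), (0, 2, 9),
   (4, 8, 9), (5, 4, 6), (5, 6, 10), (0, 5, 7), (7, 9, 5), (7, 3, 0), (7, 4, 3), (8, 6, 1),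
   (0, 2, 6), (6, 6, 5), (10, 9, 9), (9, 3, 1), (5, 0, 9), (3, 4, 2), (3, 2, 3), (6, 1, 1),
   (10, 6, 0), (0, 9, 2), (9, 0, 1), (8, 0, 10), (2, 6, 6), (0, 3, 1), (5, 0, 1), (0, 5, 10),
   (5, 1, 9), (7, 1, 5), (5, 4, 3), (5, 6, 0), (10, 6, 7), (1, 10, 10), (6, 10, 9), (0, 0, 10),
   (4, 5, 9)]

/-- The columns of Ruppert's linear system, modulo `11`. -/
def ruppertColumns : List (List ℕ) :=
  [[0, 2, 6, 9, 9, 0, 0, 2, 2, 5, 1, 4, 6, 0, 8, 10, 5, 6, 2, 10, 2, 9, 8, 10, 0, 9, 10, 1, 5, 10, 10, 1, 2, 6, 8, 0, 4, 1, 2, 1, 2],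
    [6, 8, 9, 9, 3, 1, 1, 3, 9, 5, 6, 8, 3, 7, 3, 2, 2, 10, 6, 9, 7, 10, 5, 2, 10, 10, 2, 5, 2, 10, 3, 3, 2, 4, 9, 5, 10, 2, 10, 3, 4],
    [0, 3, 1, 6, 1, 10, 1, 10, 5, 0, 0, 5, 8, 1, 6, 5, 3, 7, 1, 0, 1, 4, 2, 10, 1, 5, 0, 5, 0, 10, 5, 9, 6, 0, 7, 4, 0, 3, 10, 9, 0],
    [0, 9, 1, 10, 4, 9, 9, 4, 10, 0, 5, 10, 10, 6, 7, 10, 10, 0, 5, 0, 6, 9, 0, 4, 2, 8, 1, 2, 0, 10, 8, 5, 5, 10, 2, 9, 0, 4, 0, 5, 0],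
    [0, 4, 0, 6, 5, 5, 6, 6, 5, 0, 10, 9, 10, 10, 8, 6, 4, 3, 9, 0, 0, 9, 4, 4, 6, 4, 3, 9, 0, 10, 1, 4, 10, 1, 3, 7, 0, 5, 4, 4, 0],
    [0, 10, 7, 1, 9, 1, 1, 9, 1, 0, 4, 7, 3, 6, 4, 9, 6, 4, 10, 0, 5, 0, 2, 1, 10, 2, 4, 5, 0, 10, 5, 1, 0, 2, 8, 9, 0, 6, 5, 1, 0],
    [0, 0, 0, 0, 0, 0, 0, 0, 0, 5, 1, 4, 6, 0, 8, 10, 5, 6, 2, 9, 4, 7, 5, 9, 0, 7, 9, 2, 4, 8, 8, 3, 6, 7, 2, 0, 5, 4, 8, 4, 10],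
    [0, 0, 0, 0, 0, 0, 0, 0, 0, 5, 6, 8, 3, 7, 3, 2, 2, 10, 6, 7, 3, 9, 10, 4, 9, 9, 4, 10, 6, 8, 9, 9, 6, 1, 5, 4, 7, 8, 7, 1, 9],
    [0, 0, 0, 0, 0, 0, 0, 0, 0, 0, 0, 5, 8, 1, 6, 5, 3, 7, 1, 0, 2, 8, 4, 9, 2, 10, 0, 10, 0, 8, 4, 5, 7, 0, 10, 1, 0, 1, 7, 3, 0],
    [0, 0, 0, 0, 0, 0, 0, 0, 0, 0, 5, 10, 10, 6, 7, 10, 10, 0, 5, 0, 1, 7, 0, 8, 4, 5, 2, 4, 0, 8, 2, 4, 4, 8, 6, 5, 0, 5, 0, 9, 0],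
    [0, 0, 0, 0, 0, 0, 0, 0, 0, 0, 10, 9, 10, 10, 8, 6, 4, 3, 9, 0, 0, 7, 8, 8, 1, 8, 6, 7, 0, 8, 3, 1, 8, 3, 9, 10, 0, 9, 5, 5, 0],
    [0, 0, 0, 0, 0, 0, 0, 0, 0, 5, 1, 4, 6, 0, 8, 10, 5, 6, 2, 7, 8, 3, 10, 7, 0, 3, 7, 4, 1, 2, 2, 9, 7, 10, 6, 0, 9, 5, 10, 5, 6],
    [0, 0, 0, 0, 0, 0, 0, 0, 0, 5, 6, 8, 3, 7, 3, 2, 2, 10, 6, 3, 6, 7, 9, 8, 7, 7, 8, 9, 7, 2, 5, 5, 7, 3, 4, 1, 6, 10, 6, 4, 1],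
    [0, 0, 0, 0, 0, 0, 0, 0, 0, 0, 0, 5, 8, 1, 6, 5, 3, 7, 1, 0, 4, 5, 8, 7, 4, 9, 0, 9, 0, 2, 1, 4, 10, 0, 8, 3, 0, 4, 6, 1, 0],
    [0, 0, 0, 0, 0, 0, 0, 0, 0, 0, 5, 10, 10, 6, 7, 10, 10, 0, 5, 0, 2, 3, 0, 5, 8, 10, 4, 8, 0, 2, 6, 1, 1, 2, 7, 4, 0, 9, 0, 3, 0],
    [0, 0, 0, 0, 0, 0, 0, 0, 0, 5, 1, 4, 6, 0, 8, 10, 5, 6, 2, 3, 5, 6, 9, 3, 0, 6, 3, 8, 3, 6, 6, 5, 10, 8, 7, 0, 3, 9, 7, 9, 8],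
    [0, 0, 0, 0, 0, 0, 0, 0, 0, 5, 6, 8, 3, 7, 3, 2, 2, 10, 6, 6, 1, 3, 7, 5, 3, 3, 5, 7, 10, 6, 4, 4, 10, 9, 1, 3, 2, 7, 2, 5, 5],
    [0, 0, 0, 0, 0, 0, 0, 0, 0, 0, 0, 5, 8, 1, 6, 5, 3, 7, 1, 0, 8, 10, 5, 3, 8, 7, 0, 7, 0, 6, 3, 1, 8, 0, 2, 9, 0, 5, 2, 4, 0],
    [0, 0, 0, 0, 0, 0, 0, 0, 0, 5, 1, 4, 6, 0, 8, 10, 5, 6, 2, 6, 10, 1, 7, 6, 0, 1, 6, 5, 9, 7, 7, 4, 8, 2, 10, 0, 1, 3, 6, 3, 7],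
    [0, 0, 0, 0, 0, 0, 0, 0, 0, 5, 6, 8, 3, 7, 3, 2, 2, 10, 6, 1, 2, 6, 3, 10, 6, 6, 10, 3, 8, 7, 1, 1, 8, 5, 3, 9, 8, 6, 8, 9, 3],
    [0, 0, 0, 0, 0, 0, 0, 0, 0, 5, 1, 4, 6, 0, 8, 10, 5, 6, 2, 1, 9, 2, 3, 1, 0, 2, 1, 10, 5, 10, 10, 1, 2, 6, 8, 0, 4, 1, 2, 1, 2],
    [0, 9, 1, 3, 9, 2, 9, 2, 8, 4, 6, 5, 9, 3, 4, 6, 2, 6, 9, 3, 0, 4, 2, 1, 6, 9, 0, 0, 6, 3, 0, 5, 1, 1, 4, 6, 6, 10, 10, 0, 5],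
    [0, 9, 2, 9, 3, 10, 10, 3, 9, 0, 6, 10, 5, 1, 9, 3, 3, 4, 4, 0, 0, 8, 6, 4, 8, 10, 0, 0, 0, 3, 0, 4, 4, 5, 2, 9, 0, 10, 9, 0, 0],
    [0, 9, 4, 5, 1, 6, 5, 10, 6, 0, 6, 9, 4, 4, 1, 7, 10, 10, 3, 0, 0, 5, 7, 5, 7, 5, 0, 0, 0, 3, 0, 1, 5, 3, 1, 8, 0, 10, 7, 0, 0],
    [0, 9, 8, 4, 4, 8, 8, 4, 4, 0, 6, 7, 1, 5, 5, 9, 4, 3, 5, 0, 0, 10, 10, 9, 2, 8, 0, 0, 0, 3, 0, 3, 9, 4, 6, 1, 0, 10, 3, 0, 0],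
    [0, 9, 5, 1, 5, 7, 4, 6, 10, 0, 6, 3, 3, 9, 3, 10, 6, 2, 1, 0, 0, 9, 8, 3, 10, 4, 0, 0, 0, 3, 0, 9, 3, 9, 3, 7, 0, 10, 6, 0, 0],
    [5, 5, 3, 7, 0, 10, 10, 0, 7, 10, 1, 5, 2, 7, 8, 9, 2, 0, 10, 8, 6, 5, 1, 7, 2, 7, 2, 3, 5, 9, 6, 4, 9, 7, 7, 2, 3, 6, 1, 0, 10],
    [0, 5, 6, 10, 0, 6, 5, 0, 1, 0, 1, 10, 6, 6, 7, 10, 3, 0, 2, 0, 6, 10, 3, 6, 10, 9, 3, 2, 0, 9, 1, 1, 3, 2, 9, 3, 0, 6, 2, 0, 0],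
    [0, 5, 1, 8, 0, 8, 8, 0, 8, 0, 1, 9, 7, 2, 2, 5, 10, 0, 7, 0, 6, 9, 9, 2, 6, 10, 10, 5, 0, 9, 2, 3, 1, 10, 10, 10, 0, 6, 4, 0, 0],
    [0, 5, 2, 2, 0, 7, 4, 0, 9, 0, 1, 7, 10, 8, 10, 8, 4, 0, 8, 0, 6, 7, 5, 8, 8, 5, 4, 7, 0, 9, 4, 9, 4, 6, 5, 4, 0, 6, 8, 0, 0],
    [0, 5, 4, 6, 0, 2, 2, 0, 6, 0, 1, 3, 8, 10, 6, 4, 6, 0, 6, 0, 6, 3, 4, 10, 7, 8, 6, 1, 0, 9, 8, 5, 5, 8, 8, 6, 0, 6, 5, 0, 0],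
    [0, 0, 0, 0, 0, 0, 0, 0, 0, 5, 7, 5, 6, 0, 1, 1, 2, 5, 0, 9, 2, 4, 7, 2, 6, 3, 8, 1, 9, 5, 3, 1, 1, 0, 6, 2, 5, 9, 2, 0, 8],
    [0, 0, 0, 0, 0, 0, 0, 0, 0, 0, 7, 10, 7, 0, 5, 6, 3, 7, 0, 0, 2, 8, 10, 8, 8, 7, 1, 8, 0, 5, 6, 3, 4, 0, 3, 3, 0, 9, 4, 0, 0],
    [0, 0, 0, 0, 0, 0, 0, 0, 0, 0, 7, 9, 10, 0, 3, 3, 10, 1, 0, 0, 2, 5, 8, 10, 7, 9, 7, 9, 0, 5, 1, 9, 5, 0, 7, 10, 0, 9, 8, 0, 0],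
    [0, 0, 0, 0, 0, 0, 0, 0, 0, 0, 7, 7, 8, 0, 4, 7, 4, 8, 0, 0, 2, 10, 2, 7, 2, 10, 5, 6, 0, 5, 2, 5, 9, 0, 9, 4, 0, 9, 5, 0, 0],
    [0, 0, 0, 0, 0, 0, 0, 0, 0, 0, 2, 5, 10, 4, 5, 4, 2, 10, 1, 4, 6, 7, 2, 2, 5, 6, 2, 3, 9, 4, 8, 3, 2, 3, 6, 5, 3, 9, 0, 0, 6],
    [0, 0, 0, 0, 0, 0, 0, 0, 0, 0, 2, 10, 8, 5, 3, 2, 3, 3, 9, 0, 6, 3, 6, 8, 3, 3, 3, 2, 0, 4, 5, 9, 8, 4, 3, 2, 0, 9, 0, 0, 0],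
    [0, 0, 0, 0, 0, 0, 0, 0, 0, 0, 2, 9, 2, 9, 4, 1, 10, 2, 4, 0, 6, 6, 7, 10, 4, 7, 10, 5, 0, 4, 10, 5, 10, 9, 7, 3, 0, 9, 0, 0, 0],
    [0, 0, 0, 0, 0, 0, 0, 0, 0, 6, 8, 5, 3, 8, 9, 7, 2, 4, 2, 2, 5, 1, 2, 0, 7, 1, 9, 8, 6, 1, 10, 9, 3, 7, 4, 1, 10, 5, 1, 0, 3],
    [0, 0, 0, 0, 0, 0, 0, 0, 0, 0, 8, 10, 9, 10, 1, 9, 3, 10, 7, 0, 5, 2, 6, 0, 2, 6, 8, 9, 0, 1, 9, 5, 1, 2, 2, 7, 0, 5, 2, 0, 0],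
    [0, 0, 0, 0, 0, 0, 0, 0, 0, 1, 3, 5, 7, 1, 2, 10, 2, 9, 3, 3, 7, 9, 0, 3, 8, 2, 6, 9, 10, 3, 10, 5, 0, 4, 3, 5, 10, 6, 8, 0, 1]]

/-- The rows of the inverse of the matrix of Ruppert's linear system, modulo `11`. -/
def ruppertInverse : List (List ℕ) :=
  [[0, 7, 6, 0, 9, 9, 4, 10, 2, 1, 7, 6, 8, 8, 9, 3, 10, 6, 7, 2, 9, 7, 7, 1, 4, 1, 10, 10, 8, 9, 4, 3, 3, 10, 10, 9, 8, 7, 3, 10, 0],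
    [4, 10, 0, 2, 0, 2, 3, 9, 5, 3, 7, 4, 7, 7, 6, 4, 10, 3, 3, 1, 2, 1, 9, 6, 10, 6, 2, 2, 5, 5, 7, 8, 9, 2, 6, 7, 3, 1, 10, 0, 0],
    [8, 5, 7, 7, 7, 6, 4, 10, 0, 8, 7, 4, 8, 3, 9, 3, 6, 10, 8, 8, 1, 3, 2, 6, 5, 6, 9, 1, 2, 9, 1, 7, 4, 3, 0, 1, 10, 6, 1, 7, 0],
    [7, 8, 1, 2, 3, 2, 7, 7, 9, 4, 6, 7, 4, 0, 5, 8, 4, 6, 5, 4, 9, 7, 8, 10, 3, 1, 5, 8, 5, 9, 1, 7, 8, 6, 10, 2, 6, 5, 7, 1, 0],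
    [2, 2, 3, 4, 10, 7, 1, 4, 10, 5, 5, 10, 6, 8, 10, 7, 9, 9, 4, 4, 6, 10, 3, 6, 6, 6, 9, 4, 8, 8, 1, 3, 7, 8, 10, 4, 6, 5, 7, 1, 0],
    [9, 8, 8, 4, 3, 5, 2, 1, 7, 4, 3, 0, 10, 10, 7, 7, 6, 5, 3, 8, 5, 9, 0, 5, 7, 9, 3, 9, 7, 7, 8, 7, 1, 6, 7, 7, 2, 9, 6, 4, 0],
    [2, 2, 0, 7, 5, 8, 0, 6, 9, 4, 2, 8, 6, 4, 3, 7, 2, 5, 6, 5, 2, 6, 3, 8, 1, 8, 5, 2, 6, 9, 0, 8, 6, 1, 6, 10, 3, 6, 0, 0, 10],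
    [9, 9, 7, 5, 9, 10, 2, 0, 6, 1, 1, 5, 9, 5, 5, 1, 2, 5, 3, 4, 1, 9, 10, 5, 4, 3, 8, 3, 8, 7, 10, 9, 7, 5, 7, 8, 2, 5, 7, 6, 0],
    [3, 2, 7, 7, 3, 1, 10, 5, 4, 6, 6, 9, 5, 10, 9, 0, 7, 0, 0, 5, 10, 3, 2, 7, 5, 5, 5, 8, 3, 6, 5, 8, 2, 1, 0, 6, 1, 4, 7, 0, 0],
    [6, 4, 0, 8, 7, 2, 4, 4, 7, 0, 8, 9, 0, 1, 9, 3, 1, 9, 2, 5, 1, 8, 6, 2, 6, 2, 8, 7, 3, 2, 4, 6, 9, 5, 10, 5, 3, 0, 7, 7, 0],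
    [10, 9, 7, 9, 2, 1, 3, 10, 4, 8, 10, 5, 10, 3, 8, 2, 5, 5, 3, 8, 6, 8, 2, 1, 10, 4, 2, 7, 7, 7, 6, 0, 6, 7, 7, 3, 1, 7, 5, 1, 0],
    [4, 0, 8, 4, 1, 1, 3, 3, 3, 3, 9, 4, 1, 1, 8, 10, 6, 10, 4, 3, 9, 10, 1, 1, 9, 1, 7, 4, 9, 6, 2, 9, 5, 1, 10, 3, 10, 6, 3, 6, 3],
    [8, 6, 5, 1, 3, 1, 8, 6, 10, 2, 5, 2, 2, 9, 1, 8, 2, 4, 4, 2, 6, 0, 3, 4, 8, 7, 2, 8, 1, 8, 10, 1, 7, 10, 6, 7, 4, 4, 3, 7, 0],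
    [8, 7, 6, 6, 9, 8, 5, 5, 7, 6, 1, 7, 9, 10, 3, 10, 0, 3, 10, 9, 10, 6, 5, 2, 1, 3, 1, 3, 4, 6, 0, 6, 1, 7, 3, 0, 4, 9, 7, 5, 0],
    [4, 0, 10, 10, 10, 7, 9, 1, 0, 9, 1, 7, 9, 8, 6, 6, 0, 5, 10, 10, 10, 7, 7, 3, 0, 4, 10, 2, 2, 7, 4, 1, 0, 3, 6, 2, 10, 10, 2, 1, 0],
    [8, 4, 10, 2, 8, 1, 5, 2, 0, 0, 2, 5, 5, 6, 9, 9, 9, 0, 1, 6, 0, 6, 0, 3, 6, 0, 4, 10, 0, 1, 7, 9, 5, 7, 5, 10, 6, 7, 10, 0, 10],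
    [4, 7, 5, 4, 10, 7, 2, 2, 1, 1, 5, 1, 1, 5, 6, 2, 6, 5, 3, 2, 1, 8, 6, 6, 5, 10, 4, 9, 7, 9, 1, 5, 3, 9, 8, 4, 9, 9, 6, 9, 0],
    [9, 9, 8, 9, 0, 9, 3, 7, 2, 3, 9, 0, 9, 4, 4, 4, 3, 5, 7, 5, 10, 5, 3, 6, 3, 0, 2, 1, 10, 1, 0, 9, 7, 4, 10, 2, 5, 8, 10, 7, 0],
    [1, 8, 1, 0, 4, 7, 6, 9, 4, 10, 4, 10, 10, 0, 6, 7, 0, 2, 3, 7, 5, 4, 8, 2, 0, 5, 5, 4, 6, 5, 3, 3, 3, 9, 3, 8, 6, 8, 2, 8, 5],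
    [4, 4, 0, 4, 10, 5, 3, 10, 0, 4, 10, 8, 10, 5, 8, 6, 7, 7, 9, 3, 7, 4, 2, 1, 9, 8, 8, 6, 10, 4, 7, 10, 1, 5, 5, 8, 5, 5, 8, 3, 0],
    [1, 0, 4, 0, 7, 10, 10, 4, 8, 1, 7, 10, 9, 8, 0, 9, 6, 1, 8, 1, 10, 3, 7, 2, 4, 1, 6, 6, 1, 5, 8, 10, 8, 2, 6, 1, 1, 7, 1, 3, 5],
    [8, 2, 0, 0, 10, 10, 6, 1, 7, 3, 10, 4, 9, 9, 0, 5, 5, 6, 7, 9, 1, 7, 4, 4, 1, 1, 4, 10, 3, 7, 1, 6, 0, 2, 1, 8, 7, 6, 5, 0, 0],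
    [3, 2, 9, 9, 0, 0, 6, 0, 2, 1, 10, 5, 3, 2, 1, 7, 1, 10, 1, 10, 1, 0, 10, 10, 1, 6, 5, 10, 5, 6, 10, 10, 2, 6, 5, 10, 1, 5, 10, 4, 0],
    [8, 0, 10, 8, 2, 6, 10, 5, 8, 9, 4, 7, 6, 10, 4, 9, 1, 8, 10, 8, 5, 4, 0, 1, 3, 3, 8, 10, 7, 8, 4, 6, 1, 1, 5, 9, 3, 7, 6, 2, 0],
    [6, 9, 10, 0, 0, 10, 1, 2, 3, 6, 2, 0, 10, 1, 7, 1, 10, 6, 10, 0, 5, 5, 8, 8, 6, 0, 5, 4, 2, 0, 4, 5, 9, 2, 10, 8, 3, 6, 3, 9, 0],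
    [9, 5, 7, 4, 8, 7, 9, 5, 3, 2, 4, 5, 9, 5, 2, 7, 0, 1, 9, 6, 10, 3, 1, 10, 1, 4, 2, 4, 10, 6, 0, 9, 2, 7, 0, 3, 4, 2, 8, 10, 0],
    [2, 10, 0, 2, 0, 2, 3, 9, 5, 3, 7, 4, 7, 7, 6, 4, 10, 3, 3, 1, 2, 1, 9, 6, 10, 6, 2, 2, 5, 5, 7, 8, 9, 2, 6, 7, 3, 1, 10, 0, 0],
    [3, 8, 9, 0, 3, 9, 3, 1, 0, 2, 4, 7, 0, 1, 1, 5, 10, 4, 1, 4, 5, 2, 6, 7, 9, 2, 7, 1, 0, 9, 1, 0, 6, 10, 6, 2, 8, 10, 1, 0, 0],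
    [2, 10, 8, 3, 4, 3, 10, 1, 5, 8, 8, 1, 5, 6, 9, 0, 7, 7, 0, 6, 9, 2, 9, 6, 4, 9, 0, 10, 9, 8, 4, 3, 3, 1, 5, 7, 3, 8, 9, 6, 0],
    [1, 1, 7, 3, 7, 7, 7, 7, 3, 1, 1, 2, 10, 6, 2, 8, 4, 4, 3, 3, 10, 2, 5, 10, 10, 10, 4, 3, 6, 6, 9, 5, 8, 6, 2, 3, 10, 1, 8, 9, 0],
    [4, 6, 1, 9, 2, 0, 1, 0, 2, 7, 8, 0, 1, 1, 4, 4, 5, 6, 8, 3, 6, 2, 0, 6, 4, 2, 8, 2, 4, 4, 3, 4, 10, 5, 4, 4, 9, 2, 5, 7, 0],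
    [9, 7, 6, 5, 1, 10, 3, 9, 5, 6, 9, 8, 3, 7, 7, 1, 7, 10, 7, 4, 10, 10, 1, 2, 9, 6, 2, 1, 1, 3, 4, 8, 10, 8, 10, 2, 8, 8, 6, 3, 0],
    [10, 9, 3, 2, 4, 8, 4, 10, 0, 10, 3, 0, 0, 8, 3, 10, 7, 6, 8, 6, 10, 7, 5, 1, 10, 5, 7, 0, 5, 8, 6, 4, 7, 10, 4, 2, 6, 10, 0, 10, 0],
    [6, 3, 3, 8, 2, 0, 9, 4, 5, 0, 1, 1, 9, 6, 8, 9, 9, 5, 10, 7, 0, 9, 5, 9, 5, 4, 8, 10, 4, 1, 5, 8, 8, 10, 7, 0, 0, 5, 4, 9, 0],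
    [3, 9, 4, 1, 4, 8, 2, 4, 2, 9, 2, 2, 3, 5, 6, 7, 10, 5, 2, 3, 5, 3, 9, 10, 1, 7, 9, 4, 4, 4, 5, 0, 5, 4, 4, 8, 10, 4, 6, 10, 0],
    [1, 4, 6, 4, 0, 9, 3, 0, 4, 7, 4, 6, 8, 3, 9, 1, 4, 7, 10, 4, 2, 9, 10, 10, 3, 6, 3, 7, 6, 1, 0, 3, 10, 7, 2, 7, 8, 8, 6, 3, 0],
    [8, 3, 3, 10, 1, 0, 8, 8, 2, 7, 9, 7, 0, 9, 2, 7, 2, 10, 7, 5, 2, 5, 0, 10, 5, 3, 9, 3, 3, 0, 3, 5, 2, 1, 9, 7, 4, 4, 3, 7, 0],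
    [9, 9, 5, 6, 1, 6, 1, 10, 6, 5, 8, 0, 10, 4, 2, 1, 9, 9, 1, 5, 2, 6, 0, 2, 7, 9, 2, 2, 9, 4, 7, 10, 0, 8, 5, 9, 1, 1, 9, 10, 0],
    [5, 1, 2, 8, 9, 3, 7, 4, 6, 3, 3, 7, 9, 2, 9, 3, 7, 2, 2, 3, 4, 0, 2, 4, 7, 6, 6, 1, 1, 9, 6, 6, 1, 4, 0, 6, 3, 1, 10, 0, 0],
    [2, 0, 3, 0, 7, 1, 8, 3, 6, 6, 5, 2, 6, 3, 5, 4, 10, 6, 4, 8, 9, 4, 4, 9, 10, 3, 7, 10, 4, 0, 8, 7, 10, 10, 0, 6, 6, 3, 1, 4, 0],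
    [0, 6, 3, 4, 0, 7, 0, 5, 6, 3, 5, 9, 2, 8, 8, 5, 9, 7, 3, 0, 5, 7, 4, 3, 4, 5, 9, 5, 7, 8, 4, 6, 9, 10, 10, 5, 6, 2, 9, 0, 0]]

/-- The coefficient of an unknown in Ruppert's equation at the point `(x, y)`, where the sextic and
its derivatives have the values `v`. -/
def ruppertEntry (x y : ℤ) (v : ℤ × ℤ × ℤ) (u : Bool × ℕ × ℕ) : ℤ :=
  if u.1 then v.1 * (x ^ u.2.1 * (u.2.2 * y ^ (u.2.2 - 1))) - v.2.2 * (x ^ u.2.1 * y ^ u.2.2)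
  else v.2.1 * (x ^ u.2.1 * y ^ u.2.2) - v.1 * (u.2.1 * x ^ (u.2.1 - 1) * y ^ u.2.2)

/-- The `k`-th point at which Ruppert's equation is evaluated. -/
def ruppertPoint (k : Fin 41) : ℤ × ℤ :=
  ((ruppertPoints.getD k (0, 0)).1, (ruppertPoints.getD k (0, 0)).2)

/-- The values of the sextic and its partial derivatives, modulo `11`, at the `k`-th point. -/
def ruppertValue (k : Fin 41) : ℤ × ℤ × ℤ :=
  ((ruppertValues.getD k (0, 0, 0)).1, (ruppertValues.getD k (0, 0, 0)).2.1,
    (ruppertValues.getD k (0, 0, 0)).2.2)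

/-- The `k`-th unknown of Ruppert's linear system. -/
def ruppertUnknown (k : Fin 41) : Bool × ℕ × ℕ := ruppertIndex.getD k (true, 0, 0)

theorem isModInverse_ruppert : IsModInverse 11 41 ruppertInverse ruppertColumns := by
  unfold IsModInverse; decide +kernel

theorem sexticValues_modEq : ∀ k : Fin 41,
    (sexticValues (ruppertPoint k).1 (ruppertPoint k).2).1 ≡ (ruppertValue k).1 [ZMOD 11] ∧
    (sexticValues (ruppertPoint k).1 (ruppertPoint k).2).2.1 ≡ (ruppertValue k).2.1 [ZMOD 11] ∧
    (sexticValues (ruppertPoint k).1 (ruppertPoint k).2).2.2 ≡ (ruppertValue k).2.2 [ZMOD 11] := by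
  unfold Int.ModEq; decide +kernel

theorem ruppertEntry_modEq : ∀ k u : Fin 41,
    ruppertEntry (ruppertPoint k).1 (ruppertPoint k).2 (ruppertValue k) (ruppertUnknown u) ≡
      ((ruppertColumns.getD u []).getD k 0 : ℕ) [ZMOD 11] := by
  unfold Int.ModEq; decide +kernel

theorem ruppertUnknown_injective : Function.Injective ruppertUnknown := by
  unfold Function.Injective; decide +kernel

theorem image_ruppertUnknown : Finset.univ.image ruppertUnknown =
    (triangle 5).image (fun m => (true, m)) ∪ ((triangle 5).erase (0, 5)).image
      (fun m => (false, m)) := by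
  decide +kernel

/-- The linear system behind Ruppert's irreducibility criterion has only the trivial solution: there
is no closed rational differential form `(r dx + s dy) / F` with `F` the sextic and `r`, `s` of
degree at most five, apart from the multiples of `dF / F`. -/
theorem ruppert_trivial {r s : MvPolynomial (Fin 2) ℝ} (hr : r.totalDegree ≤ 5)
    (hs : s.totalDegree ≤ 5) (h0 : coeff (expo 0 5) s = 0)
    (h : sextic * (pderiv 0 r - pderiv 1 s) = r * pderiv 0 sextic - s * pderiv 1 sextic) :
    r = 0 ∧ s = 0 := by
  set cr : ℕ → ℕ → ℝ := fun i j => coeff (expo i j) r with hcr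
  set cs : ℕ → ℕ → ℝ := fun i j => coeff (expo i j) s with hcs
  have er := eq_ofTriangle hr
  have es := eq_ofTriangle hs
  set m : Bool × ℕ × ℕ → ℝ := fun u => if u.1 then cr u.2.1 u.2.2 else cs u.2.1 u.2.2 with hm
  have hz : (fun u : Fin 41 => m (ruppertUnknown u)) = 0 := by
    refine isModInverse_ruppert.eq_zero (by norm_num) (a := fun k u => ruppertEntry
      (ruppertPoint k).1 (ruppertPoint k).2
      (sexticValues (ruppertPoint k).1 (ruppertPoint k).2) (ruppertUnknown u)) ?_ ?_
    · intro k u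
      refine Int.ModEq.trans ?_ (ruppertEntry_modEq k u)
      obtain ⟨h1, h2, h3⟩ := sexticValues_modEq k
      unfold ruppertEntry
      split_ifs
      · exact (h1.mul_right _).sub (h3.mul_right _)
      · exact (h2.mul_right _).sub (h1.mul_right _)
    · intro k
      obtain ⟨x, y⟩ := ruppertPoint k
      have hk := congrArg (eval ![(y : ℝ), (x : ℝ)]) h
      rw [er, es] at hk
      simp only [map_mul, map_sub, eval_ofTriangle, eval_pderiv_one_ofTriangle,
        eval_pderiv_zero_ofTriangle, sextic] at hk
      rw [← Finset.sum_image (f := fun u => (ruppertEntry x y (sexticValues x y) u : ℝ) * m u)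
        ruppertUnknown_injective.injOn, image_ruppertUnknown,
        Finset.sum_union (by
          rw [Finset.disjoint_left]; simp),
        Finset.sum_image (by intro a _ b _ hab; simpa using hab),
        Finset.sum_image (by intro a _ b _ hab; simpa using hab),
        Finset.sum_erase _ (by simp [hm, hcs, h0])]
      simp only [ruppertEntry, sexticValues, hm, if_true, Bool.false_eq_true, if_false]
      push_cast
      simp only [sub_mul, Finset.sum_sub_distrib, mul_assoc, ← Finset.mul_sum]
      rw [mul_sub, sub_eq_sub_iff_add_eq_add] at hk
      simp only [hcr, hcs]
      simp only [mul_comm, mul_assoc, mul_left_comm] at hk ⊢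
      linarith
  have hall (u) (hu : u ∈ Finset.univ.image ruppertUnknown) : m u = 0 := by
    obtain ⟨k, -, rfl⟩ := Finset.mem_image.1 hu
    exact congrFun hz k
  rw [image_ruppertUnknown] at hall
  constructor
  · rw [er, ofTriangle]
    refine Finset.sum_eq_zero fun t ht => ?_
    have : cr t.1 t.2 = 0 := hall (true, t) (by simp [ht])
    simp only [hcr] at this
    simp [this]
  · rw [es, ofTriangle]
    refine Finset.sum_eq_zero fun t ht => ?_
    have : cs t.1 t.2 = 0 := by
      by_cases ht' : t = (0, 5)
      · rw [ht']; exact h0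
      · exact hall (false, t) (by simp [ht, ht'])
    simp only [hcs] at this
    simp [this]

theorem expo_degree_le {f : MvPolynomial (Fin 2) ℝ} {n : Fin 2 →₀ ℕ} (h : coeff n f ≠ 0) :
    n 0 + n 1 ≤ f.totalDegree := by
  have := le_totalDegree (mem_support_iff.2 h)
  rw [Finsupp.sum_fintype _ _ (by simp)] at this
  simpa [Fin.sum_univ_two] using this

theorem totalDegree_le_of_coeff {f : MvPolynomial (Fin 2) ℝ} {d : ℕ}
    (h : ∀ n : Fin 2 →₀ ℕ, coeff n f ≠ 0 → n 0 + n 1 ≤ d) : f.totalDegree ≤ d := by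
  refine Finset.sup_le fun n hn => ?_
  rw [Finsupp.sum_fintype _ _ (by simp)]
  simpa [Fin.sum_univ_two] using h n (mem_support_iff.1 hn)

theorem totalDegree_pderiv_le (i : Fin 2) (f : MvPolynomial (Fin 2) ℝ) :
    (pderiv i f).totalDegree ≤ f.totalDegree - 1 := by
  refine totalDegree_le_of_coeff fun n hn => ?_
  rw [coeff_pderiv] at hn
  have := expo_degree_le (left_ne_zero_of_mul hn)
  fin_cases i <;> simp at this <;> omega

theorem pderiv_comm (f : MvPolynomial (Fin 2) ℝ) :
    pderiv 0 (pderiv 1 f) = pderiv 1 (pderiv 0 f) := by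
  ext n
  simp only [coeff_pderiv]
  rw [add_right_comm]
  simp
  ring

theorem totalDegree_ofTriangle_le (d : ℕ) (c : ℕ → ℕ → ℝ) : (ofTriangle d c).totalDegree ≤ d := by
  refine totalDegree_le_of_coeff fun n hn => ?_
  rw [coeff_ofTriangle] at hn
  by_contra h
  exact hn (if_neg (by omega))

/-- The restriction of a bivariate polynomial to the line `x = 0`. -/
noncomputable def restrictLine : MvPolynomial (Fin 2) ℝ →ₐ[ℝ] Polynomial ℝ :=
  aeval ![Polynomial.X, 0]

theorem coeff_restrictLine (f : MvPolynomial (Fin 2) ℝ) (n : ℕ) :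
    (restrictLine f).coeff n = coeff (expo 0 n) f := by
  induction f using MvPolynomial.induction_on' with
  | add p q hp hq => simp [hp, hq]
  | monomial m a =>
    rw [restrictLine, aeval_monomial, Finsupp.prod_fintype _ _ (by simp)]
    simp only [Fin.prod_univ_two, coeff_monomial, eq_comm (a := m), expo_eq_iff]
    by_cases h1 : m 1 = 0
    · simp [h1, Polynomial.coeff_X_pow]
    · simp [h1, Ne.symm h1]

theorem restrictLine_pderiv_zero (f : MvPolynomial (Fin 2) ℝ) :
    restrictLine (pderiv 0 f) = Polynomial.derivative (restrictLine f) := by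
  ext n
  rw [coeff_restrictLine, coeff_pderiv, Polynomial.coeff_derivative, coeff_restrictLine]
  have : expo 0 n + Finsupp.single 0 1 = expo 0 (n + 1) := by
    rw [eq_comm, expo_eq_iff]; simp [expo]
  rw [this]; simp [expo]

theorem natDegree_restrictLine_le (f : MvPolynomial (Fin 2) ℝ) :
    (restrictLine f).natDegree ≤ f.totalDegree := by
  rw [Polynomial.natDegree_le_iff_coeff_eq_zero]
  intro n hn
  rw [coeff_restrictLine]
  by_contra h
  have := expo_degree_le h
  simp [expo] at this
  omega

theorem sextic_coeff_ne_zero : coeff (expo 0 6) sextic ≠ 0 := by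
  rw [sextic, coeff_ofTriangle]
  simp [expo, sexticCoeff, sexticData]

theorem totalDegree_sextic : sextic.totalDegree = 6 := by
  refine le_antisymm (totalDegree_ofTriangle_le _ _) ?_
  simpa [expo] using expo_degree_le sextic_coeff_ne_zero

theorem natDegree_restrictLine_sextic : (restrictLine sextic).natDegree = 6 := by
  refine le_antisymm ((natDegree_restrictLine_le _).trans totalDegree_sextic.le) ?_
  apply Polynomial.le_natDegree_of_ne_zero
  rw [coeff_restrictLine]
  exact sextic_coeff_ne_zero

theorem sextic_ne_zero : sextic ≠ 0 := by
  intro h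
  have := totalDegree_sextic
  simp [h] at this

/-- The rational point of the sextic that corresponds to the given initial configuration. -/
theorem eval_sextic_initial : eval ![(4 / 5 : ℝ), 7003716944 / 10000000000] sextic = 0 := by
  rw [sextic, eval_ofTriangle]
  have h : ∑ m ∈ triangle 6, (sexticCoeff m.1 m.2 : ℚ) *
      ((7003716944 / 10000000000) ^ m.1 * (4 / 5) ^ m.2) = 0 := by decide +kernel
  have := congrArg (fun q : ℚ => (q : ℝ)) h
  push_cast at this
  exact this

theorem eval_pderiv_sextic_initial :
    eval ![(4 / 5 : ℝ), 7003716944 / 10000000000] (pderiv 0 sextic) ≠ 0 := by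
  rw [sextic, eval_pderiv_zero_ofTriangle]
  have h : ∑ m ∈ triangle 6, (sexticCoeff m.1 m.2 : ℚ) *
      ((7003716944 / 10000000000) ^ m.1 * (m.2 * (4 / 5) ^ (m.2 - 1))) ≠ 0 := by decide +kernel
  intro h0
  apply h
  rw [← Rat.cast_eq_zero (α := ℝ)]
  push_cast
  exact h0

/-- The sextic is irreducible: a factorization `G * H` gives the solution
`(∂G/∂x * H, ∂G/∂y * H)` of Ruppert's linear system. -/
theorem irreducible_sextic : Irreducible sextic := by
  obtain ⟨s, hs, hprod⟩ := UniqueFactorizationMonoid.exists_prime_factors sextic sextic_ne_zero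
  obtain ⟨u, hu⟩ := hprod
  -- a prime factor that vanishes at the rational point
  have hz : eval ![(4 / 5 : ℝ), 7003716944 / 10000000000] s.prod = 0 := by
    have h1 := eval_sextic_initial
    rw [← hu, map_mul] at h1
    refine (mul_eq_zero.1 h1).resolve_right ?_
    exact ((u.isUnit.map (eval ![(4 / 5 : ℝ), 7003716944 / 10000000000])).ne_zero)
  rw [map_multiset_prod, Multiset.prod_eq_zero_iff, Multiset.mem_map] at hz
  obtain ⟨G, hGs, hG0⟩ := hz
  have hG := hs G hGs
  obtain ⟨H, hH⟩ : G ∣ sextic := by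
    rw [← hu]; exact (Multiset.dvd_prod hGs).mul_right _
  have hne : G ≠ 0 ∧ H ≠ 0 := by
    constructor <;> rintro rfl <;> simp [sextic_ne_zero] at hH
  have hdeg : G.totalDegree + H.totalDegree = 6 := by
    rw [← totalDegree_mul_of_isDomain hne.1 hne.2, ← hH, totalDegree_sextic]
  set k := G.totalDegree with hk
  set g := restrictLine G with hg
  set h := restrictLine H with hh
  have hgh : g * h = restrictLine sextic := by rw [hH, map_mul]
  have hgne : g ≠ 0 ∧ h ≠ 0 := by
    have : restrictLine sextic ≠ 0 := by
      intro h0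
      have := natDegree_restrictLine_sextic
      simp [h0] at this
    rw [← hgh] at this
    exact ⟨left_ne_zero_of_mul this, right_ne_zero_of_mul this⟩
  have hsum : g.natDegree + h.natDegree = 6 := by
    rw [← Polynomial.natDegree_mul hgne.1 hgne.2, hgh, natDegree_restrictLine_sextic]
  have hgk : g.natDegree = k ∧ h.natDegree = H.totalDegree := by
    have h1 := natDegree_restrictLine_le G
    have h2 := natDegree_restrictLine_le H
    simp only [← hg, ← hh] at h1 h2
    omega
  have hkpos : 0 < k := by
    rw [Nat.pos_iff_ne_zero]
    intro h0
    apply hG.not_isUnit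
    rw [totalDegree_eq_zero_iff_eq_C.1 (hk ▸ h0 : G.totalDegree = 0)]
    rw [isUnit_map_iff, isUnit_iff_ne_zero]
    intro hc
    apply hne.1
    rw [totalDegree_eq_zero_iff_eq_C.1 (hk ▸ h0 : G.totalDegree = 0), hc, map_zero]
  -- it suffices to show that the cofactor is constant
  suffices hH0 : H.totalDegree = 0 by
    have hunit : IsUnit H := by
      rw [totalDegree_eq_zero_iff_eq_C.1 hH0, isUnit_map_iff, isUnit_iff_ne_zero]
      intro hc
      apply hne.2
      rw [totalDegree_eq_zero_iff_eq_C.1 hH0, hc, map_zero]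
    rw [hH]
    exact (irreducible_mul_isUnit hunit).2 hG.irreducible
  by_contra hHpos
  have hk6 : k < 6 := by omega
  set r := pderiv 1 G * H - C ((k : ℝ) / 6) * pderiv 1 sextic with hr
  set t := pderiv 0 G * H - C ((k : ℝ) / 6) * pderiv 0 sextic with ht
  have hdegmul (i : Fin 2) : (pderiv i G * H - C ((k : ℝ) / 6) * pderiv i sextic).totalDegree ≤ 5 := by
    refine (totalDegree_sub _ _).trans (max_le ?_ ?_)
    · refine (totalDegree_mul _ _).trans ?_
      have := totalDegree_pderiv_le i G
      omega
    · refine (totalDegree_mul _ _).trans ?_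
      have := totalDegree_pderiv_le i sextic
      rw [totalDegree_sextic] at this
      rw [totalDegree_C]
      omega
  have hlead : coeff (expo 0 5) t = 0 := by
    rw [← coeff_restrictLine, ht, map_sub, map_mul, map_mul, restrictLine_pderiv_zero,
      restrictLine_pderiv_zero, ← hgh, ← hg, ← hh]
    have e1 : (Polynomial.derivative g * h).coeff 5 = k * (g.leadingCoeff * h.leadingCoeff) := by
      have : 5 = (k - 1) + h.natDegree := by omega
      rw [this, Polynomial.coeff_mul_add_eq_of_natDegree_le
        ((Polynomial.natDegree_derivative_le g).trans (by omega)) le_rfl,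
        Polynomial.coeff_derivative, Nat.sub_add_cancel hkpos, ← hgk.1, Polynomial.leadingCoeff,
        Polynomial.leadingCoeff, hgk.1, Nat.cast_sub hkpos]
      push_cast; ring
    have e2 : (Polynomial.derivative (g * h)).coeff 5 = 6 * (g.leadingCoeff * h.leadingCoeff) := by
      rw [Polynomial.coeff_derivative, ← Polynomial.leadingCoeff_mul, Polynomial.leadingCoeff,
        Polynomial.natDegree_mul hgne.1 hgne.2, hsum]
      norm_num; ring
    have e3 : restrictLine (C ((k : ℝ) / 6)) = Polynomial.C ((k : ℝ) / 6) := by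
      simp [restrictLine]
    rw [Polynomial.coeff_sub, e1, e3, Polynomial.coeff_C_mul, e2]
    ring
  have hrup : sextic * (pderiv 0 r - pderiv 1 t) = r * pderiv 0 sextic - t * pderiv 1 sextic := by
    rw [hr, ht]
    simp only [map_sub, pderiv_mul, pderiv_comm, hH, map_add, pderiv_C]
    ring
  obtain ⟨-, ht0⟩ := ruppert_trivial (hdegmul 1) (hdegmul 0) hlead hrup
  have hdvd : G ∣ pderiv 0 G * H := by
    have h6 : C (1 - (k : ℝ) / 6) * (pderiv 0 G * H) = G * (C ((k : ℝ) / 6) * pderiv 0 H) := by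
      have h7 : t = 0 := ht0
      rw [ht, hH, pderiv_mul] at h7
      rw [map_sub, map_one]
      linear_combination h7
    have h8 : IsUnit (C (1 - (k : ℝ) / 6) : MvPolynomial (Fin 2) ℝ) := by
      rw [isUnit_map_iff, isUnit_iff_ne_zero]
      have : (k : ℝ) < 6 := by exact_mod_cast hk6
      intro h0; linarith
    rw [← h8.dvd_mul_left, h6]
    exact dvd_mul_right _ _
  rcases hG.dvd_or_dvd hdvd with h9 | ⟨H', h9⟩
  · have hder : pderiv 0 G ≠ 0 := by
      intro h0
      have h10 := restrictLine_pderiv_zero G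
      rw [h0, map_zero, ← hg] at h10
      have := Polynomial.derivative_eq_zero.1 h10.symm
      omega
    obtain ⟨Q, hQ⟩ := h9
    have hQ0 : Q ≠ 0 := by rintro rfl; simp at hQ; exact hder hQ
    have h11 := totalDegree_mul_of_isDomain hne.1 hQ0
    rw [← hQ] at h11
    have := totalDegree_pderiv_le 0 G
    omega
  · apply eval_pderiv_sextic_initial
    rw [hH, pderiv_mul, map_add, map_mul, map_mul, hG0, h9, map_mul, hG0]
    ring

/-- A polynomial of degree less than six has only finitely many zeros in common with the
irreducible sextic. -/
theorem finite_common_zeros {q : MvPolynomial (Fin 2) ℝ} (hq : q ≠ 0) (hdeg : q.totalDegree < 6) :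
    {p : ℝ × ℝ | eval ![p.2, p.1] sextic = 0 ∧ eval ![p.2, p.1] q = 0}.Finite := by
  set φ := finSuccEquiv ℝ 1 with hφ
  set f := φ sextic with hf
  set g := φ q with hg
  have hfdeg : f.natDegree = 6 := by
    rw [hf, hφ, natDegree_finSuccEquiv]
    refine le_antisymm ((degreeOf_le_totalDegree _ _).trans totalDegree_sextic.le) ?_
    have := monomial_le_degreeOf (0 : Fin 2) (mem_support_iff.2 sextic_coeff_ne_zero)
    simpa [expo] using this
  have hgdeg : g.natDegree < 6 := by
    rw [hg, hφ, natDegree_finSuccEquiv]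
    exact (degreeOf_le_totalDegree _ _).trans_lt hdeg
  have hfirr : Irreducible f := (MulEquiv.irreducible_iff φ).2 irreducible_sextic
  have hg0 : g ≠ 0 := by
    rw [hg]; exact (EmbeddingLike.map_ne_zero_iff).2 hq
  set ι := algebraMap (MvPolynomial (Fin 1) ℝ) (FractionRing (MvPolynomial (Fin 1) ℝ)) with hι
  have hinj : Function.Injective ι := IsFractionRing.injective _ _
  have hcop : IsCoprime (f.map ι) (g.map ι) := by
    have h1 : Irreducible (f.map ι) :=
      ((hfirr.isPrimitive (by rw [hfdeg]; norm_num)).irreducible_iff_irreducible_map_fraction_map).1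
        hfirr
    refine (h1.coprime_iff_not_dvd).2 fun h2 => ?_
    have h3 := Polynomial.natDegree_le_of_dvd h2 ((Polynomial.map_ne_zero_iff hinj).2 hg0)
    rw [Polynomial.natDegree_map_eq_of_injective hinj,
      Polynomial.natDegree_map_eq_of_injective hinj] at h3
    omega
  set R := Polynomial.resultant f g with hR
  have hR0 : R ≠ 0 := by
    have h4 := Polynomial.resultant_ne_zero _ _ hcop
    rw [Polynomial.natDegree_map_eq_of_injective hinj,
      Polynomial.natDegree_map_eq_of_injective hinj, Polynomial.resultant_map_map] at h4
    intro h5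
    apply h4
    rw [← hR, h5, map_zero]
  obtain ⟨a, b, -, -, hab⟩ := Polynomial.exists_mul_add_mul_eq_C_resultant f g le_rfl le_rfl
    (by left; omega)
  have heval (x y : ℝ) (p : MvPolynomial (Fin 2) ℝ) :
      eval ![y, x] p = Polynomial.eval y (Polynomial.map (eval ![x]) (φ p)) := by
    rw [← eval_eq_eval_mv_eval']; rfl
  -- the resultant as a univariate polynomial
  set ρ : Polynomial ℝ := aeval (fun _ : Fin 1 => (Polynomial.X : Polynomial ℝ)) R with hρ
  have hρeval (x : ℝ) : ρ.eval x = eval ![x] R := by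
    have e : (Polynomial.aeval x).comp (aeval fun _ : Fin 1 => (Polynomial.X : Polynomial ℝ)) =
        aeval ![x] := by
      ext i; fin_cases i; simp
    have := DFunLike.congr_fun e R
    simpa [hρ, Polynomial.coe_aeval_eq_eval, MvPolynomial.coe_aeval_eq_eval] using this
  have hρ0 : ρ ≠ 0 := by
    intro h0
    apply hR0
    apply MvPolynomial.funext
    intro v
    have : v = ![v 0] := by funext i; fin_cases i; rfl
    rw [this, ← hρeval, h0]; simp
  have hxfin : {x : ℝ | ρ.eval x = 0}.Finite := Polynomial.finite_setOfPred_isRoot hρ0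
  have hyfin (x : ℝ) : {y : ℝ | eval ![y, x] sextic = 0}.Finite := by
    have h6 : Polynomial.map (eval ![x]) f ≠ 0 := by
      intro h0
      have h7 : (Polynomial.map (eval ![x]) f).coeff 6 = coeff (expo 0 6) sextic := by
        have h8 : f.leadingCoeff = C (coeff (expo 0 6) sextic) := by
          ext m
          rw [Polynomial.leadingCoeff, hfdeg, hf, hφ, finSuccEquiv_coeff_coeff, coeff_C]
          by_cases hm : 0 = m
          · rw [if_pos hm, ← hm]
            congr 1
            rw [eq_comm, expo_eq_iff]
            exact ⟨rfl, rfl⟩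
          · rw [if_neg hm]
            by_contra hne
            have h9 := expo_degree_le hne
            rw [totalDegree_sextic] at h9
            apply hm
            have h10 : (Finsupp.cons 6 m : Fin 2 →₀ ℕ) 1 = m 0 := rfl
            have h11 : (Finsupp.cons 6 m : Fin 2 →₀ ℕ) 0 = 6 := rfl
            rw [h10, h11] at h9
            refine Finsupp.ext fun i => ?_
            rw [Subsingleton.elim i 0, Finsupp.zero_apply]
            omega
        rw [Polynomial.leadingCoeff, hfdeg] at h8
        rw [Polynomial.coeff_map, h8, eval_C]
      rw [h0] at h7
      exact sextic_coeff_ne_zero h7.symm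
    refine (Polynomial.finite_setOfPred_isRoot h6).subset fun y hy => ?_
    rw [Set.mem_ofPred_eq, heval] at hy
    exact hy
  refine ((hxfin.biUnion fun x _ => (hyfin x).image fun y => (x, y))).subset ?_
  rintro ⟨x, y⟩ ⟨h1, h2⟩
  refine Set.mem_biUnion (x := x) ?_ ⟨y, h1, rfl⟩
  have h3 := congrArg (fun P => Polynomial.eval y (Polynomial.map (eval ![x]) P)) hab
  simp only [Polynomial.map_add, Polynomial.map_mul, Polynomial.eval_add, Polynomial.eval_mul,
    Polynomial.map_C, Polynomial.eval_C] at h3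
  rw [hf, hg, ← heval, ← heval, h1, h2] at h3
  rw [Set.mem_ofPred_eq, hρeval, hR, ← h3]
  ring

end Icosapod

namespace Icosapod

/-! ### The web over the integers -/

/-- Scaling factors that make the four basis matrices of the web integral. -/
def webScale : Fin 4 → ℤ :=
  ![31778787934680773542094770000,
    626183013491246769302360,
    562788452208042034393650,
    1]

/-- The integral multiples of the four basis matrices of the web. -/
def webInt : Fin 4 → Fin 4 → Fin 4 → ℤ :=
  ![![![31778787934680773542094770000,
        0,
        0,
        2165173657249446450550760432],
      ![0,
        0,
        -14364452615180436394749585,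
        -217122938250956826667690342],
      ![0,
        -14364452615180436394749585,
        483701177849565006321529515,
        -9442265890154728541341872],
      ![2165173657249446450550760432,
        -217122938250956826667690342,
        -9442265890154728541341872,
        604661424303643792005822699]],
    ![![0,
        626183013491246769302360,
        0,
        281593564792475629142064],
      ![626183013491246769302360,
        0,
        -2179221674656078872765,
        -27122764098369323722030],
      ![0,
        -2179221674656078872765,
        154330951408161825013610,
        -1613178103262434036464],
      ![281593564792475629142064,
        -27122764098369323722030,
        -1613178103262434036464,
        173690882667238054944938]],
    ![![0,
        0,
        562788452208042034393650,
        -70495754567542173124178],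
      ![0,
        0,
        -75869190897105777600660,
        9899191843968448260393],
      ![562788452208042034393650,
        -75869190897105777600660,
        430557682383894720440,
        9495179569422704945088],
      ![-70495754567542173124178,
        9899191843968448260393,
        9495179569422704945088,
        -5563914698964334265896]],
    ![![0,
        0,
        0,
        0],
      ![0,
        1,
        0,
        0],
      ![0,
        0,
        1,
        0],
      ![0,
        0,
        0,
        1]]]

theorem webScale_ne_zero : ∀ k, webScale k ≠ 0 := by decide +kernel

theorem webInt_eq : ∀ k i j : Fin 4,
    (webInt k i j : ℚ) = webScale k * web (fun l => if l = k then (1 : ℚ) else 0) i j := by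
  decide +kernel

theorem web_eq_sum {K : Type} [Field K] [CharZero K] (v : Fin 4 → K) (i j : Fin 4) :
    web v i j = ∑ k, v k / webScale k * (webInt k i j : K) := by
  have h (k : Fin 4) : v k / webScale k * (webInt k i j : K) =
      v k * web (fun l => if l = k then (1 : K) else 0) i j := by
    have h1 := congrArg (fun q : ℚ => (q : K)) (webInt_eq k i j)
    have h2 : ((web (fun l => if l = k then (1 : ℚ) else 0) i j : ℚ) : K) =
        web (fun l => if l = k then (1 : K) else 0) i j := by
      fin_cases k <;> fin_cases i <;> fin_cases j <;> simp [web, webForm]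
    have h3 : (webScale k : K) ≠ 0 := by exact_mod_cast webScale_ne_zero k
    push_cast at h1
    rw [h1, h2]
    field_simp
  simp only [h]
  have h4 : v = ∑ k, v k • (fun l => if l = k then (1 : K) else 0) := by
    funext l; simp
  conv_lhs => rw [h4, ← webMap_apply, map_sum]
  simp [Matrix.sum_apply, webMap]

/-- The exponents of a monomial in four variables. -/
abbrev Exps := ℕ × ℕ × ℕ × ℕ

/-- The value at `w` of the monomial with exponents `n`. -/
def mono {K : Type} [Field K] (n : Exps) (w : Fin 4 → K) : K :=
  w 0 ^ n.1 * w 1 ^ n.2.1 * w 2 ^ n.2.2.1 * w 3 ^ n.2.2.2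

/-- The exponents of the `i`-th variable. -/
def unitExp : Fin 4 → Exps := ![(1, 0, 0, 0), (0, 1, 0, 0), (0, 0, 1, 0), (0, 0, 0, 1)]

theorem mono_add {K : Type} [Field K] (m n : Exps) (w : Fin 4 → K) :
    mono (m + n) w = mono m w * mono n w := by
  simp only [mono, Prod.fst_add, Prod.snd_add, pow_add]
  ring

theorem mono_unitExp {K : Type} [Field K] (i : Fin 4) (w : Fin 4 → K) :
    mono (unitExp i) w = w i := by
  fin_cases i <;> simp [mono, unitExp]

/-- Collecting terms by exponent. -/
theorem sum_collect {K ι : Type} [Field K] [Fintype ι] {N : ℕ} {col : Fin N → Exps}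
    (hcol : Function.Injective col) (s : ι → Exps) (a : ι → ℤ) (g : Exps → K)
    (hg : ∀ t, (∃ c, col c = s t) ∨ g (s t) = 0) :
    ∑ c, ((∑ t, if s t = col c then a t else 0 : ℤ) : K) * g (col c) = ∑ t, (a t : K) * g (s t) := by
  push_cast
  simp only [Finset.sum_mul]
  rw [Finset.sum_comm]
  refine Finset.sum_congr rfl fun t _ => ?_
  by_cases h : ∃ c, col c = s t
  · obtain ⟨c, hc⟩ := h
    rw [Finset.sum_eq_single c]
    · simp [hc]
    · intro c' _ hne
      rw [if_neg]
      · simp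
      · intro h'
        exact hne (hcol (h'.symm.trans hc.symm))
    · simp
  · have h0 := (hg t).resolve_left h
    rw [h0, mul_zero]
    refine Finset.sum_eq_zero fun c _ => ?_
    rw [if_neg fun h' => h ⟨c, h'.symm⟩]
    simp

/-! ### The web of quadrics has no base points -/

/-- The exponents of the quintic monomials in four variables. -/
def quinticExps : List Exps :=
  [(0, 0, 0, 5), (0, 0, 1, 4), (0, 0, 2, 3), (0, 0, 3, 2), (0, 0, 4, 1),
    (0, 0, 5, 0), (0, 1, 0, 4), (0, 1, 1, 3), (0, 1, 2, 2), (0, 1, 3, 1),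
    (0, 1, 4, 0), (0, 2, 0, 3), (0, 2, 1, 2), (0, 2, 2, 1), (0, 2, 3, 0),
    (0, 3, 0, 2), (0, 3, 1, 1), (0, 3, 2, 0), (0, 4, 0, 1), (0, 4, 1, 0),
    (0, 5, 0, 0), (1, 0, 0, 4), (1, 0, 1, 3), (1, 0, 2, 2), (1, 0, 3, 1),
    (1, 0, 4, 0), (1, 1, 0, 3), (1, 1, 1, 2), (1, 1, 2, 1), (1, 1, 3, 0),
    (1, 2, 0, 2), (1, 2, 1, 1), (1, 2, 2, 0), (1, 3, 0, 1), (1, 3, 1, 0),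
    (1, 4, 0, 0), (2, 0, 0, 3), (2, 0, 1, 2), (2, 0, 2, 1), (2, 0, 3, 0),
    (2, 1, 0, 2), (2, 1, 1, 1), (2, 1, 2, 0), (2, 2, 0, 1), (2, 2, 1, 0),
    (2, 3, 0, 0), (3, 0, 0, 2), (3, 0, 1, 1), (3, 0, 2, 0), (3, 1, 0, 1),
    (3, 1, 1, 0), (3, 2, 0, 0), (4, 0, 0, 1), (4, 0, 1, 0), (4, 1, 0, 0),
    (5, 0, 0, 0)]

/-- Pairs of a basis quadric of the web and the exponents of a cubic monomial: the products of
these quadrics and cubics span the quintic forms. -/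
def quinticRows : List (Fin 4 × Exps) :=
  [(3, (0, 0, 0, 3)), (3, (0, 0, 1, 2)), (3, (0, 0, 2, 1)), (3, (0, 0, 3, 0)), (3, (0, 1, 0, 2)),
    (3, (0, 1, 1, 1)), (3, (0, 1, 2, 0)), (3, (0, 2, 0, 1)), (3, (0, 2, 1, 0)), (3, (0, 3, 0, 0)),
    (3, (1, 0, 0, 2)), (3, (1, 0, 1, 1)), (3, (1, 0, 2, 0)), (3, (1, 1, 0, 1)), (3, (1, 1, 1, 0)),
    (3, (1, 2, 0, 0)), (3, (2, 0, 0, 1)), (3, (2, 0, 1, 0)), (3, (2, 1, 0, 0)), (3, (3, 0, 0, 0)),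
    (0, (0, 0, 0, 3)), (0, (0, 0, 1, 2)), (0, (0, 0, 2, 1)), (0, (0, 0, 3, 0)), (0, (0, 1, 0, 2)),
    (0, (0, 1, 1, 1)), (0, (0, 1, 2, 0)), (0, (1, 0, 0, 2)), (0, (1, 0, 1, 1)), (0, (1, 0, 2, 0)),
    (0, (1, 1, 0, 1)), (0, (1, 1, 1, 0)), (0, (2, 0, 0, 1)), (0, (2, 0, 1, 0)), (0, (2, 1, 0, 0)),
    (0, (3, 0, 0, 0)), (1, (0, 0, 0, 3)), (1, (0, 0, 1, 2)), (1, (0, 0, 2, 1)), (1, (0, 0, 3, 0)),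
    (1, (0, 1, 0, 2)), (1, (0, 1, 1, 1)), (1, (0, 1, 2, 0)), (1, (1, 0, 0, 2)), (1, (1, 0, 1, 1)),
    (1, (1, 0, 2, 0)), (1, (1, 1, 0, 1)), (1, (1, 1, 1, 0)), (2, (0, 0, 0, 3)), (2, (0, 0, 1, 2)),
    (2, (0, 0, 2, 1)), (2, (0, 0, 3, 0)), (2, (0, 1, 0, 2)), (2, (0, 1, 1, 1)), (2, (0, 1, 2, 0)),
    (2, (1, 0, 0, 2))]

/-- The columns, modulo `13`, of the matrix with entries `quinticEntry`: its rows are indexed by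
`quinticRows`, its columns by `quinticExps`. -/
def quinticColumns : List (List ℕ) :=
  [[1, 0, 0, 0, 0, 0, 0, 0, 0, 0, 0, 0, 0, 0, 0, 0, 0, 0, 0, 0, 5, 0, 0, 0, 0, 0, 0, 0, 0, 0, 0, 0, 0, 0, 0, 0, 8, 0, 0, 0, 0, 0, 0, 0, 0, 0, 0, 0, 8, 0, 0, 0, 0, 0, 0, 0],
    [0, 1, 0, 0, 0, 0, 0, 0, 0, 0, 0, 0, 0, 0, 0, 0, 0, 0, 0, 0, 2, 5, 0, 0, 0, 0, 0, 0, 0, 0, 0, 0, 0, 0, 0, 0, 1, 8, 0, 0, 0, 0, 0, 0, 0, 0, 0, 0, 4, 8, 0, 0, 0, 0, 0, 0],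
    [1, 0, 1, 0, 0, 0, 0, 0, 0, 0, 0, 0, 0, 0, 0, 0, 0, 0, 0, 0, 2, 2, 5, 0, 0, 0, 0, 0, 0, 0, 0, 0, 0, 0, 0, 0, 10, 1, 8, 0, 0, 0, 0, 0, 0, 0, 0, 0, 6, 4, 8, 0, 0, 0, 0, 0],
    [0, 1, 0, 1, 0, 0, 0, 0, 0, 0, 0, 0, 0, 0, 0, 0, 0, 0, 0, 0, 0, 2, 2, 5, 0, 0, 0, 0, 0, 0, 0, 0, 0, 0, 0, 0, 0, 10, 1, 8, 0, 0, 0, 0, 0, 0, 0, 0, 0, 6, 4, 8, 0, 0, 0, 0],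
    [0, 0, 1, 0, 0, 0, 0, 0, 0, 0, 0, 0, 0, 0, 0, 0, 0, 0, 0, 0, 0, 0, 2, 2, 0, 0, 0, 0, 0, 0, 0, 0, 0, 0, 0, 0, 0, 0, 10, 1, 0, 0, 0, 0, 0, 0, 0, 0, 0, 0, 6, 4, 0, 0, 0, 0],
    [0, 0, 0, 1, 0, 0, 0, 0, 0, 0, 0, 0, 0, 0, 0, 0, 0, 0, 0, 0, 0, 0, 0, 2, 0, 0, 0, 0, 0, 0, 0, 0, 0, 0, 0, 0, 0, 0, 0, 10, 0, 0, 0, 0, 0, 0, 0, 0, 0, 0, 0, 6, 0, 0, 0, 0],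
    [0, 0, 0, 0, 1, 0, 0, 0, 0, 0, 0, 0, 0, 0, 0, 0, 0, 0, 0, 0, 6, 0, 0, 0, 5, 0, 0, 0, 0, 0, 0, 0, 0, 0, 0, 0, 5, 0, 0, 0, 8, 0, 0, 0, 0, 0, 0, 0, 9, 0, 0, 0, 8, 0, 0, 0],
    [0, 0, 0, 0, 0, 1, 0, 0, 0, 0, 0, 0, 0, 0, 0, 0, 0, 0, 0, 0, 12, 6, 0, 0, 2, 5, 0, 0, 0, 0, 0, 0, 0, 0, 0, 0, 6, 5, 0, 0, 1, 8, 0, 0, 0, 0, 0, 0, 6, 9, 0, 0, 4, 8, 0, 0],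
    [0, 0, 0, 0, 1, 0, 1, 0, 0, 0, 0, 0, 0, 0, 0, 0, 0, 0, 0, 0, 0, 12, 6, 0, 2, 2, 5, 0, 0, 0, 0, 0, 0, 0, 0, 0, 0, 6, 5, 0, 10, 1, 8, 0, 0, 0, 0, 0, 0, 6, 9, 0, 6, 4, 8, 0],
    [0, 0, 0, 0, 0, 1, 0, 0, 0, 0, 0, 0, 0, 0, 0, 0, 0, 0, 0, 0, 0, 0, 12, 6, 0, 2, 2, 0, 0, 0, 0, 0, 0, 0, 0, 0, 0, 0, 6, 5, 0, 10, 1, 0, 0, 0, 0, 0, 0, 0, 6, 9, 0, 6, 4, 0],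
    [0, 0, 0, 0, 0, 0, 1, 0, 0, 0, 0, 0, 0, 0, 0, 0, 0, 0, 0, 0, 0, 0, 0, 12, 0, 0, 2, 0, 0, 0, 0, 0, 0, 0, 0, 0, 0, 0, 0, 6, 0, 0, 10, 0, 0, 0, 0, 0, 0, 0, 0, 6, 0, 0, 6, 0],
    [1, 0, 0, 0, 0, 0, 0, 1, 0, 0, 0, 0, 0, 0, 0, 0, 0, 0, 0, 0, 0, 0, 0, 0, 6, 0, 0, 0, 0, 0, 0, 0, 0, 0, 0, 0, 0, 0, 0, 0, 5, 0, 0, 0, 0, 0, 0, 0, 0, 0, 0, 0, 9, 0, 0, 0],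
    [0, 1, 0, 0, 0, 0, 0, 0, 1, 0, 0, 0, 0, 0, 0, 0, 0, 0, 0, 0, 0, 0, 0, 0, 12, 6, 0, 0, 0, 0, 0, 0, 0, 0, 0, 0, 0, 0, 0, 0, 6, 5, 0, 0, 0, 0, 0, 0, 0, 0, 0, 0, 6, 9, 0, 0],
    [0, 0, 1, 0, 0, 0, 0, 1, 0, 0, 0, 0, 0, 0, 0, 0, 0, 0, 0, 0, 0, 0, 0, 0, 0, 12, 6, 0, 0, 0, 0, 0, 0, 0, 0, 0, 0, 0, 0, 0, 0, 6, 5, 0, 0, 0, 0, 0, 0, 0, 0, 0, 0, 6, 9, 0],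
    [0, 0, 0, 1, 0, 0, 0, 0, 1, 0, 0, 0, 0, 0, 0, 0, 0, 0, 0, 0, 0, 0, 0, 0, 0, 0, 12, 0, 0, 0, 0, 0, 0, 0, 0, 0, 0, 0, 0, 0, 0, 0, 6, 0, 0, 0, 0, 0, 0, 0, 0, 0, 0, 0, 6, 0],
    [0, 0, 0, 0, 1, 0, 0, 0, 0, 1, 0, 0, 0, 0, 0, 0, 0, 0, 0, 0, 0, 0, 0, 0, 0, 0, 0, 0, 0, 0, 0, 0, 0, 0, 0, 0, 0, 0, 0, 0, 0, 0, 0, 0, 0, 0, 0, 0, 0, 0, 0, 0, 0, 0, 0, 0],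
    [0, 0, 0, 0, 0, 1, 0, 0, 0, 0, 0, 0, 0, 0, 0, 0, 0, 0, 0, 0, 0, 0, 0, 0, 0, 0, 0, 0, 0, 0, 0, 0, 0, 0, 0, 0, 0, 0, 0, 0, 0, 0, 0, 0, 0, 0, 0, 0, 0, 0, 0, 0, 0, 0, 0, 0],
    [0, 0, 0, 0, 0, 0, 1, 0, 0, 1, 0, 0, 0, 0, 0, 0, 0, 0, 0, 0, 0, 0, 0, 0, 0, 0, 0, 0, 0, 0, 0, 0, 0, 0, 0, 0, 0, 0, 0, 0, 0, 0, 0, 0, 0, 0, 0, 0, 0, 0, 0, 0, 0, 0, 0, 0],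
    [0, 0, 0, 0, 0, 0, 0, 1, 0, 0, 0, 0, 0, 0, 0, 0, 0, 0, 0, 0, 0, 0, 0, 0, 0, 0, 0, 0, 0, 0, 0, 0, 0, 0, 0, 0, 0, 0, 0, 0, 0, 0, 0, 0, 0, 0, 0, 0, 0, 0, 0, 0, 0, 0, 0, 0],
    [0, 0, 0, 0, 0, 0, 0, 0, 1, 0, 0, 0, 0, 0, 0, 0, 0, 0, 0, 0, 0, 0, 0, 0, 0, 0, 0, 0, 0, 0, 0, 0, 0, 0, 0, 0, 0, 0, 0, 0, 0, 0, 0, 0, 0, 0, 0, 0, 0, 0, 0, 0, 0, 0, 0, 0],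
    [0, 0, 0, 0, 0, 0, 0, 0, 0, 1, 0, 0, 0, 0, 0, 0, 0, 0, 0, 0, 0, 0, 0, 0, 0, 0, 0, 0, 0, 0, 0, 0, 0, 0, 0, 0, 0, 0, 0, 0, 0, 0, 0, 0, 0, 0, 0, 0, 0, 0, 0, 0, 0, 0, 0, 0],
    [0, 0, 0, 0, 0, 0, 0, 0, 0, 0, 1, 0, 0, 0, 0, 0, 0, 0, 0, 0, 10, 0, 0, 0, 0, 0, 0, 5, 0, 0, 0, 0, 0, 0, 0, 0, 10, 0, 0, 0, 0, 0, 0, 8, 0, 0, 0, 0, 11, 0, 0, 0, 0, 0, 0, 8],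
    [0, 0, 0, 0, 0, 0, 0, 0, 0, 0, 0, 1, 0, 0, 0, 0, 0, 0, 0, 0, 0, 10, 0, 0, 0, 0, 0, 2, 5, 0, 0, 0, 0, 0, 0, 0, 0, 10, 0, 0, 0, 0, 0, 1, 8, 0, 0, 0, 7, 11, 0, 0, 0, 0, 0, 4],
    [0, 0, 0, 0, 0, 0, 0, 0, 0, 0, 1, 0, 1, 0, 0, 0, 0, 0, 0, 0, 0, 0, 10, 0, 0, 0, 0, 2, 2, 5, 0, 0, 0, 0, 0, 0, 0, 0, 10, 0, 0, 0, 0, 10, 1, 8, 0, 0, 0, 7, 11, 0, 0, 0, 0, 6],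
    [0, 0, 0, 0, 0, 0, 0, 0, 0, 0, 0, 1, 0, 0, 0, 0, 0, 0, 0, 0, 0, 0, 0, 10, 0, 0, 0, 0, 2, 2, 0, 0, 0, 0, 0, 0, 0, 0, 0, 10, 0, 0, 0, 0, 10, 1, 0, 0, 0, 0, 7, 11, 0, 0, 0, 0],
    [0, 0, 0, 0, 0, 0, 0, 0, 0, 0, 0, 0, 1, 0, 0, 0, 0, 0, 0, 0, 0, 0, 0, 0, 0, 0, 0, 0, 0, 2, 0, 0, 0, 0, 0, 0, 0, 0, 0, 0, 0, 0, 0, 0, 0, 10, 0, 0, 0, 0, 0, 7, 0, 0, 0, 0],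
    [0, 0, 0, 0, 0, 0, 0, 0, 0, 0, 0, 0, 0, 1, 0, 0, 0, 0, 0, 0, 0, 0, 0, 0, 10, 0, 0, 6, 0, 0, 5, 0, 0, 0, 0, 0, 10, 0, 0, 0, 10, 0, 0, 5, 0, 0, 8, 0, 0, 0, 0, 0, 11, 0, 0, 9],
    [0, 0, 0, 0, 0, 0, 0, 0, 0, 0, 0, 0, 0, 0, 1, 0, 0, 0, 0, 0, 0, 0, 0, 0, 0, 10, 0, 12, 6, 0, 2, 5, 0, 0, 0, 0, 0, 10, 0, 0, 0, 10, 0, 6, 5, 0, 1, 8, 0, 0, 0, 0, 7, 11, 0, 6],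
    [0, 0, 0, 0, 0, 0, 0, 0, 0, 0, 0, 0, 0, 1, 0, 0, 0, 0, 0, 0, 0, 0, 0, 0, 0, 0, 10, 0, 12, 6, 2, 2, 0, 0, 0, 0, 0, 0, 10, 0, 0, 0, 10, 0, 6, 5, 10, 1, 0, 0, 0, 0, 0, 7, 11, 0],
    [0, 0, 0, 0, 0, 0, 0, 0, 0, 0, 0, 0, 0, 0, 1, 0, 0, 0, 0, 0, 0, 0, 0, 0, 0, 0, 0, 0, 0, 12, 0, 2, 0, 0, 0, 0, 0, 0, 0, 10, 0, 0, 0, 0, 0, 6, 0, 10, 0, 0, 0, 0, 0, 0, 7, 0],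
    [0, 0, 0, 0, 0, 0, 0, 0, 0, 0, 1, 0, 0, 0, 0, 1, 0, 0, 0, 0, 0, 0, 0, 0, 0, 0, 0, 0, 0, 0, 6, 0, 0, 0, 0, 0, 0, 0, 0, 0, 10, 0, 0, 0, 0, 0, 5, 0, 0, 0, 0, 0, 0, 0, 0, 0],
    [0, 0, 0, 0, 0, 0, 0, 0, 0, 0, 0, 1, 0, 0, 0, 0, 0, 0, 0, 0, 0, 0, 0, 0, 0, 0, 0, 0, 0, 0, 12, 6, 0, 0, 0, 0, 0, 0, 0, 0, 0, 10, 0, 0, 0, 0, 6, 5, 0, 0, 0, 0, 0, 0, 0, 0],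
    [0, 0, 0, 0, 0, 0, 0, 0, 0, 0, 0, 0, 1, 0, 0, 1, 0, 0, 0, 0, 0, 0, 0, 0, 0, 0, 0, 0, 0, 0, 0, 12, 0, 0, 0, 0, 0, 0, 0, 0, 0, 0, 10, 0, 0, 0, 0, 6, 0, 0, 0, 0, 0, 0, 0, 0],
    [0, 0, 0, 0, 0, 0, 0, 0, 0, 0, 0, 0, 0, 1, 0, 0, 0, 0, 0, 0, 0, 0, 0, 0, 0, 0, 0, 0, 0, 0, 0, 0, 0, 0, 0, 0, 0, 0, 0, 0, 0, 0, 0, 0, 0, 0, 0, 0, 0, 0, 0, 0, 0, 0, 0, 0],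
    [0, 0, 0, 0, 0, 0, 0, 0, 0, 0, 0, 0, 0, 0, 1, 0, 0, 0, 0, 0, 0, 0, 0, 0, 0, 0, 0, 0, 0, 0, 0, 0, 0, 0, 0, 0, 0, 0, 0, 0, 0, 0, 0, 0, 0, 0, 0, 0, 0, 0, 0, 0, 0, 0, 0, 0],
    [0, 0, 0, 0, 0, 0, 0, 0, 0, 0, 0, 0, 0, 0, 0, 1, 0, 0, 0, 0, 0, 0, 0, 0, 0, 0, 0, 0, 0, 0, 0, 0, 0, 0, 0, 0, 0, 0, 0, 0, 0, 0, 0, 0, 0, 0, 0, 0, 0, 0, 0, 0, 0, 0, 0, 0],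
    [0, 0, 0, 0, 0, 0, 0, 0, 0, 0, 0, 0, 0, 0, 0, 0, 1, 0, 0, 0, 3, 0, 0, 0, 0, 0, 0, 10, 0, 0, 0, 0, 5, 0, 0, 0, 0, 0, 0, 0, 0, 0, 0, 10, 0, 0, 0, 0, 0, 0, 0, 0, 0, 0, 0, 11],
    [0, 0, 0, 0, 0, 0, 0, 0, 0, 0, 0, 0, 0, 0, 0, 0, 0, 1, 0, 0, 0, 3, 0, 0, 0, 0, 0, 0, 10, 0, 0, 0, 2, 5, 0, 0, 0, 0, 0, 0, 0, 0, 0, 0, 10, 0, 0, 0, 0, 0, 0, 0, 0, 0, 0, 7],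
    [0, 0, 0, 0, 0, 0, 0, 0, 0, 0, 0, 0, 0, 0, 0, 0, 1, 0, 0, 0, 0, 0, 3, 0, 0, 0, 0, 0, 0, 10, 0, 0, 2, 2, 0, 0, 0, 0, 0, 0, 0, 0, 0, 0, 0, 10, 0, 0, 0, 0, 0, 0, 0, 0, 0, 0],
    [0, 0, 0, 0, 0, 0, 0, 0, 0, 0, 0, 0, 0, 0, 0, 0, 0, 1, 0, 0, 0, 0, 0, 3, 0, 0, 0, 0, 0, 0, 0, 0, 0, 2, 0, 0, 0, 0, 0, 0, 0, 0, 0, 0, 0, 0, 0, 0, 0, 0, 0, 0, 0, 0, 0, 0],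
    [0, 0, 0, 0, 0, 0, 0, 0, 0, 0, 0, 0, 0, 0, 0, 0, 0, 0, 1, 0, 0, 0, 0, 0, 3, 0, 0, 0, 0, 0, 10, 0, 6, 0, 5, 0, 0, 0, 0, 0, 0, 0, 0, 10, 0, 0, 10, 0, 0, 0, 0, 0, 0, 0, 0, 0],
    [0, 0, 0, 0, 0, 0, 0, 0, 0, 0, 0, 0, 0, 0, 0, 0, 0, 0, 0, 0, 0, 0, 0, 0, 0, 3, 0, 0, 0, 0, 0, 10, 12, 6, 2, 0, 0, 0, 0, 0, 0, 0, 0, 0, 10, 0, 0, 10, 0, 0, 0, 0, 0, 0, 0, 0],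
    [0, 0, 0, 0, 0, 0, 0, 0, 0, 0, 0, 0, 0, 0, 0, 0, 0, 0, 1, 0, 0, 0, 0, 0, 0, 0, 3, 0, 0, 0, 0, 0, 0, 12, 2, 0, 0, 0, 0, 0, 0, 0, 0, 0, 0, 10, 0, 0, 0, 0, 0, 0, 0, 0, 0, 0],
    [0, 0, 0, 0, 0, 0, 0, 0, 0, 0, 0, 0, 0, 0, 0, 0, 1, 0, 0, 0, 0, 0, 0, 0, 0, 0, 0, 0, 0, 0, 0, 0, 0, 0, 6, 0, 0, 0, 0, 0, 0, 0, 0, 0, 0, 0, 10, 0, 0, 0, 0, 0, 0, 0, 0, 0],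
    [0, 0, 0, 0, 0, 0, 0, 0, 0, 0, 0, 0, 0, 0, 0, 0, 0, 1, 0, 0, 0, 0, 0, 0, 0, 0, 0, 0, 0, 0, 0, 0, 0, 0, 12, 0, 0, 0, 0, 0, 0, 0, 0, 0, 0, 0, 0, 10, 0, 0, 0, 0, 0, 0, 0, 0],
    [0, 0, 0, 0, 0, 0, 0, 0, 0, 0, 0, 0, 0, 0, 0, 0, 0, 0, 1, 0, 0, 0, 0, 0, 0, 0, 0, 0, 0, 0, 0, 0, 0, 0, 0, 0, 0, 0, 0, 0, 0, 0, 0, 0, 0, 0, 0, 0, 0, 0, 0, 0, 0, 0, 0, 0],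
    [0, 0, 0, 0, 0, 0, 0, 0, 0, 0, 0, 0, 0, 0, 0, 0, 0, 0, 0, 1, 0, 0, 0, 0, 0, 0, 0, 3, 0, 0, 0, 0, 10, 0, 0, 5, 0, 0, 0, 0, 0, 0, 0, 0, 0, 0, 0, 0, 0, 0, 0, 0, 0, 0, 0, 0],
    [0, 0, 0, 0, 0, 0, 0, 0, 0, 0, 0, 0, 0, 0, 0, 0, 0, 0, 0, 0, 0, 0, 0, 0, 0, 0, 0, 0, 3, 0, 0, 0, 0, 10, 0, 2, 0, 0, 0, 0, 0, 0, 0, 0, 0, 0, 0, 0, 0, 0, 0, 0, 0, 0, 0, 0],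
    [0, 0, 0, 0, 0, 0, 0, 0, 0, 0, 0, 0, 0, 0, 0, 0, 0, 0, 0, 1, 0, 0, 0, 0, 0, 0, 0, 0, 0, 3, 0, 0, 0, 0, 0, 2, 0, 0, 0, 0, 0, 0, 0, 0, 0, 0, 0, 0, 0, 0, 0, 0, 0, 0, 0, 0],
    [0, 0, 0, 0, 0, 0, 0, 0, 0, 0, 0, 0, 0, 0, 0, 0, 0, 0, 0, 0, 0, 0, 0, 0, 0, 0, 0, 0, 0, 0, 3, 0, 0, 0, 10, 6, 0, 0, 0, 0, 0, 0, 0, 0, 0, 0, 0, 0, 0, 0, 0, 0, 0, 0, 0, 0],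
    [0, 0, 0, 0, 0, 0, 0, 0, 0, 0, 0, 0, 0, 0, 0, 0, 0, 0, 0, 0, 0, 0, 0, 0, 0, 0, 0, 0, 0, 0, 0, 3, 0, 0, 0, 12, 0, 0, 0, 0, 0, 0, 0, 0, 0, 0, 0, 0, 0, 0, 0, 0, 0, 0, 0, 0],
    [0, 0, 0, 0, 0, 0, 0, 0, 0, 0, 0, 0, 0, 0, 0, 0, 0, 0, 0, 1, 0, 0, 0, 0, 0, 0, 0, 0, 0, 0, 0, 0, 0, 0, 0, 0, 0, 0, 0, 0, 0, 0, 0, 0, 0, 0, 0, 0, 0, 0, 0, 0, 0, 0, 0, 0],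
    [0, 0, 0, 0, 0, 0, 0, 0, 0, 0, 0, 0, 0, 0, 0, 0, 0, 0, 0, 0, 0, 0, 0, 0, 0, 0, 0, 0, 0, 0, 0, 0, 3, 0, 0, 10, 0, 0, 0, 0, 0, 0, 0, 0, 0, 0, 0, 0, 0, 0, 0, 0, 0, 0, 0, 0],
    [0, 0, 0, 0, 0, 0, 0, 0, 0, 0, 0, 0, 0, 0, 0, 0, 0, 0, 0, 0, 0, 0, 0, 0, 0, 0, 0, 0, 0, 0, 0, 0, 0, 3, 0, 0, 0, 0, 0, 0, 0, 0, 0, 0, 0, 0, 0, 0, 0, 0, 0, 0, 0, 0, 0, 0],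
    [0, 0, 0, 0, 0, 0, 0, 0, 0, 0, 0, 0, 0, 0, 0, 0, 0, 0, 0, 0, 0, 0, 0, 0, 0, 0, 0, 0, 0, 0, 0, 0, 0, 0, 3, 0, 0, 0, 0, 0, 0, 0, 0, 0, 0, 0, 0, 0, 0, 0, 0, 0, 0, 0, 0, 0],
    [0, 0, 0, 0, 0, 0, 0, 0, 0, 0, 0, 0, 0, 0, 0, 0, 0, 0, 0, 0, 0, 0, 0, 0, 0, 0, 0, 0, 0, 0, 0, 0, 0, 0, 0, 3, 0, 0, 0, 0, 0, 0, 0, 0, 0, 0, 0, 0, 0, 0, 0, 0, 0, 0, 0, 0]]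

/-- The rows of the inverse, modulo `13`, of the matrix with columns `quinticColumns`. -/
def quinticInverse : List (List ℕ) :=
  [[5, 1, 3, 2, 0, 0, 0, 0, 0, 0, 1, 2, 5, 0, 0, 0, 12, 9, 0, 0, 5, 6, 1, 10, 5, 1, 5, 0, 0, 0, 0, 0, 0, 0, 0, 0, 3, 1, 9, 4, 7, 5, 12, 1, 11, 5, 4, 3, 8, 9, 8, 7, 11, 11, 8, 12],
    [11, 9, 10, 3, 0, 0, 0, 0, 0, 0, 1, 6, 7, 0, 0, 0, 8, 5, 0, 0, 10, 5, 5, 7, 10, 1, 12, 0, 0, 0, 0, 0, 0, 0, 0, 0, 6, 12, 9, 9, 12, 0, 10, 3, 8, 12, 7, 6, 1, 11, 2, 6, 10, 5, 11, 8],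
    [9, 5, 10, 3, 0, 0, 0, 0, 0, 0, 9, 11, 10, 0, 0, 0, 11, 4, 0, 0, 2, 6, 3, 3, 0, 11, 11, 0, 0, 0, 0, 0, 0, 0, 0, 0, 7, 5, 4, 4, 12, 6, 6, 5, 1, 11, 8, 10, 2, 11, 6, 7, 1, 9, 4, 1],
    [11, 8, 6, 2, 0, 0, 0, 0, 0, 0, 5, 4, 11, 0, 0, 0, 2, 7, 0, 0, 9, 5, 11, 2, 1, 12, 3, 0, 0, 0, 0, 0, 0, 0, 0, 0, 7, 10, 7, 7, 10, 8, 4, 9, 1, 3, 5, 11, 12, 6, 4, 9, 7, 0, 7, 1],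
    [8, 2, 6, 10, 0, 0, 0, 0, 0, 0, 3, 6, 6, 0, 0, 0, 6, 8, 0, 0, 7, 3, 12, 6, 9, 11, 1, 0, 0, 0, 0, 0, 0, 0, 0, 0, 11, 12, 8, 4, 0, 9, 3, 7, 4, 1, 2, 7, 8, 8, 7, 7, 9, 7, 2, 3],
    [0, 12, 4, 9, 0, 0, 0, 0, 0, 0, 6, 6, 3, 0, 0, 0, 0, 10, 0, 0, 5, 7, 9, 1, 2, 9, 9, 0, 0, 0, 0, 0, 0, 0, 0, 0, 7, 7, 1, 4, 2, 9, 12, 2, 10, 9, 0, 12, 11, 12, 5, 9, 12, 6, 1, 11],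
    [5, 9, 5, 12, 0, 0, 0, 0, 0, 0, 12, 4, 12, 0, 0, 0, 12, 8, 0, 0, 7, 4, 6, 6, 3, 8, 10, 0, 0, 0, 0, 0, 0, 0, 0, 0, 7, 7, 4, 2, 2, 8, 5, 12, 1, 10, 4, 7, 1, 9, 1, 10, 5, 8, 12, 5],
    [5, 7, 12, 1, 0, 0, 0, 0, 0, 0, 9, 2, 2, 0, 0, 0, 6, 9, 0, 0, 3, 7, 5, 10, 7, 0, 7, 0, 0, 0, 0, 0, 0, 0, 0, 0, 6, 5, 6, 5, 2, 1, 11, 5, 10, 7, 2, 3, 11, 12, 11, 12, 11, 11, 3, 0],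
    [6, 12, 6, 0, 0, 0, 0, 0, 0, 0, 4, 1, 12, 0, 0, 0, 7, 9, 0, 0, 4, 7, 11, 10, 12, 10, 9, 0, 0, 0, 0, 0, 0, 0, 0, 0, 12, 6, 1, 6, 11, 10, 10, 1, 7, 9, 11, 3, 1, 3, 4, 4, 4, 11, 11, 8],
    [2, 10, 10, 9, 0, 0, 0, 0, 0, 0, 0, 9, 6, 0, 0, 0, 0, 7, 0, 0, 6, 0, 2, 2, 7, 12, 2, 0, 0, 0, 0, 0, 0, 0, 0, 0, 8, 1, 11, 0, 0, 4, 11, 7, 1, 2, 0, 11, 1, 11, 9, 0, 11, 11, 3, 5],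
    [0, 9, 3, 3, 0, 0, 0, 0, 0, 0, 10, 1, 3, 0, 0, 0, 11, 1, 0, 0, 4, 7, 2, 4, 10, 8, 10, 0, 0, 0, 0, 0, 0, 0, 0, 0, 9, 6, 12, 12, 8, 1, 6, 2, 12, 10, 8, 9, 8, 10, 11, 2, 12, 4, 6, 2],
    [0, 7, 0, 8, 0, 0, 0, 0, 0, 0, 3, 0, 11, 0, 0, 0, 3, 0, 0, 0, 6, 1, 9, 0, 8, 1, 10, 0, 0, 0, 0, 0, 0, 0, 0, 0, 3, 7, 0, 5, 7, 2, 8, 7, 1, 10, 1, 0, 3, 6, 12, 12, 1, 6, 1, 0],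
    [4, 10, 10, 8, 0, 0, 0, 0, 0, 0, 7, 3, 8, 0, 0, 0, 3, 1, 0, 0, 7, 3, 10, 4, 2, 0, 11, 0, 0, 0, 0, 0, 0, 0, 0, 0, 0, 4, 10, 10, 4, 5, 12, 1, 4, 11, 1, 9, 0, 9, 7, 11, 9, 8, 8, 4],
    [9, 6, 11, 0, 0, 0, 0, 0, 0, 0, 1, 9, 10, 0, 0, 0, 9, 1, 0, 0, 4, 4, 11, 4, 4, 4, 1, 0, 0, 0, 0, 0, 0, 0, 0, 0, 8, 9, 1, 5, 1, 11, 4, 1, 8, 1, 3, 9, 3, 7, 0, 12, 3, 10, 7, 9],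
    [2, 6, 3, 3, 0, 0, 0, 0, 0, 0, 2, 3, 12, 0, 0, 0, 11, 9, 0, 0, 12, 1, 6, 10, 10, 5, 1, 0, 0, 0, 0, 0, 0, 0, 0, 0, 12, 9, 5, 2, 1, 9, 10, 2, 2, 1, 8, 3, 3, 8, 4, 8, 7, 7, 5, 1],
    [2, 5, 2, 1, 1, 0, 0, 0, 0, 0, 10, 8, 2, 0, 0, 0, 7, 9, 0, 0, 2, 2, 9, 10, 11, 8, 7, 0, 0, 0, 0, 0, 0, 0, 0, 0, 7, 0, 8, 5, 0, 8, 11, 0, 5, 7, 11, 3, 11, 1, 8, 12, 4, 7, 3, 0],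
    [6, 9, 4, 3, 0, 1, 0, 0, 0, 0, 4, 2, 5, 0, 0, 0, 7, 10, 0, 0, 4, 6, 6, 1, 12, 1, 4, 0, 0, 0, 0, 0, 0, 0, 0, 0, 12, 7, 9, 8, 11, 8, 4, 1, 2, 4, 11, 12, 1, 3, 6, 1, 4, 4, 7, 8],
    [7, 5, 4, 10, 0, 0, 1, 0, 0, 0, 12, 11, 11, 0, 0, 0, 8, 3, 0, 0, 5, 12, 0, 12, 4, 8, 7, 0, 0, 0, 0, 0, 0, 0, 0, 0, 5, 1, 0, 8, 7, 2, 10, 10, 7, 7, 7, 1, 4, 0, 11, 7, 10, 11, 9, 3],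
    [4, 0, 2, 5, 0, 0, 0, 1, 0, 0, 9, 4, 5, 0, 0, 0, 1, 12, 0, 0, 3, 8, 6, 9, 1, 8, 2, 0, 0, 0, 0, 0, 0, 0, 0, 0, 2, 10, 12, 3, 5, 0, 1, 5, 4, 2, 9, 4, 7, 0, 1, 2, 9, 10, 5, 4],
    [7, 10, 0, 2, 0, 0, 0, 0, 1, 0, 4, 7, 6, 0, 0, 0, 12, 3, 0, 0, 7, 9, 10, 12, 1, 8, 1, 0, 0, 0, 0, 0, 0, 0, 0, 0, 1, 0, 11, 1, 8, 12, 4, 10, 7, 1, 4, 1, 10, 9, 2, 7, 10, 11, 0, 8],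
    [4, 3, 7, 2, 12, 0, 12, 0, 0, 1, 4, 7, 0, 0, 0, 0, 11, 1, 0, 0, 6, 12, 4, 4, 11, 10, 12, 0, 0, 0, 0, 0, 0, 0, 0, 0, 1, 12, 5, 0, 6, 3, 5, 3, 1, 12, 8, 9, 11, 12, 7, 7, 12, 8, 1, 10],
    [3, 12, 6, 2, 0, 0, 0, 0, 0, 0, 4, 5, 2, 0, 0, 0, 5, 10, 0, 0, 5, 1, 0, 1, 11, 7, 6, 0, 0, 0, 0, 0, 0, 0, 0, 0, 3, 4, 4, 9, 7, 12, 3, 5, 8, 6, 6, 12, 0, 2, 6, 6, 0, 7, 2, 9],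
    [2, 5, 10, 0, 0, 0, 0, 0, 0, 0, 2, 11, 6, 0, 0, 0, 7, 11, 0, 0, 12, 4, 0, 5, 6, 1, 11, 0, 0, 0, 0, 0, 0, 0, 0, 0, 11, 9, 11, 3, 6, 0, 5, 8, 6, 11, 11, 8, 4, 1, 9, 2, 4, 0, 12, 3],
    [12, 3, 12, 3, 0, 0, 0, 0, 0, 0, 1, 11, 1, 0, 0, 0, 12, 7, 0, 0, 0, 8, 10, 2, 11, 0, 1, 0, 0, 0, 0, 0, 0, 0, 0, 0, 11, 3, 2, 6, 7, 4, 5, 7, 2, 1, 4, 11, 7, 3, 0, 4, 12, 12, 12, 2],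
    [4, 2, 8, 6, 0, 0, 0, 0, 0, 0, 11, 2, 7, 0, 0, 0, 9, 8, 0, 0, 6, 7, 6, 6, 5, 0, 9, 0, 0, 0, 0, 0, 0, 0, 0, 0, 4, 4, 6, 8, 0, 1, 12, 2, 6, 9, 3, 7, 8, 0, 0, 1, 2, 10, 8, 4],
    [0, 4, 1, 9, 0, 0, 0, 0, 0, 0, 8, 1, 1, 0, 0, 0, 6, 1, 0, 0, 11, 3, 0, 4, 0, 2, 2, 0, 0, 0, 0, 0, 0, 0, 0, 0, 0, 2, 1, 8, 6, 2, 1, 11, 6, 2, 2, 9, 11, 2, 7, 12, 1, 4, 0, 3],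
    [6, 9, 6, 6, 0, 0, 0, 0, 0, 0, 2, 2, 6, 0, 0, 0, 3, 4, 0, 0, 10, 1, 4, 3, 3, 7, 5, 0, 0, 0, 0, 0, 0, 0, 0, 0, 6, 2, 3, 1, 11, 2, 9, 2, 10, 5, 1, 10, 0, 6, 12, 5, 10, 7, 6, 7],
    [5, 5, 7, 0, 0, 0, 0, 0, 0, 0, 0, 10, 2, 0, 0, 0, 1, 8, 0, 0, 2, 6, 12, 6, 12, 9, 8, 0, 0, 0, 0, 0, 0, 0, 0, 0, 4, 0, 2, 1, 2, 7, 6, 3, 2, 8, 9, 7, 12, 0, 12, 5, 12, 9, 4, 12],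
    [0, 12, 6, 5, 0, 0, 0, 0, 0, 0, 11, 3, 12, 0, 0, 0, 2, 1, 0, 0, 7, 1, 12, 4, 10, 11, 4, 0, 0, 0, 0, 0, 0, 0, 0, 0, 9, 5, 9, 0, 12, 0, 9, 5, 2, 4, 5, 9, 11, 4, 9, 0, 4, 2, 6, 4],
    [1, 8, 7, 6, 0, 0, 0, 0, 0, 0, 0, 0, 7, 0, 0, 0, 3, 4, 0, 0, 3, 10, 4, 3, 0, 2, 5, 0, 0, 0, 0, 0, 0, 0, 0, 0, 8, 3, 9, 10, 6, 10, 5, 12, 5, 5, 1, 10, 3, 6, 6, 3, 11, 4, 10, 1],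
    [11, 11, 8, 8, 0, 0, 0, 0, 0, 0, 9, 10, 10, 0, 0, 0, 9, 9, 0, 0, 8, 4, 3, 10, 4, 6, 6, 0, 0, 0, 0, 0, 0, 0, 0, 0, 12, 6, 7, 11, 12, 10, 5, 1, 3, 6, 3, 3, 6, 8, 7, 3, 1, 7, 12, 2],
    [7, 6, 8, 7, 0, 0, 0, 0, 0, 0, 0, 1, 0, 0, 0, 0, 10, 7, 0, 0, 8, 2, 7, 2, 2, 12, 6, 0, 0, 0, 0, 0, 0, 0, 0, 0, 11, 0, 9, 2, 7, 12, 9, 3, 1, 6, 12, 11, 1, 12, 4, 10, 7, 3, 6, 6],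
    [1, 6, 0, 1, 0, 0, 0, 0, 0, 0, 4, 1, 12, 0, 0, 0, 8, 5, 0, 0, 2, 2, 3, 7, 2, 11, 10, 0, 0, 0, 0, 0, 0, 0, 0, 0, 2, 8, 10, 12, 0, 7, 7, 8, 5, 10, 7, 6, 8, 8, 6, 10, 0, 10, 1, 8],
    [7, 5, 1, 2, 0, 0, 0, 0, 0, 0, 0, 8, 8, 1, 0, 0, 8, 8, 0, 0, 9, 11, 10, 6, 0, 8, 4, 0, 0, 0, 0, 0, 0, 0, 0, 0, 11, 6, 1, 12, 3, 11, 8, 6, 1, 4, 7, 7, 2, 3, 5, 8, 12, 4, 1, 2],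
    [7, 0, 12, 7, 0, 0, 0, 0, 0, 0, 0, 3, 4, 0, 1, 0, 9, 1, 0, 0, 8, 10, 10, 4, 1, 2, 0, 0, 0, 0, 0, 0, 0, 0, 0, 0, 1, 10, 2, 2, 5, 9, 2, 11, 6, 0, 3, 9, 11, 7, 8, 5, 3, 0, 12, 0],
    [1, 9, 5, 4, 0, 0, 0, 0, 0, 0, 0, 2, 4, 0, 0, 1, 9, 12, 0, 0, 3, 7, 7, 9, 7, 9, 10, 0, 0, 0, 0, 0, 0, 0, 0, 0, 12, 12, 9, 3, 1, 9, 1, 4, 5, 10, 3, 4, 12, 10, 0, 0, 12, 9, 0, 3],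
    [12, 7, 12, 10, 0, 0, 0, 0, 0, 0, 5, 9, 11, 0, 0, 0, 11, 2, 0, 0, 2, 4, 0, 8, 1, 3, 8, 0, 0, 0, 0, 0, 0, 0, 0, 0, 12, 9, 9, 0, 2, 10, 5, 6, 11, 8, 8, 5, 8, 6, 2, 0, 7, 6, 12, 12],
    [10, 6, 4, 7, 0, 0, 0, 0, 0, 0, 9, 9, 2, 0, 0, 0, 10, 2, 0, 0, 5, 3, 2, 8, 9, 9, 1, 0, 0, 0, 0, 0, 0, 0, 0, 0, 1, 10, 3, 3, 10, 5, 2, 10, 4, 1, 12, 5, 6, 9, 0, 2, 9, 2, 10, 4],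
    [12, 2, 9, 6, 0, 0, 0, 0, 0, 0, 3, 0, 3, 0, 0, 0, 9, 5, 0, 0, 6, 9, 12, 7, 0, 11, 6, 0, 0, 0, 0, 0, 0, 0, 0, 0, 5, 3, 0, 6, 6, 3, 0, 10, 5, 6, 3, 6, 6, 12, 8, 4, 4, 0, 0, 5],
    [11, 10, 7, 12, 0, 0, 0, 0, 0, 0, 0, 0, 2, 0, 0, 0, 1, 1, 0, 0, 7, 3, 5, 0, 7, 6, 1, 0, 0, 0, 0, 0, 0, 0, 0, 0, 2, 5, 5, 8, 2, 7, 10, 11, 10, 1, 9, 9, 2, 10, 10, 2, 6, 11, 12, 1],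
    [9, 1, 2, 11, 0, 0, 0, 0, 0, 0, 0, 3, 5, 0, 0, 0, 4, 5, 0, 0, 10, 10, 12, 7, 5, 11, 9, 0, 0, 0, 0, 0, 0, 0, 0, 0, 11, 5, 8, 1, 8, 5, 5, 12, 5, 9, 10, 6, 6, 11, 9, 5, 10, 0, 12, 12],
    [8, 4, 12, 11, 0, 0, 0, 0, 0, 0, 12, 10, 0, 0, 0, 0, 5, 11, 0, 0, 8, 11, 9, 5, 11, 9, 2, 0, 0, 0, 0, 0, 0, 0, 0, 0, 5, 8, 12, 5, 1, 7, 3, 5, 5, 2, 6, 8, 2, 7, 10, 12, 10, 11, 2, 7],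
    [6, 4, 1, 11, 0, 0, 0, 0, 0, 0, 5, 8, 9, 0, 0, 0, 12, 12, 0, 0, 7, 3, 10, 9, 0, 5, 10, 0, 0, 0, 0, 0, 0, 0, 0, 0, 9, 10, 9, 3, 4, 0, 11, 9, 1, 1, 4, 4, 7, 4, 12, 1, 0, 8, 4, 3],
    [2, 4, 5, 10, 0, 0, 0, 0, 0, 0, 5, 4, 12, 0, 0, 0, 7, 6, 0, 0, 5, 0, 1, 11, 12, 12, 12, 0, 0, 0, 0, 0, 0, 0, 0, 0, 9, 1, 4, 7, 5, 0, 8, 10, 10, 12, 2, 2, 12, 8, 3, 9, 2, 7, 1, 9],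
    [5, 10, 2, 7, 0, 0, 0, 0, 0, 0, 4, 4, 9, 0, 0, 0, 2, 11, 0, 0, 1, 7, 6, 5, 10, 11, 11, 0, 0, 0, 0, 0, 0, 0, 0, 0, 10, 11, 5, 2, 1, 1, 1, 5, 12, 11, 5, 12, 5, 7, 3, 9, 11, 0, 4, 8],
    [11, 8, 10, 4, 0, 0, 0, 0, 0, 0, 8, 2, 12, 0, 0, 0, 10, 9, 1, 0, 9, 0, 4, 10, 8, 10, 7, 0, 0, 0, 0, 0, 0, 0, 0, 0, 6, 11, 9, 9, 1, 8, 10, 5, 7, 3, 12, 3, 0, 11, 5, 7, 3, 5, 10, 11],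
    [9, 0, 8, 10, 0, 0, 0, 0, 0, 0, 1, 7, 9, 0, 0, 0, 6, 7, 0, 0, 1, 3, 11, 2, 4, 10, 0, 9, 0, 0, 0, 0, 0, 0, 0, 0, 12, 12, 10, 12, 8, 3, 12, 2, 12, 0, 2, 11, 9, 1, 5, 8, 2, 10, 8, 1],
    [12, 10, 1, 7, 0, 0, 0, 0, 0, 0, 10, 2, 4, 0, 0, 0, 9, 10, 0, 0, 1, 5, 6, 1, 11, 6, 9, 0, 9, 0, 0, 0, 0, 0, 0, 0, 11, 5, 0, 4, 4, 5, 8, 8, 7, 9, 3, 12, 8, 11, 3, 7, 5, 9, 1, 7],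
    [7, 2, 8, 9, 0, 0, 0, 0, 0, 0, 10, 4, 9, 0, 0, 0, 2, 4, 0, 0, 12, 12, 12, 3, 6, 10, 8, 0, 0, 9, 0, 0, 0, 0, 0, 0, 12, 11, 3, 6, 3, 2, 10, 1, 0, 8, 5, 10, 4, 4, 9, 7, 8, 7, 5, 11],
    [2, 11, 9, 10, 0, 0, 0, 0, 0, 0, 6, 6, 9, 0, 0, 0, 4, 7, 0, 0, 0, 5, 3, 2, 4, 4, 0, 0, 0, 0, 9, 0, 0, 0, 0, 0, 11, 8, 2, 12, 2, 7, 12, 11, 6, 0, 10, 11, 5, 8, 10, 8, 9, 7, 8, 5],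
    [7, 7, 6, 3, 0, 0, 0, 0, 0, 0, 6, 7, 1, 0, 0, 0, 0, 8, 0, 0, 0, 12, 0, 6, 7, 4, 0, 0, 0, 0, 0, 9, 0, 0, 0, 0, 9, 1, 8, 1, 2, 6, 7, 7, 1, 0, 0, 7, 8, 5, 0, 11, 5, 11, 12, 9],
    [10, 11, 10, 7, 0, 0, 0, 0, 0, 0, 2, 2, 8, 0, 0, 0, 5, 2, 0, 1, 0, 11, 3, 8, 3, 6, 5, 4, 0, 4, 0, 0, 0, 0, 0, 0, 2, 3, 0, 8, 2, 8, 4, 10, 1, 5, 6, 5, 0, 8, 12, 11, 3, 9, 0, 1],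
    [11, 4, 1, 1, 0, 0, 0, 0, 0, 0, 6, 5, 12, 0, 0, 0, 12, 10, 0, 0, 12, 11, 11, 1, 3, 3, 8, 9, 0, 0, 0, 0, 9, 0, 0, 0, 11, 7, 7, 10, 0, 8, 2, 4, 1, 8, 4, 12, 11, 5, 12, 11, 4, 11, 10, 1],
    [5, 7, 12, 4, 0, 0, 0, 0, 0, 0, 1, 0, 9, 0, 0, 0, 10, 2, 0, 0, 5, 10, 7, 2, 4, 11, 2, 0, 9, 0, 0, 0, 0, 9, 0, 0, 2, 5, 1, 11, 3, 2, 0, 5, 11, 12, 12, 5, 4, 12, 1, 2, 11, 5, 4, 5],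
    [10, 8, 5, 7, 0, 0, 0, 0, 0, 0, 12, 4, 4, 0, 0, 0, 3, 1, 0, 0, 7, 3, 5, 4, 11, 8, 0, 0, 0, 0, 9, 0, 0, 0, 9, 0, 12, 11, 3, 9, 6, 3, 9, 11, 8, 6, 6, 6, 10, 12, 10, 2, 7, 2, 5, 2],
    [12, 11, 9, 11, 0, 0, 0, 0, 0, 0, 7, 10, 1, 0, 0, 0, 4, 8, 0, 0, 6, 6, 5, 6, 1, 8, 1, 7, 7, 7, 8, 3, 9, 0, 0, 9, 0, 4, 0, 3, 9, 8, 9, 1, 8, 1, 10, 7, 11, 5, 6, 2, 6, 8, 11, 2]]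

/-- The exponents of the `c`-th quintic monomial. -/
def quinticExp (c : Fin 56) : Exps := quinticExps.getD c 0

/-- The `c`-th pair of a basis quadric and a cubic monomial. -/
def quinticRow (c : Fin 56) : Fin 4 × Exps := quinticRows.getD c (0, 0)

/-- The coefficient of the monomial `n` in the product of the monomial `m` and the `k`-th basis
quadric. -/
def quinticEntry (k : Fin 4) (m n : Exps) : ℤ :=
  ∑ t : Fin 4 × Fin 4, if m + unitExp t.1 + unitExp t.2 = n then webInt k t.1 t.2 else 0

theorem isModInverse_quintic : IsModInverse 13 56 quinticInverse quinticColumns := by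
  unfold IsModInverse; decide +kernel

theorem quinticEntry_modEq : ∀ r c : Fin 56,
    quinticEntry (quinticRow r).1 (quinticRow r).2 (quinticExp c) ≡
      ((quinticColumns.getD c []).getD r 0 : ℕ) [ZMOD 13] := by
  unfold Int.ModEq; decide +kernel

theorem quinticExp_injective : Function.Injective quinticExp := by
  unfold Function.Injective; decide +kernel

theorem quinticRow_exps : ∀ (r : Fin 56) (t : Fin 4 × Fin 4),
    ∃ c, quinticExp c = (quinticRow r).2 + unitExp t.1 + unitExp t.2 := by
  decide +kernel

theorem quinticExp_pow : ∀ i : Fin 4, ∃ c, quinticExp c =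
    unitExp i + unitExp i + unitExp i + unitExp i + unitExp i := by
  decide +kernel

/-- The quadrics of the web have no common zero. -/
theorem eq_zero_of_forall_web {w : Fin 4 → ℂ}
    (h : ∀ v : Fin 4 → ℂ, ∑ i, ∑ j, web v i j * (w i * w j) = 0) : w = 0 := by
  have hq (k : Fin 4) : ∑ i, ∑ j, (webInt k i j : ℂ) * (w i * w j) = 0 := by
    have h1 := h fun l => if l = k then (webScale k : ℂ) else 0
    have h3 : (webScale k : ℂ) ≠ 0 := by exact_mod_cast webScale_ne_zero k
    simpa [web_eq_sum, ite_div, h3] using h1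
  have hz : (fun c => mono (quinticExp c) w) = 0 := by
    refine isModInverse_quintic.eq_zero (by norm_num) quinticEntry_modEq fun r => ?_
    have := sum_collect (K := ℂ) quinticExp_injective
      (fun t : Fin 4 × Fin 4 => (quinticRow r).2 + unitExp t.1 + unitExp t.2)
      (fun t => webInt (quinticRow r).1 t.1 t.2) (fun n => mono n w)
      (fun t => Or.inl (quinticRow_exps r t))
    rw [show (∑ j, (quinticEntry (quinticRow r).1 (quinticRow r).2 (quinticExp j) : ℂ) *
      mono (quinticExp j) w) = _ from this]
    simp only [mono_add, mono_unitExp, Fintype.sum_prod_type]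
    have h4 := hq (quinticRow r).1
    calc _ = mono (quinticRow r).2 w *
          ∑ i, ∑ j, (webInt (quinticRow r).1 i j : ℂ) * (w i * w j) := by
          simp only [Finset.mul_sum]
          refine Finset.sum_congr rfl fun i _ => Finset.sum_congr rfl fun j _ => by ring
      _ = 0 := by rw [h4, mul_zero]
  funext i
  obtain ⟨c, hc⟩ := quinticExp_pow i
  have h5 : mono (quinticExp c) w = 0 := congrFun hz c
  rw [hc] at h5
  simpa [mono_add, mono_unitExp] using h5

/-! ### At most ten matrices of rank two -/

/-- The coefficient of `v k * v l * v m` in the minor of `∑ k, v k • webInt k` that omits row `i`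
and column `j`, when the first row is taken from `webInt k`, the second from `webInt l` and the
third from `webInt m`. -/
def mixedMinor (i j : Fin 4) (t : Fin 4 × Fin 4 × Fin 4) : ℤ :=
  let a (c : Fin 3) := webInt t.1 (i.succAbove 0) (j.succAbove c)
  let b (c : Fin 3) := webInt t.2.1 (i.succAbove 1) (j.succAbove c)
  let d (c : Fin 3) := webInt t.2.2 (i.succAbove 2) (j.succAbove c)
  a 0 * b 1 * d 2 - a 0 * b 2 * d 1 - a 1 * b 0 * d 2 + a 1 * b 2 * d 0 + a 2 * b 0 * d 1
    - a 2 * b 1 * d 0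

/-- The exponents of `v k * v l * v m`. -/
def tripleExp (t : Fin 4 × Fin 4 × Fin 4) : Exps :=
  unitExp t.1 + unitExp t.2.1 + unitExp t.2.2

/-- The exponents of the cubic monomials in the last three variables. -/
def cubicExp : Fin 10 → Exps :=
  ![(0, 0, 0, 3), (0, 0, 1, 2), (0, 0, 2, 1), (0, 0, 3, 0), (0, 1, 0, 2),
    (0, 1, 1, 1), (0, 1, 2, 0), (0, 2, 0, 1), (0, 2, 1, 0), (0, 3, 0, 0)]

/-- The row and column omitted in the ten essentially different `3 × 3` minors. -/
def minorIndex : Fin 10 → Fin 4 × Fin 4 :=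
  ![(0, 0), (0, 1), (0, 2), (0, 3), (1, 1), (1, 2), (1, 3), (2, 2), (2, 3), (3, 3)]

/-- The exponents of the monomials of degree at most two in the last three variables. -/
def quadraticExp : Fin 10 → Exps :=
  ![(0, 0, 0, 0), (0, 0, 0, 1), (0, 0, 1, 0), (0, 1, 0, 0), (0, 0, 0, 2),
    (0, 0, 1, 1), (0, 0, 2, 0), (0, 1, 0, 1), (0, 1, 1, 0), (0, 2, 0, 0)]

/-- The columns, modulo `13`, of the matrix with entries `minorEntry`: its rows are indexed by
`minorIndex`, its columns by `cubicExp`. -/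
def cubicColumns : List (List ℕ) :=
  [[1, 0, 0, 0, 0, 0, 0, 0, 0, 0],
    [1, 0, 3, 12, 0, 0, 0, 0, 0, 0],
    [5, 7, 9, 0, 3, 0, 0, 12, 10, 4],
    [10, 1, 8, 1, 12, 4, 12, 0, 0, 0],
    [5, 5, 0, 5, 0, 0, 0, 0, 0, 0],
    [1, 7, 3, 12, 10, 2, 8, 10, 2, 0],
    [12, 7, 0, 0, 12, 12, 0, 7, 2, 1],
    [6, 6, 11, 5, 1, 0, 12, 2, 0, 1],
    [8, 1, 3, 11, 0, 7, 3, 0, 5, 7],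
    [3, 5, 8, 0, 10, 9, 3, 3, 4, 10]]

/-- The rows of the inverse, modulo `13`, of the matrix with columns `cubicColumns`. -/
def cubicInverse : List (List ℕ) :=
  [[1, 7, 10, 5, 10, 2, 9, 6, 7, 12],
    [0, 4, 12, 9, 7, 4, 1, 4, 7, 6],
    [0, 1, 4, 12, 7, 5, 6, 7, 8, 5],
    [0, 11, 5, 2, 3, 3, 9, 12, 10, 7],
    [0, 0, 7, 8, 8, 5, 11, 4, 8, 8],
    [0, 5, 7, 8, 7, 11, 2, 7, 11, 3],
    [0, 3, 12, 10, 12, 12, 2, 12, 12, 0],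
    [0, 7, 2, 6, 4, 0, 12, 7, 9, 5],
    [0, 12, 9, 1, 5, 0, 2, 2, 6, 12],
    [0, 11, 5, 2, 9, 2, 0, 3, 10, 10]]

theorem isModInverse_cubic : IsModInverse 13 10 cubicInverse cubicColumns := by
  unfold IsModInverse; decide +kernel

/-- The coefficient of the monomial `n` in the minor that omits row `i` and column `j`. -/
def minorEntry (i j : Fin 4) (n : Exps) : ℤ :=
  ∑ t : Fin 4 × Fin 4 × Fin 4, if tripleExp t = n then mixedMinor i j t else 0

theorem minorEntry_modEq : ∀ r c : Fin 10,
    minorEntry (minorIndex r).1 (minorIndex r).2 (cubicExp c) ≡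
      ((cubicColumns.getD c []).getD r 0 : ℕ) [ZMOD 13] := by
  unfold Int.ModEq; decide +kernel

theorem cubicExp_injective : Function.Injective cubicExp := by
  unfold Function.Injective; decide +kernel

theorem tripleExp_cases : ∀ t, (∃ c, cubicExp c = tripleExp t) ∨ 0 < (tripleExp t).1 := by
  decide +kernel

theorem tripleExp_of_ne_zero : ∀ t : Fin 4 × Fin 4 × Fin 4, t.1 ≠ 0 → t.2.1 ≠ 0 → t.2.2 ≠ 0 →
    ∃ c, cubicExp c = tripleExp t := by
  decide +kernel

theorem quadraticExp_surj : ∀ a b c : Fin 3, a.val + b.val + c.val ≤ 2 →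
    ∃ q, quadraticExp q = (0, a.val, b.val, c.val) := by
  decide +kernel

/-- The integral web at `v`. -/
def intWeb {K : Type} [Field K] (v : Fin 4 → K) : Mat4 K :=
  fun i j => ∑ k, v k * (webInt k i j : K)

/-- All `3 × 3` minors vanish. -/
def MinorsVanish {K : Type} [Field K] (N : Mat4 K) : Prop :=
  ∀ i j : Fin 4, (N.submatrix i.succAbove j.succAbove).det = 0

theorem sum_mul_sum_mul_sum {K ι : Type} [Field K] [Fintype ι] (f g h : ι → K) :
    (∑ i, f i) * (∑ i, g i) * (∑ i, h i) = ∑ t : ι × ι × ι, f t.1 * g t.2.1 * h t.2.2 := by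
  simp only [Fintype.sum_prod_type, ← Finset.mul_sum, ← Finset.sum_mul]

theorem det_submatrix_intWeb {K : Type} [Field K] (v : Fin 4 → K) (i j : Fin 4) :
    ((intWeb v).submatrix i.succAbove j.succAbove).det =
      ∑ t, (mixedMinor i j t : K) * mono (tripleExp t) v := by
  rw [Matrix.det_fin_three]
  have key (a b c : Fin 3) : intWeb v (i.succAbove 0) (j.succAbove a) *
      intWeb v (i.succAbove 1) (j.succAbove b) * intWeb v (i.succAbove 2) (j.succAbove c) =
      ∑ t : Fin 4 × Fin 4 × Fin 4, (v t.1 * (webInt t.1 (i.succAbove 0) (j.succAbove a) : K)) *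
        (v t.2.1 * (webInt t.2.1 (i.succAbove 1) (j.succAbove b) : K)) *
        (v t.2.2 * (webInt t.2.2 (i.succAbove 2) (j.succAbove c) : K)) :=
    sum_mul_sum_mul_sum _ _ _
  have e (A B C D E F G H I : K) : A * E * I - A * F * H - B * D * I + B * F * G + C * D * H
      - C * E * G = A * E * I - A * F * H - B * D * I + B * F * G + C * D * H - C * E * G := rfl
  simp only [Matrix.submatrix_apply, key]
  simp only [← Finset.sum_sub_distrib, ← Finset.sum_add_distrib]
  refine Finset.sum_congr rfl fun t _ => ?_
  simp only [mixedMinor, tripleExp, mono_add, mono_unitExp]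
  push_cast
  ring

/-- A relation between the values of a function on exponents which is satisfied by all multiples of
the minors forces the function to vanish on cubics in the last three variables, once it vanishes on
the multiples of the first variable. -/
theorem cubic_eq_zero {K : Type} [Field K] [CharZero K] {g : Exps → K}
    (h : ∀ i j, ∑ t, (mixedMinor i j t : K) * g (tripleExp t) = 0)
    (h0 : ∀ t, 0 < (tripleExp t).1 → g (tripleExp t) = 0) (c : Fin 10) : g (cubicExp c) = 0 := by
  have hz : (fun c => g (cubicExp c)) = 0 := by
    refine isModInverse_cubic.eq_zero (by norm_num) minorEntry_modEq fun r => ?_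
    rw [← h (minorIndex r).1 (minorIndex r).2]
    exact sum_collect cubicExp_injective tripleExp _ g
      fun t => (tripleExp_cases t).imp_right (h0 t)
  exact congrFun hz c

/-- The rank two matrices of the web have a nonzero first entry. -/
theorem eq_zero_of_minorsVanish {v : Fin 4 → ℂ} (h : MinorsVanish (intWeb v)) (h0 : v 0 = 0) :
    v = 0 := by
  have h1 := cubic_eq_zero (g := fun n => mono n v)
    (fun i j => by rw [← det_submatrix_intWeb]; exact h i j) (by
      intro t ht
      simp only [mono, h0]
      rw [zero_pow ht.ne']
      ring)
  funext i
  by_cases hi : i = 0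
  · rw [hi, h0]; rfl
  · obtain ⟨c, hc⟩ := tripleExp_of_ne_zero (i, i, i) hi hi hi
    have h2 := h1 c
    simp only [hc, tripleExp, mono_add, mono_unitExp] at h2
    simpa using h2

theorem exists_unitExp_add {n : Exps} (h : 0 < n.2.1 + n.2.2.1 + n.2.2.2) :
    ∃ (i : Fin 4) (m : Exps), i ≠ 0 ∧ n = m + unitExp i ∧
      n.2.1 + n.2.2.1 + n.2.2.2 = m.2.1 + m.2.2.1 + m.2.2.2 + 1 := by
  obtain ⟨a, b, c, d⟩ := n
  simp only at h
  by_cases hb : 0 < b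
  · exact ⟨1, (a, b - 1, c, d), by decide, by simp [unitExp]; omega, by simp only; omega⟩
  by_cases hc : 0 < c
  · exact ⟨2, (a, b, c - 1, d), by decide, by simp [unitExp]; omega, by simp only; omega⟩
  · exact ⟨3, (a, b, c, d - 1), by decide, by simp [unitExp]; omega, by simp only; omega⟩

/-- In the chart where the first coordinate is one, the functions of degree at most two span all
functions on the set of matrices with vanishing `3 × 3` minors. A linear functional on functions
that vanishes in degree at most two vanishes. -/
theorem functional_eq_zero {n : ℕ} {pt : Fin n → Fin 4 → ℂ} (hinj : Function.Injective pt)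
    (h1 : ∀ p, pt p 0 = 1) (hm : ∀ p, MinorsVanish (intWeb (pt p))) {c : Fin n → ℂ}
    (hc : ∀ q, ∑ p, c p * mono (quadraticExp q) (pt p) = 0) : c = 0 := by
  have hmono : ∀ (d : ℕ) (e : Exps), e.2.1 + e.2.2.1 + e.2.2.2 = d →
      ∑ p, c p * mono e (pt p) = 0 := by
    intro d
    induction d using Nat.strong_induction_on with
    | _ d ih =>
      intro e he
      by_cases hd : d ≤ 2
      · obtain ⟨q, hq⟩ := quadraticExp_surj ⟨e.2.1, by omega⟩ ⟨e.2.2.1, by omega⟩ ⟨e.2.2.2, by omega⟩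
          (by simp; omega)
        rw [← hc q, hq]
        refine Finset.sum_congr rfl fun p _ => ?_
        simp [mono, h1]
      · obtain ⟨i, e1, hi, he1, hs1⟩ := exists_unitExp_add (n := e) (by omega)
        obtain ⟨j, e2, hj, he2, hs2⟩ := exists_unitExp_add (n := e1) (by omega)
        obtain ⟨k, m, hk, he3, hs3⟩ := exists_unitExp_add (n := e2) (by omega)
        obtain ⟨a, ha⟩ := tripleExp_of_ne_zero (k, j, i) hk hj hi
        have hem : e = m + cubicExp a := by
          rw [ha, he1, he2, he3, tripleExp]; abel
        rw [hem]
        refine cubic_eq_zero (g := fun n => ∑ p, c p * mono (m + n) (pt p)) ?_ ?_ a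
        · intro i j
          simp only [mono_add, Finset.mul_sum]
          rw [Finset.sum_comm]
          refine Finset.sum_eq_zero fun p _ => ?_
          have := hm p i j
          rw [det_submatrix_intWeb] at this
          calc _ = c p * mono m (pt p) * ∑ t, (mixedMinor i j t : ℂ) * mono (tripleExp t) (pt p) := by
                rw [Finset.mul_sum]
                refine Finset.sum_congr rfl fun t _ => by ring
            _ = 0 := by rw [this, mul_zero]
        · intro t ht
          have hsum : (tripleExp t).1 + (tripleExp t).2.1 + (tripleExp t).2.2.1 + (tripleExp t).2.2.2 = 3 := by
            have : ∀ t : Fin 4 × Fin 4 × Fin 4,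
              (tripleExp t).1 + (tripleExp t).2.1 + (tripleExp t).2.2.1 + (tripleExp t).2.2.2 = 3 := by decide +kernel
            exact this t
          refine ih (m.2.1 + m.2.2.1 + m.2.2.2 + ((tripleExp t).2.1 + (tripleExp t).2.2.1 + (tripleExp t).2.2.2)) (by omega) _ ?_
          simp only [Prod.fst_add, Prod.snd_add]
          omega
  have hpoly (f : MvPolynomial (Fin 4) ℂ) : ∑ p, c p * MvPolynomial.eval (pt p) f = 0 := by
    induction f using MvPolynomial.induction_on' with
    | add f g hf hg => simp only [map_add, mul_add, Finset.sum_add_distrib, hf, hg, add_zero]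
    | monomial u a =>
      have h2 := hmono _ (u 0, u 1, u 2, u 3) rfl
      have h3 (p : Fin n) : c p * MvPolynomial.eval (pt p) (MvPolynomial.monomial u a) =
          a * (c p * mono (u 0, u 1, u 2, u 3) (pt p)) := by
        rw [MvPolynomial.eval_monomial, Finsupp.prod_fintype _ _ (by simp), Fin.prod_univ_four, mono]
        ring
      simp only [h3, ← Finset.mul_sum, h2, mul_zero]
  funext p
  have hsep (q : Fin n) : ∃ i, q ≠ p → pt q i ≠ pt p i := by
    by_cases hqp : q = p
    · exact ⟨0, fun h => absurd hqp h⟩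
    · obtain ⟨i, hi⟩ := Function.ne_iff.1 (hinj.ne hqp)
      exact ⟨i, fun _ => hi⟩
  choose i hi using hsep
  have h4 := hpoly (∏ q ∈ Finset.univ.erase p, (MvPolynomial.X (i q) - MvPolynomial.C (pt q (i q))))
  rw [Finset.sum_eq_single p] at h4
  · rcases mul_eq_zero.1 h4 with h5 | h5
    · exact h5
    · exfalso
      rw [map_prod, Finset.prod_eq_zero_iff] at h5
      obtain ⟨q, hq, h6⟩ := h5
      apply hi q (Finset.ne_of_mem_erase hq)
      simp at h6
      exact (sub_eq_zero.1 h6).symm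
  · intro q _ hqp
    rw [map_prod, Finset.prod_eq_zero (i := q)]
    · simp
    · simp [hqp]
    · simp
  · simp

/-- There are at most ten matrices of rank two in the web, up to scaling. -/
theorem not_eleven {pt : Fin 11 → Fin 4 → ℂ} (hinj : Function.Injective pt)
    (h1 : ∀ p, pt p 0 = 1) (hm : ∀ p, MinorsVanish (intWeb (pt p))) : False := by
  have hker : LinearMap.ker (Matrix.mulVecLin
      (Matrix.of fun (q : Fin 10) (p : Fin 11) => mono (quadraticExp q) (pt p))) ≠ ⊥ :=
    LinearMap.ker_ne_bot_of_finrank_lt (by simp)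
  obtain ⟨c, hc, hc0⟩ := (Submodule.ne_bot_iff _).1 hker
  refine hc0 (functional_eq_zero hinj h1 hm fun q => ?_)
  have := congrFun (LinearMap.mem_ker.1 hc) q
  simpa [Matrix.mulVec, dotProduct, mul_comm] using this

/-! ### Singular points of symmetroids -/

theorem eval_zero_det_add_X_smul {n : ℕ} (N B : Matrix (Fin n) (Fin n) ℂ) :
    (N.map (fun t => Polynomial.C t)
      + (Polynomial.X : Polynomial ℂ) • B.map (fun t => Polynomial.C t)).det.coeff 0 = N.det := by
  rw [Polynomial.coeff_zero_eq_eval_zero, ← Polynomial.coe_evalRingHom, RingHom.map_det]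
  congr 1
  ext i j
  simp

theorem coeff_one_det_add_X_smul {n : ℕ} (N B : Matrix (Fin n) (Fin n) ℂ) :
    (N.map (fun t => Polynomial.C t)
      + (Polynomial.X : Polynomial ℂ) • B.map (fun t => Polynomial.C t)).det.coeff 1
      = (N.adjugate * B).trace := by
  have h1 : ∀ p : Polynomial ℂ, p.coeff 1 = (Polynomial.derivative p).eval 0 := fun p => by
    rw [← Polynomial.coeff_zero_eq_eval_zero, Polynomial.coeff_derivative]; simp
  rw [h1, Matrix.det_apply, Polynomial.derivative_sum, Polynomial.eval_finsetSum]
  have h2 : (N.adjugate * B).trace = ∑ i, (N.updateCol i (fun k => B k i)).det := by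
    simp only [Matrix.trace, Matrix.diag_apply, Matrix.mul_apply]
    refine Finset.sum_congr rfl fun i _ => ?_
    rw [← Matrix.cramer_apply, Matrix.cramer_eq_adjugate_mulVec]
    rfl
  rw [h2]
  simp_rw [Matrix.det_apply]
  rw [Finset.sum_comm]
  refine Finset.sum_congr rfl fun σ _ => ?_
  rw [← Finset.smul_sum, Polynomial.derivative_smul, Polynomial.eval_smul]
  congr 1
  rw [Polynomial.derivative_prod_finset, Polynomial.eval_finsetSum]
  refine Finset.sum_congr rfl fun i _ => ?_
  rw [← Finset.prod_erase_mul _ _ (Finset.mem_univ i), Polynomial.eval_mul, Polynomial.eval_prod]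
  congr 1
  · refine Finset.prod_congr rfl fun j hj => ?_
    simp [Finset.ne_of_mem_erase hj]
  · simp

theorem X_sq_dvd_det_add_X_smul_iff {n : ℕ} (N B : Matrix (Fin n) (Fin n) ℂ) :
    (Polynomial.X : Polynomial ℂ) ^ 2 ∣ (N.map (fun t => Polynomial.C t)
      + (Polynomial.X : Polynomial ℂ) • B.map (fun t => Polynomial.C t)).det ↔
      N.det = 0 ∧ (N.adjugate * B).trace = 0 := by
  rw [Polynomial.X_pow_dvd_iff]
  constructor
  · intro h
    exact ⟨by rw [← h 0 (by norm_num), eval_zero_det_add_X_smul],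
      by rw [← h 1 (by norm_num), coeff_one_det_add_X_smul]⟩
  · rintro ⟨h0, h1⟩ d hd
    interval_cases d
    · rw [eval_zero_det_add_X_smul, h0]
    · rw [coeff_one_det_add_X_smul, h1]

theorem minorsVanish_iff {K : Type} [Field K] (N : Mat4 K) : MinorsVanish N ↔ N.adjugate = 0 := by
  constructor
  · intro h
    ext i j
    rw [Matrix.adjugate_fin_succ_eq_det_submatrix, h j i]
    simp
  · intro h i j
    have := congrFun (congrFun h j) i
    rw [Matrix.adjugate_fin_succ_eq_det_submatrix] at this
    simpa using this

theorem MinorsVanish.det_eq_zero {K : Type} [Field K] {N : Mat4 K} (h : MinorsVanish N) :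
    N.det = 0 := by
  rw [Matrix.det_succ_row_zero]
  refine Finset.sum_eq_zero fun j _ => ?_
  have := h 0 j
  simp only [Fin.succAbove_zero] at this
  rw [this, mul_zero]

/-- The adjugate of a singular symmetric matrix has rank at most one. -/
theorem adjugate_mul_eq {K : Type} [Field K] {N : Mat4 K} (hs : N.IsSymm) (h0 : N.det = 0)
    {i j : Fin 4} (hij : N.adjugate j i ≠ 0) (k l : Fin 4) :
    N.adjugate k l * N.adjugate j i ^ 2 = N.adjugate j j * (N.adjugate k i * N.adjugate l i) := by
  set D := N.adjugate with hD
  have hsymm (a b) : D a b = D b a := by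
    have : Dᵀ = D := by rw [hD, Matrix.adjugate_transpose, hs.eq]
    exact (congrFun (congrFun this b) a)
  have hminor : (N.submatrix i.succAbove j.succAbove).det ≠ 0 := by
    rw [hD, Matrix.adjugate_fin_succ_eq_det_submatrix] at hij
    exact right_ne_zero_of_mul hij
  have key (k l) : D k l * D j i = D j l * D k i := by
    let x : Fin 4 → K := fun k => D k l * D j i - D j l * D k i
    have hND : N * D = 0 := by rw [hD, Matrix.mul_adjugate, h0, zero_smul]
    have hx : N *ᵥ x = 0 := by
      funext a
      have e1 := congrFun (congrFun hND a) l
      have e2 := congrFun (congrFun hND a) i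
      rw [Matrix.mul_apply, Matrix.zero_apply] at e1 e2
      simp only [Matrix.mulVec, dotProduct, x, Pi.zero_apply, mul_sub, Finset.sum_sub_distrib]
      rw [Finset.sum_congr rfl (fun c _ => (mul_assoc (N a c) (D c l) (D j i)).symm),
        Finset.sum_congr rfl (fun c _ => (mul_left_comm (N a c) (D j l) (D c i))),
        ← Finset.sum_mul, ← Finset.mul_sum, e1, e2]
      simp
    have hxj : x j = 0 := by simp only [x]; ring
    have hsub : N.submatrix i.succAbove j.succAbove *ᵥ (fun c => x (j.succAbove c)) = 0 := by
      funext a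
      have e := congrFun hx (i.succAbove a)
      rw [Matrix.mulVec, dotProduct, Fin.sum_univ_succAbove _ j, hxj] at e
      simpa [Matrix.mulVec, dotProduct] using e
    have hz := Matrix.eq_zero_of_mulVec_eq_zero hminor hsub
    have hxk : x k = 0 := by
      rcases Fin.eq_self_or_eq_succAbove j k with rfl | ⟨c, rfl⟩
      · exact hxj
      · exact congrFun hz c
    exact sub_eq_zero.1 hxk
  have e1 := key k l
  have e2 := key l j
  rw [hsymm l j] at e2
  calc D k l * D j i ^ 2 = (D k l * D j i) * D j i := by ring
    _ = (D j l * D j i) * D k i := by rw [e1]; ring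
    _ = _ := by rw [e2]; ring

/-- At a singular point of the symmetroid the adjugate vanishes, as the quadrics of the web have no
common zero. -/
theorem symmetroidMultGE_two_iff {v : Fin 4 → ℂ} :
    SymmetroidMultGE theWeb 2 (web v) ↔ MinorsVanish (web v) := by
  rw [SymmetroidMultGE, complexSpan_theWeb]
  constructor
  · intro h
    by_contra hm
    rw [minorsVanish_iff] at hm
    obtain ⟨j, i, hij⟩ : ∃ j i, (web v).adjugate j i ≠ 0 := by
      by_contra! hall
      exact hm (by ext j i; exact hall j i)
    have h0 := ((X_sq_dvd_det_add_X_smul_iff _ _).1 (h _ ⟨0, rfl⟩)).1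
    have hrank := adjugate_mul_eq (web_isSymm v) h0 hij
    set D := (web v).adjugate with hD
    have hjj : D j j ≠ 0 := by
      intro hz
      have := hrank j i
      rw [hz, zero_mul] at this
      exact hij (by simpa using this)
    have hw : (fun k => D k i) = 0 := by
      refine eq_zero_of_forall_web fun u => ?_
      have ht := ((X_sq_dvd_det_add_X_smul_iff _ _).1 (h _ ⟨u, rfl⟩)).2
      rw [← hD, Matrix.trace] at ht
      simp only [Matrix.diag_apply, Matrix.mul_apply, webMap_apply] at ht
      have : D j j * ∑ a, ∑ b, web u a b * (D a i * D b i) = 0 := by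
        rw [← zero_mul (D j i ^ 2), ← ht]
        simp only [Finset.sum_mul, Finset.mul_sum]
        refine Finset.sum_congr rfl fun a _ => Finset.sum_congr rfl fun b _ => ?_
        rw [show D a b * web u b a * D j i ^ 2 = web u b a * (D a b * D j i ^ 2) by ring, hrank,
          (web_isSymm u).apply a b]
        ring
      exact (mul_eq_zero.1 this).resolve_left hjj
    exact hij (congrFun hw j)
  · rintro h _ ⟨u, rfl⟩
    rw [X_sq_dvd_det_add_X_smul_iff, (minorsVanish_iff _).1 h]
    exact ⟨h.det_eq_zero, by simp⟩

/-! ### The ten nodes of the symmetroid -/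

/-- The platform point, in homogeneous coordinates, of the leg given by the `k`-th solution of
`legSystem`. -/
noncomputable def nodeA (k : Fin 10) : Fin 4 → ℝ := ![1, node k 0, node k 1, node k 2]

/-- The base point, in homogeneous coordinates, of the leg given by the `k`-th solution of
`legSystem`. -/
noncomputable def nodeB (k : Fin 10) : Fin 4 → ℝ := ![1, node k 3, node k 4, node k 5]

/-- The parameters of the `k`-th node of the symmetroid. -/
noncomputable def nodeParam (k : Fin 10) : Fin 4 → ℝ :=
  ![2, node k 0 + node k 3, node k 1 + node k 4, 2 * (node k 0 * node k 3)]

theorem nodeA_one_ne (k : Fin 10) : nodeA k 1 ≠ nodeB k 1 := by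
  intro h
  have := @node_first_injective (k, 0) (k, 1) (by simpa [nodeA, nodeB] using h)
  simp at this

/-- The matrix `a bᵀ + b aᵀ`. -/
def symProd {K : Type} [Field K] (a b : Fin 4 → K) : Mat4 K :=
  Matrix.vecMulVec a b + Matrix.vecMulVec b a

theorem symProd_apply {K : Type} [Field K] (a b : Fin 4 → K) (i j : Fin 4) :
    symProd a b i j = a i * b j + b i * a j := rfl

theorem web_nodeParam (k : Fin 10) : web (nodeParam k) = symProd (nodeA k) (nodeB k) := by
  have h := legSystem_node k
  have e (i) := congrFun h i
  have e0 := e 0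
  have e1 := e 1
  have e2 := e 2
  have e3 := e 3
  have e4 := e 4
  have e5 := e 5
  simp only [legSystem, Matrix.cons_val, Pi.zero_apply] at e0 e1 e2 e3 e4 e5
  rw [← mem_range_webMap (N := symProd (nodeA k) (nodeB k))]
  · congr 1
    funext i
    fin_cases i <;> simp [nodeParam, symProd_apply, nodeA, nodeB] <;> ring
  · ext i j
    simp [symProd_apply]; ring
  all_goals
    have p0 : symProd (nodeA k) (nodeB k) 0 0 = 2 := by
      simp [symProd_apply, nodeA, nodeB]; norm_num
    have p1 : symProd (nodeA k) (nodeB k) 0 1 = node k 0 + node k 3 := by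
      simp [symProd_apply, nodeA, nodeB]; ring
    have p2 : symProd (nodeA k) (nodeB k) 0 2 = node k 1 + node k 4 := by
      simp [symProd_apply, nodeA, nodeB]; ring
    rw [p0, p1, p2]
    simp only [symProd_apply, nodeA, nodeB, Matrix.cons_val]
    linarith

theorem minorsVanish_symProd {K : Type} [Field K] (a b : Fin 4 → K) :
    MinorsVanish (symProd a b) := by
  intro i j
  rw [Matrix.det_fin_three]
  simp only [Matrix.submatrix_apply, symProd_apply]
  ring

theorem MinorsVanish.smul {K : Type} [Field K] {N : Mat4 K} (h : MinorsVanish N) (c : K) :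
    MinorsVanish (c • N) := by
  intro i j
  rw [show (c • N).submatrix i.succAbove j.succAbove =
    c • N.submatrix i.succAbove j.succAbove from rfl, Matrix.det_smul, h i j, mul_zero]

/-- The complex parameters of the `k`-th node. -/
noncomputable def nodeParamC (k : Fin 10) : Fin 4 → ℂ := fun i => (nodeParam k i : ℂ)

theorem web_nodeParamC (k : Fin 10) :
    web (nodeParamC k) = symProd (fun i => (nodeA k i : ℂ)) (fun i => (nodeB k i : ℂ)) := by
  rw [show nodeParamC k = fun i => (nodeParam k i : ℂ) from rfl, ← map_ofReal_web, web_nodeParam]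
  ext i j
  simp [symProd_apply]

theorem web_smul {K : Type} [Field K] (c : K) (v : Fin 4 → K) : web (c • v) = c • web v :=
  webMap.map_smul c v

theorem intWeb_eq (v : Fin 4 → ℂ) : intWeb (fun i => v i / webScale i) = web v := by
  ext i j
  rw [web_eq_sum]
  rfl

theorem intWeb_smul (c : ℂ) (v : Fin 4 → ℂ) : intWeb (c • v) = c • intWeb v := by
  ext i j
  simp [intWeb, Finset.mul_sum, mul_assoc]

/-- The matrices of rank at most two in the web are the multiples of the ten nodes. -/
theorem exists_node_of_minorsVanish {v : Fin 4 → ℂ} (hv : v ≠ 0) (h : MinorsVanish (web v)) :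
    ∃ k, ∃ c : ℂ, c ≠ 0 ∧ v = c • nodeParamC k := by
  have hs (i : Fin 4) : ((webScale i : ℤ) : ℂ) ≠ 0 := by exact_mod_cast webScale_ne_zero i
  -- the points are normalized so that the entry `00` of the integral web is one
  let nrm : (Fin 4 → ℂ) → Fin 4 → ℂ := fun v => (v 0 / webScale 0)⁻¹ • fun i => v i / webScale i
  have hnrm {v : Fin 4 → ℂ} (h0 : v 0 ≠ 0) : nrm v 0 = 1 := by
    have hs0 := hs 0
    simp only [nrm, Pi.smul_apply, smul_eq_mul]
    exact inv_mul_cancel₀ (div_ne_zero h0 hs0)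
  have hmin {v : Fin 4 → ℂ} (h : MinorsVanish (web v)) : MinorsVanish (intWeb (nrm v)) := by
    simp only [nrm]
    rw [intWeb_smul, intWeb_eq]
    exact h.smul _
  have hinv {v w : Fin 4 → ℂ} (h0 : v 0 ≠ 0) (hw : w 0 ≠ 0) (he : nrm v = nrm w) :
      v = (v 0 / w 0) • w := by
    funext i
    have := congrFun he i
    have hs0 := hs 0
    have hsi := hs i
    simp only [nrm, Pi.smul_apply, smul_eq_mul] at this ⊢
    field_simp at this ⊢
    exact this
  have h0 : v 0 ≠ 0 := by
    intro h0
    apply hv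
    have := eq_zero_of_minorsVanish (v := fun i => v i / webScale i) (by rwa [intWeb_eq])
      (by simp [h0])
    funext i
    simpa [hs i] using congrFun this i
  have hn0 (k : Fin 10) : nodeParamC k 0 = 2 := by simp [nodeParamC, nodeParam]
  have hn0' (k : Fin 10) : nodeParamC k 0 ≠ 0 := by rw [hn0]; norm_num
  by_contra! hcon
  refine not_eleven (pt := Fin.cons (nrm v) fun k => nrm (nodeParamC k)) ?_ ?_ ?_
  · rw [Fin.cons_injective_iff]
    constructor
    · rintro ⟨k, hk⟩
      have := hinv h0 (hn0' k) hk.symm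
      exact hcon k _ (div_ne_zero h0 (hn0' k)) this
    · intro k l hkl
      have := hinv (hn0' k) (hn0' l) hkl
      have h1 := congrFun this 1
      rw [hn0, hn0] at h1
      simp only [nodeParamC, nodeParam, Pi.smul_apply, smul_eq_mul] at h1
      refine node_sum_injective ?_
      have h2 : ((node k 0 + node k 3 : ℝ) : ℂ) = ((node l 0 + node l 3 : ℝ) : ℂ) := by
        simpa using h1
      exact_mod_cast h2
  · intro p
    refine Fin.cases ?_ (fun k => ?_) p
    · exact hnrm h0
    · exact hnrm (hn0' k)
  · intro p
    refine Fin.cases ?_ (fun k => ?_) p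
    · exact hmin h
    · refine hmin ?_
      rw [web_nodeParamC]
      exact minorsVanish_symProd _ _

theorem web_nodeParamC_ne_zero (k : Fin 10) : web (nodeParamC k) ≠ 0 := by
  intro h
  have := congrFun (congrFun h 0) 0
  simp [web, nodeParamC, nodeParam] at this

/-- The `k`-th node as a point of projective space. -/
noncomputable def nodePoint (k : Fin 10) : ℙ ℂ (Mat4 ℂ) :=
  Projectivization.mk ℂ (web (nodeParamC k)) (web_nodeParamC_ne_zero k)

theorem nodePoint_injective : Function.Injective nodePoint := by
  intro k l h
  rw [nodePoint, nodePoint, Projectivization.mk_eq_mk_iff'] at h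
  obtain ⟨c, hc⟩ := h
  have e0 := congrFun (congrFun hc 0) 0
  have e1 := congrFun (congrFun hc 0) 1
  simp [web, nodeParamC, nodeParam] at e0 e1
  rw [e0, one_mul] at e1
  exact node_sum_injective (by exact_mod_cast e1.symm)

theorem rep_nodePoint (k : Fin 10) :
    ∃ c : ℂ, c ≠ 0 ∧ (nodePoint k).rep = c • web (nodeParamC k) := by
  obtain ⟨c, hc⟩ := Projectivization.exists_smul_eq_mk_rep ℂ (web (nodeParamC k))
    (web_nodeParamC_ne_zero k)
  exact ⟨c, c.ne_zero, hc.symm⟩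

/-- The singular points of the symmetroid are the ten nodes. -/
theorem symmetroidSing_theWeb : symmetroidSing theWeb = Set.range nodePoint := by
  ext p
  constructor
  · rintro ⟨h1, h2⟩
    rw [complexSpan_theWeb] at h1
    obtain ⟨v, hv⟩ := h1
    rw [webMap_apply] at hv
    rw [← hv, symmetroidMultGE_two_iff] at h2
    have hv0 : v ≠ 0 := by
      rintro rfl
      exact p.rep_nonzero (hv.symm.trans (webMap (K := ℂ)).map_zero)
    obtain ⟨k, c, hc, rfl⟩ := exists_node_of_minorsVanish hv0 h2
    refine ⟨k, ?_⟩
    rw [← p.mk_rep, nodePoint, Projectivization.mk_eq_mk_iff']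
    exact ⟨c⁻¹, by rw [← hv, web_smul, inv_smul_smul₀ hc]⟩
  · rintro ⟨k, rfl⟩
    obtain ⟨c, hc, hk⟩ := rep_nodePoint k
    rw [← web_smul] at hk
    refine ⟨?_, ?_⟩
    · rw [hk, complexSpan_theWeb]
      exact ⟨_, rfl⟩
    · rw [hk, symmetroidMultGE_two_iff, web_smul, web_nodeParamC]
      exact (minorsVanish_symProd _ _).smul _

theorem rank_symProd_le {K : Type} [Field K] (a b : Fin 4 → K) : (symProd a b).rank ≤ 2 := by
  have h : symProd a b = (Matrix.of fun i => ![a i, b i]) * Matrix.of ![b, a] := by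
    ext i j
    simp [symProd_apply, Matrix.mul_apply, Fin.sum_univ_two]
  rw [h]
  exact (Matrix.rank_mul_le_left _ _).trans ((Matrix.rank_le_card_width _).trans (by simp))

theorem le_rank_of_det_ne_zero {K : Type} [Field K] {N : Mat4 K} (r s : Fin 2 → Fin 4)
    (h : (N.submatrix r s).det ≠ 0) : 2 ≤ N.rank := by
  refine le_trans ?_ (Matrix.rank_submatrix_le N r s)
  rw [Matrix.rank_of_isUnit _ ((Matrix.isUnit_iff_isUnit_det _).2 h.isUnit)]
  simp

/-- On the line from a node in direction `E`, the determinant vanishes exactly to order two. -/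
theorem coeff_two_det_symProd (c : ℂ) {a b : Fin 4 → ℂ} (ha : a 0 = 1) (hb : b 0 = 1) :
    ((c • symProd a b).map (fun t => Polynomial.C t) + (Polynomial.X : Polynomial ℂ) •
      (web ![0, 0, 0, 1]).map (fun t => Polynomial.C t)).det.coeff 2 =
      -c ^ 2 * ((a 1 - b 1) ^ 2 + (a 2 - b 2) ^ 2 + (a 3 - b 3) ^ 2) := by
  have : ((c • symProd a b).map (fun t => Polynomial.C t) + (Polynomial.X : Polynomial ℂ) •
      (web ![0, 0, 0, 1]).map (fun t => Polynomial.C t)).det =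
      Polynomial.C (-c ^ 2 * ((a 1 - b 1) ^ 2 + (a 2 - b 2) ^ 2 + (a 3 - b 3) ^ 2)) *
        Polynomial.X ^ 2 + Polynomial.C (c + c) * Polynomial.X ^ 3 := by
    simp [Matrix.det_succ_row_zero, Fin.sum_univ_succ, symProd_apply, web, webForm, ha, hb,
      Fin.succAbove]
    ring
  rw [this, Polynomial.coeff_add, Polynomial.coeff_C_mul_X_pow, Polynomial.coeff_C_mul_X_pow]
  simp

theorem det_submatrix_symProd {K : Type} [Field K] (a b : Fin 4 → K) (ha : a 0 = 1) (hb : b 0 = 1) :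
    ((symProd a b).submatrix ![0, 1] ![0, 1]).det = -(a 1 - b 1) ^ 2 := by
  rw [Matrix.det_fin_two]
  simp [symProd_apply, ha, hb]
  ring

/-- None of the ten real nodes is semidefinite: the leading `2 × 2` minor of `a bᵀ + b aᵀ` is
`-(a₁ - b₁)²`. -/
theorem hasType_theWeb : HasType theWeb 10 0 := by
  have hcard : (Set.range nodePoint).encard = 10 := by
    rw [← Set.image_univ, nodePoint_injective.encard_image]
    simp
  refine ⟨?_, ?_, ?_, ?_⟩
  · rw [symmetroidSing_theWeb, hcard]
  · rw [symmetroidSing_theWeb]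
    rintro _ ⟨k, rfl⟩
    obtain ⟨c, hc, hk⟩ := rep_nodePoint k
    rw [web_nodeParamC] at hk
    have hne : (nodeA k 1 : ℂ) - nodeB k 1 ≠ 0 := by
      rw [sub_ne_zero]; exact_mod_cast nodeA_one_ne k
    constructor
    · intro h
      have h3 := h (web ![0, 0, 0, 1]) (by rw [complexSpan_theWeb]; exact ⟨_, rfl⟩)
      rw [Polynomial.X_pow_dvd_iff] at h3
      have := h3 2 (by norm_num)
      rw [hk, coeff_two_det_symProd c (by simp [nodeA]) (by simp [nodeB])] at this
      have hpos : (nodeA k 1 - nodeB k 1) ^ 2 + (nodeA k 2 - nodeB k 2) ^ 2 +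
          (nodeA k 3 - nodeB k 3) ^ 2 ≠ 0 := by
        have := sq_pos_of_ne_zero (sub_ne_zero.2 (nodeA_one_ne k))
        positivity
      refine mul_ne_zero (neg_ne_zero.2 (pow_ne_zero 2 hc)) ?_ this
      exact_mod_cast hpos
    · rw [hk, Matrix.rank_smul_of_mem_nonZeroDivisors _ (mem_nonZeroDivisors_of_ne_zero hc)]
      refine le_antisymm (rank_symProd_le _ _) (le_rank_of_det_ne_zero ![0, 1] ![0, 1] ?_)
      rw [det_submatrix_symProd _ _ (by simp [nodeA]) (by simp [nodeB])]
      exact neg_ne_zero.2 (pow_ne_zero 2 hne)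
  · rw [show ((10 : ℕ) : ℕ∞) = 10 from rfl, ← hcard, symmetroidSing_theWeb]
    congr 1
    ext p
    refine ⟨fun h => h.1, fun h => ⟨h, ?_⟩⟩
    obtain ⟨k, rfl⟩ := h
    obtain ⟨c, -, hk⟩ := rep_nodePoint k
    exact ⟨web (nodeParam k), ⟨_, rfl⟩, c, by rw [hk, map_ofReal_web]; rfl⟩
  · rw [Nat.cast_zero, Set.encard_eq_zero, Set.eq_empty_iff_forall_notMem]
    rintro p ⟨h, N, -, ⟨d, hd⟩, hN⟩
    rw [symmetroidSing_theWeb] at h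
    obtain ⟨k, rfl⟩ := h
    obtain ⟨c, hc, hk⟩ := rep_nodePoint k
    rw [web_nodeParamC, hd] at hk
    have hdet := (hN.submatrix ![0, 1]).det_nonneg
    rw [Matrix.det_fin_two] at hdet
    simp at hdet
    have hd0 : d ≠ 0 := by
      rintro rfl
      have := congrFun (congrFun hk 0) 0
      simp [symProd_apply, nodeA, nodeB] at this
      exact hc this
    have e (i j) := congrFun (congrFun hk i) j
    have e00 := e 0 0
    have e01 := e 0 1
    have e10 := e 1 0
    have e11 := e 1 1
    simp [symProd_apply, nodeA, nodeB] at e00 e01 e10 e11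
    -- the real factor between `N` and the node
    have hN0 : N 0 0 ≠ 0 := by
      intro h0
      rw [h0] at e00
      simp at e00
      exact hc e00
    have hcd : c = d * (N 0 0 / 2 : ℝ) := by push_cast; linear_combination -e00 / 2
    have r01 : N 0 1 = N 0 0 / 2 * (node k 0 + node k 3) := by
      have := mul_left_cancel₀ hd0 (e01.trans (by rw [hcd, mul_assoc]) :
        _ = d * (((N 0 0 / 2 : ℝ) : ℂ) * ((node k 3 : ℂ) + node k 0)))
      have h2 : N 0 1 = N 0 0 / 2 * (node k 3 + node k 0) := by exact_mod_cast this
      rw [h2]; ring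
    have r10 : N 1 0 = N 0 0 / 2 * (node k 0 + node k 3) := by
      have := mul_left_cancel₀ hd0 (e10.trans (by rw [hcd, mul_assoc]) :
        _ = d * (((N 0 0 / 2 : ℝ) : ℂ) * ((node k 0 : ℂ) + node k 3)))
      exact_mod_cast this
    have r11 : N 1 1 = N 0 0 / 2 * (node k 0 * node k 3 + node k 3 * node k 0) := by
      have := mul_left_cancel₀ hd0 (e11.trans (by rw [hcd, mul_assoc]) :
        _ = d * (((N 0 0 / 2 : ℝ) : ℂ) * ((node k 0 : ℂ) * node k 3 + node k 3 * node k 0)))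
      exact_mod_cast this
    rw [r01, r10, r11] at hdet
    have h1 : 0 < N 0 0 ^ 2 * (node k 0 - node k 3) ^ 2 := by
      have : node k 0 - node k 3 ≠ 0 := sub_ne_zero.2 (by simpa [nodeA, nodeB] using nodeA_one_ne k)
      positivity
    nlinarith

/-! ### Linear independence of the legs -/

/-- A matrix `A` with an approximation `B` is invertible if `B` has an approximate inverse `R`. -/
theorem det_ne_zero_of_approx {n : ℕ} {A : Matrix (Fin n) (Fin n) ℝ}
    {B R : Matrix (Fin n) (Fin n) ℚ} {δ : ℚ} (hA : ∀ i j, |A i j - (B i j : ℝ)| ≤ δ)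
    (h : ∀ i, ∑ j, |(1 - R * B) i j| + n * δ * ∑ j, |R i j| < 1) : A.det ≠ 0 := by
  suffices hdet : (R.map (fun t => (t : ℝ)) * A).det ≠ 0 by
    rw [Matrix.det_mul] at hdet
    exact right_ne_zero_of_mul hdet
  refine det_ne_zero_of_near_one _ fun i => ?_
  have h1 : ∑ j, |(1 - R.map (fun t => (t : ℝ)) * A) i j| ≤
      ((∑ j, |(1 - R * B) i j| + n * δ * ∑ j, |R i j| : ℚ) : ℝ) := by
    have h2 (j : Fin n) : |(1 - R.map (fun t => (t : ℝ)) * A) i j| ≤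
        ((|(1 - R * B) i j| : ℚ) : ℝ) + δ * ∑ k, |(R i k : ℝ)| := by
      have e : (1 - R.map (fun t => (t : ℝ)) * A) i j =
          (((1 - R * B) i j : ℚ) : ℝ) - ∑ k, (R i k : ℝ) * (A k j - B k j) := by
        simp only [Matrix.sub_apply, Matrix.mul_apply, Matrix.map_apply, mul_sub,
          Finset.sum_sub_distrib, Matrix.one_apply]
        push_cast
        split_ifs <;> ring
      rw [e]
      refine (abs_sub _ _).trans (add_le_add (by push_cast; rfl) ?_)
      rw [Finset.mul_sum]
      refine (Finset.abs_sum_le_sum_abs _ _).trans (Finset.sum_le_sum fun k _ => ?_)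
      rw [abs_mul, mul_comm]
      exact mul_le_mul_of_nonneg_right (hA k j) (abs_nonneg _)
    refine (Finset.sum_le_sum fun j _ => h2 j).trans (le_of_eq ?_)
    rw [Finset.sum_add_distrib, Finset.sum_const, Finset.card_univ, Fintype.card_fin]
    push_cast
    rw [nsmul_eq_mul, mul_assoc]
  exact h1.trans_lt (by exact_mod_cast h i)

/-- The rational approximations of the solutions of `legSystem`. -/
def nodeRat (k : Fin 10) (i : Fin 6) : ℚ := (nodeApprox k i : ℚ) / 10 ^ 12

theorem node_near_rat (k : Fin 10) (i : Fin 6) : |node k i - (nodeRat k i : ℝ)| ≤ 1 / 10 ^ 9 := by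
  have := node_near k i
  simpa [nodeRat] using this

theorem abs_nodeRat_le : ∀ k i, |nodeRat k i| ≤ 3 / 20 := by decide +kernel

theorem node_mul_near (k : Fin 10) (i j : Fin 6) :
    |node k i * node k j - (nodeRat k i : ℝ) * nodeRat k j| ≤ 1 / 10 ^ 9 := by
  have hi := node_near_rat k i
  have hj := node_near_rat k j
  have bi : |(nodeRat k i : ℝ)| ≤ 3 / 20 := by
    have := (Rat.cast_le (K := ℝ)).2 (abs_nodeRat_le k i)
    push_cast at this; exact this
  have bj : |(nodeRat k j : ℝ)| ≤ 3 / 20 := by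
    have := (Rat.cast_le (K := ℝ)).2 (abs_nodeRat_le k j)
    push_cast at this; exact this
  have bj' : |node k j| ≤ 1 / 5 := by
    have := abs_add_le (node k j - nodeRat k j) (nodeRat k j)
    rw [sub_add_cancel] at this
    linarith
  refine (abs_mul_sub_mul_le (ρ := 1 / 5) (m := 1 / 10 ^ 9) bj' (by linarith) hi hj).trans ?_
  norm_num

/-- The Plücker coordinates of the line through `a` and `b`, as coefficients of the sphere
condition of `a bᵀ - b aᵀ` at the entries of `x - y` and `M - Mᵀ`. -/
def pluckerRow {K : Type} [Field K] (w : Fin 6 → K) : Fin 6 → K :=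
  ![w 0 - w 3, w 1 - w 4, w 2 - w 5, w 1 * w 3 - w 0 * w 4, w 2 * w 3 - w 0 * w 5,
    w 2 * w 4 - w 1 * w 5]

/-- The parameters in the web of `a bᵀ + b aᵀ`. -/
def paramRow {K : Type} [Field K] (w : Fin 6 → K) : Fin 4 → K :=
  ![2, w 0 + w 3, w 1 + w 4, 2 * (w 0 * w 3)]

/-- Six nodes for which the Plücker coordinates of the line `ab` are linearly independent. -/
def pluckerNodes : Fin 6 → Fin 10 := ![0, 1, 2, 4, 7, 8]

/-- Four linearly independent nodes. -/
def paramNodes : Fin 4 → Fin 10 := ![1, 3, 4, 5]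

/-- An approximate inverse, in units of `1 / 10`, of the matrix of six of the vectors
`pluckerRow (node k)`. -/
def pluckerInverse : Fin 6 → Fin 6 → ℤ :=
  ![![-351, -144, 68, 156, -274, -608],
    ![-592, -691, -1156, -579, 2308, 607],
    ![-2444, -633, 235, 977, -785, -5172],
    ![-1931, -5015, -10659, -2961, 17555, 3995],
    ![-19679, -4682, 1688, 8254, -5696, -38345],
    ![-19766, -361, 8406, -12102, -2767, 4297]]

/-- An approximate inverse, in units of `1 / 10`, of the matrix of four of the vectors
`nodeParam k`. -/
def paramInverse : Fin 4 → Fin 4 → ℤ :=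
  ![![169, 463, -316, -311],
    ![2521, 7227, -4865, -4883],
    ![3, -54, 106, -54],
    ![9387, 28254, -18539, -19102]]

theorem det_pluckerRow_ne_zero :
    (Matrix.of fun i : Fin 6 => pluckerRow (node (pluckerNodes i))).det ≠ 0 := by
  refine det_ne_zero_of_approx (B := Matrix.of fun i => pluckerRow (nodeRat (pluckerNodes i)))
    (R := Matrix.of fun i j => (pluckerInverse i j : ℚ) / 10) (δ := 2 / 10 ^ 9)
    (fun i j => ?_) ?_
  · have h (l) := abs_le.1 (node_near_rat (pluckerNodes i) l)
    have hm (l m) := abs_le.1 (node_mul_near (pluckerNodes i) l m)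
    rw [abs_le]
    push_cast
    fin_cases j <;> simp only [pluckerRow, Matrix.of_apply, Fin.zero_eta, Fin.mk_one,
      Fin.reduceFinMk, Matrix.cons_val] <;> push_cast
    · constructor <;> linarith [h 0, h 3]
    · constructor <;> linarith [h 1, h 4]
    · constructor <;> linarith [h 2, h 5]
    · constructor <;> linarith [hm 1 3, hm 0 4]
    · constructor <;> linarith [hm 2 3, hm 0 5]
    · constructor <;> linarith [hm 2 4, hm 1 5]
  · decide +kernel

theorem det_paramRow_ne_zero :
    (Matrix.of fun i : Fin 4 => nodeParam (paramNodes i)).det ≠ 0 := by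
  refine det_ne_zero_of_approx (B := Matrix.of fun i => paramRow (nodeRat (paramNodes i)))
    (R := Matrix.of fun i j => (paramInverse i j : ℚ) / 10) (δ := 2 / 10 ^ 9)
    (fun i j => ?_) ?_
  · have h (l) := abs_le.1 (node_near_rat (paramNodes i) l)
    have hm (l m) := abs_le.1 (node_mul_near (paramNodes i) l m)
    rw [abs_le]
    push_cast
    fin_cases j <;> simp only [paramRow, nodeParam, Matrix.of_apply, Fin.zero_eta, Fin.mk_one,
      Fin.reduceFinMk, Matrix.cons_val] <;> push_cast
    · constructor <;> linarith
    · constructor <;> linarith [h 0, h 3]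
    · constructor <;> linarith [h 1, h 4]
    · constructor <;> linarith [hm 0 3]
  · decide +kernel

/-! ### The icosapod -/

/-- The squared length of the two legs given by a node. -/
noncomputable def nodeSqLength (k : Fin 10) : ℝ :=
  node k 0 ^ 2 + node k 1 ^ 2 + node k 2 ^ 2 + node k 3 ^ 2 + node k 4 ^ 2 + node k 5 ^ 2
    - webLift (nodeParam k) / 2

theorem nodeSqLength_rat_pos : ∀ k, 1 / 1000 <
    nodeRat k 0 ^ 2 + nodeRat k 1 ^ 2 + nodeRat k 2 ^ 2 + nodeRat k 3 ^ 2 + nodeRat k 4 ^ 2 +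
      nodeRat k 5 ^ 2 - webLift (paramRow (nodeRat k)) / 2 := by
  decide +kernel

theorem nodeSqLength_pos (k : Fin 10) : 0 < nodeSqLength k := by
  have h (i) := abs_le.1 (node_near_rat k i)
  have hm (i j) := abs_le.1 (node_mul_near k i j)
  have hr := (Rat.cast_lt (K := ℝ)).2 (nodeSqLength_rat_pos k)
  simp only [nodeSqLength, webLift, nodeParam, paramRow, liftCoeff, pow_two, Matrix.cons_val] at hr ⊢
  push_cast at hr
  linarith [hm 0 0, hm 1 1, hm 2 2, hm 3 3, hm 4 4, hm 5 5, hm 0 3, h 0, h 3, h 1, h 4]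

/-- The node and the direction (platform to base, or reversed) of each of the twenty legs. -/
def legIndex : Fin 20 → Fin 10 × Fin 2 :=
  ![(0, 0), (1, 0), (2, 0), (0, 1), (1, 1), (2, 1), (3, 0), (4, 0), (5, 0), (6, 0), (7, 0), (8, 0),
    (9, 0), (3, 1), (4, 1), (5, 1), (6, 1), (7, 1), (8, 1), (9, 1)]

theorem legIndex_injective : Function.Injective legIndex := by decide +kernel

theorem legIndex_surjective : Function.Surjective legIndex := by decide +kernel

/-- The platform point of a leg, in homogeneous coordinates. -/
noncomputable def legA (p : Fin 10 × Fin 2) : Fin 4 → ℝ := ![nodeA p.1, nodeB p.1] p.2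

/-- The base point of a leg, in homogeneous coordinates. -/
noncomputable def legB (p : Fin 10 × Fin 2) : Fin 4 → ℝ := ![nodeB p.1, nodeA p.1] p.2

/-- The icosapod given by the ten nodes. -/
noncomputable def thePod : Pod 20 where
  platform i := WithLp.toLp 2 (Matrix.vecTail (legA (legIndex i)))
  base i := WithLp.toLp 2 (Matrix.vecTail (legB (legIndex i)))
  length i := √(nodeSqLength (legIndex i).1)
  length_pos _ := Real.sqrt_pos.2 (nodeSqLength_pos _)

theorem cons_vecTail_legA (p : Fin 10 × Fin 2) :
    Matrix.vecCons 1 (Matrix.vecTail (legA p)) = legA p := by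
  obtain ⟨k, s⟩ := p
  fin_cases s <;> funext i <;> fin_cases i <;> rfl

theorem cons_vecTail_legB (p : Fin 10 × Fin 2) :
    Matrix.vecCons 1 (Matrix.vecTail (legB p)) = legB p := by
  obtain ⟨k, s⟩ := p
  fin_cases s <;> funext i <;> fin_cases i <;> rfl

theorem legVector_thePod (i : Fin 20) :
    legVector (thePod.platform i) (thePod.base i) (thePod.length i) =
      (Matrix.vecMulVec (legA (legIndex i)) (legB (legIndex i)),
        webLift (nodeParam (legIndex i).1) / 2) := by
  simp only [thePod, legVector]
  generalize legIndex i = p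
  rw [EuclideanSpace.norm_sq_eq, EuclideanSpace.norm_sq_eq, Real.sq_sqrt (nodeSqLength_pos _).le,
    cons_vecTail_legA, cons_vecTail_legB]
  obtain ⟨k, s⟩ := p
  refine Prod.ext rfl ?_
  fin_cases s <;>
    simp [legA, legB, nodeA, nodeB, Matrix.vecTail, Fin.sum_univ_three, nodeSqLength] <;> ring

/-! ### The compactified configuration space -/

/-- The bilinear sphere condition as a linear form on the leg space. -/
def bscLin {K : Type} [Field K] (p : MotionSpace K) : LegSpace K →ₗ[K] K where
  toFun := bsc p
  map_add' w w' := by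
    obtain ⟨h, M, x, y, r⟩ := p
    obtain ⟨z, l⟩ := w
    obtain ⟨z', l'⟩ := w'
    simp [bsc, Fin.sum_univ_three]
    ring
  map_smul' c w := by
    obtain ⟨h, M, x, y, r⟩ := p
    obtain ⟨z, l⟩ := w
    simp [bsc, Fin.sum_univ_three]
    ring

theorem bscLin_apply {K : Type} [Field K] (p : MotionSpace K) (w : LegSpace K) :
    bscLin p w = bsc p w := rfl

theorem bsc_transpose {K : Type} [Field K] {h r : K} {M : Matrix (Fin 3) (Fin 3) K}
    {x : Fin 3 → K} (hM : M = Mᵀ) (z : Mat4 K) (l : K) :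
    bsc (h, M, x, x, r) (zᵀ, l) = bsc (h, M, x, x, r) (z, l) := by
  have e (i j) : M i j = M j i := congrFun (congrFun hM i) j
  simp [bsc, Fin.sum_univ_three, e 1 0, e 2 0, e 2 1]
  ring

theorem map_web {K : Type} [Field K] (f : ℝ →+* K) (v : Fin 4 → ℝ) :
    (web v).map f = web (fun i => f (v i)) := by
  ext i j; fin_cases i <;> fin_cases j <;> simp [web, webForm]

theorem map_webLift {K : Type} [Field K] (f : ℝ →+* K) (v : Fin 4 → ℝ) :
    f (webLift v) = webLift (fun i => f (v i)) := by
  simp [webLift, map_ofNat f 2]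

/-- The coordinates of the `k`-th pair of legs over a field containing the real numbers. -/
noncomputable def legOver {K : Type} [Field K] (f : ℝ →+* K) (p : Fin 10 × Fin 2) : LegSpace K :=
  ((Matrix.vecMulVec (legA p) (legB p)).map f, f (webLift (nodeParam p.1) / 2))

theorem legOver_add {K : Type} [Field K] [CharZero K] (f : ℝ →+* K) (k : Fin 10) :
    legOver f (k, 0) + legOver f (k, 1) =
      (web (fun i => f (nodeParam k i)), webLift (fun i => f (nodeParam k i))) := by
  refine Prod.ext ?_ ?_
  · rw [← map_web, web_nodeParam]
    ext i j
    simp [legOver, legA, legB, symProd_apply, Matrix.vecMulVec_apply]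
  · rw [← map_webLift]
    simp only [legOver, Prod.snd_add, ← map_add]
    congr 1
    ring

theorem det_map_ne_zero {K : Type} [Field K] {n : ℕ} (f : ℝ →+* K) {A : Matrix (Fin n) (Fin n) ℝ}
    (h : A.det ≠ 0) : (A.map f).det ≠ 0 := by
  have := RingHom.map_det f A
  rw [RingHom.mapMatrix_apply] at this
  rw [← this]
  exact (map_ne_zero f).2 h

/-- A point that satisfies the twenty sphere conditions satisfies the linear equations of `Xinv`
and the conditions of the lifted web: the ten differences of paired legs span the six-dimensional
space of antisymmetric conditions, the ten sums span the lifted web. -/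
theorem involutory_of_legs {K : Type} [Field K] [CharZero K] (f : ℝ →+* K) {h r : K}
    {M : Matrix (Fin 3) (Fin 3) K} {x y : Fin 3 → K}
    (H : ∀ p, bsc (h, M, x, y, r) (legOver f p) = 0) :
    M = Mᵀ ∧ x = y ∧ ∀ v, bsc (h, M, x, y, r) (web v, webLift v) = 0 := by
  have hg : (![x 0 - y 0, x 1 - y 1, x 2 - y 2, M 0 1 - M 1 0, M 0 2 - M 2 0, M 1 2 - M 2 1] :
      Fin 6 → K) = 0 := by
    refine Matrix.eq_zero_of_mulVec_eq_zero (det_map_ne_zero f det_pluckerRow_ne_zero) ?_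
    funext i
    have h0 := H (pluckerNodes i, 0)
    have h1 := H (pluckerNodes i, 1)
    simp [bsc, legOver, legA, legB, nodeA, nodeB, Fin.sum_univ_three]
      at h0 h1
    simp [Matrix.mulVec, dotProduct, Fin.sum_univ_succ, pluckerRow]
    linear_combination (h1 - h0) / 2
  have e (i) := congrFun hg i
  have e0 := e 0
  have e1 := e 1
  have e2 := e 2
  have e3 := e 3
  have e4 := e 4
  have e5 := e 5
  simp [sub_eq_zero] at e0 e1 e2 e3 e4 e5
  refine ⟨?_, ?_, ?_⟩
  · ext i j; fin_cases i <;> fin_cases j <;> simp [e3, e4, e5]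
  · funext i; fin_cases i <;> simpa
  · set φ := (bscLin (h, M, x, y, r)).comp liftMap with hφ
    have hv (v : Fin 4 → K) : φ v = ∑ j, v j * φ (Pi.single j 1) := by
      conv_lhs => rw [pi_eq_sum_univ' v, map_sum]
      refine Finset.sum_congr rfl fun j _ => ?_
      rw [map_smul, smul_eq_mul]
    have h0 : (fun j => φ (Pi.single j 1)) = 0 := by
      refine Matrix.eq_zero_of_mulVec_eq_zero (det_map_ne_zero f det_paramRow_ne_zero) ?_
      funext i
      have h1 : φ (fun j => f (nodeParam (paramNodes i) j)) = 0 := by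
        rw [hφ, LinearMap.comp_apply, liftMap_apply, ← legOver_add, map_add, bscLin_apply,
          bscLin_apply, H, H, add_zero]
      rw [hv] at h1
      exact h1
    intro v
    have : φ v = 0 := by
      rw [hv]
      exact Finset.sum_eq_zero fun j _ => by rw [congrFun h0 j]; simp
    exact this

theorem bsc_legOver {K : Type} [Field K] [CharZero K] (f : ℝ →+* K) {h r : K}
    {M : Matrix (Fin 3) (Fin 3) K} {x : Fin 3 → K} (hM : M = Mᵀ)
    (H : ∀ v, bsc (h, M, x, x, r) (web v, webLift v) = 0) (p : Fin 10 × Fin 2) :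
    bsc (h, M, x, x, r) (legOver f p) = 0 := by
  obtain ⟨k, s⟩ := p
  have h1 := H (fun i => f (nodeParam k i))
  rw [← legOver_add, ← bscLin_apply, map_add, bscLin_apply, bscLin_apply] at h1
  have h2 : bsc (h, M, x, x, r) (legOver f (k, 1)) = bsc (h, M, x, x, r) (legOver f (k, 0)) := by
    rw [← bsc_transpose hM (legOver f (k, 0)).1]
    congr 1
    refine Prod.ext ?_ rfl
    ext i j
    simp [legOver, legA, legB, Matrix.vecMulVec_apply, mul_comm]
  rw [h2, ← two_mul] at h1
  have h3 := (mul_eq_zero.1 h1).resolve_left two_ne_zero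
  fin_cases s
  · exact h3
  · exact h2.trans h3

theorem bsc_matE {K : Type} [Field K] (h r : K) (M : Matrix (Fin 3) (Fin 3) K) (x y : Fin 3 → K) :
    bsc (h, M, x, y, r) (web ![0, 0, 0, 1], webLift ![0, 0, 0, 1]) = -2 * (M.trace + h) := by
  simp [bsc, web, webForm, webLift, Fin.sum_univ_three, Matrix.trace]
  ring

theorem legVector_toComplex_thePod (i : Fin 20) :
    (legVector (thePod.platform i) (thePod.base i) (thePod.length i)).toComplex =
      legOver Complex.ofRealHom (legIndex i) := by
  rw [legVector_thePod]
  rfl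

theorem forall_legs_iff (p : MotionSpace ℂ) :
    (∀ i, bsc p (legVector (thePod.platform i) (thePod.base i) (thePod.length i)).toComplex = 0) ↔
      IsInvolutory p ∧ ∀ v : Fin 4 → ℂ, bsc p (web v, webLift v) = 0 := by
  obtain ⟨h, M, x, y, r⟩ := p
  constructor
  · intro H
    have H' : ∀ q, bsc (h, M, x, y, r) (legOver Complex.ofRealHom q) = 0 := fun q => by
      obtain ⟨i, rfl⟩ := legIndex_surjective q
      rw [← legVector_toComplex_thePod]
      exact H i
    obtain ⟨hM, hx, hv⟩ := involutory_of_legs _ H'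
    refine ⟨⟨hM, hx, ?_⟩, hv⟩
    have := hv ![0, 0, 0, 1]
    rw [bsc_matE] at this
    simpa using this
  · rintro ⟨⟨hM, rfl, -⟩, hv⟩ i
    rw [legVector_toComplex_thePod]
    exact bsc_legOver _ hM hv _

theorem forall_theLift_iff (p : MotionSpace ℂ) :
    (∀ w ∈ theLift, bsc p w.toComplex = 0) ↔ ∀ v : Fin 4 → ℂ, bsc p (web v, webLift v) = 0 := by
  have e (v : Fin 4 → ℝ) : LegSpace.toComplex (liftMap v) =
      (web (fun i => (v i : ℂ)), webLift (fun i => (v i : ℂ))) :=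
    Prod.ext (map_ofReal_web v) (ofReal_webLift v)
  constructor
  · intro H v
    have h1 : ∀ i, bsc p (liftMap (Pi.single i (1 : ℂ))) = 0 := fun i => by
      have := H _ ⟨Pi.single i (1 : ℝ), rfl⟩
      rw [e] at this
      have hs : (fun j => ((Pi.single i (1 : ℝ) : Fin 4 → ℝ) j : ℂ)) = Pi.single i 1 := by
        funext j
        by_cases hij : j = i
        · subst hij; simp
        · simp [hij]
      rwa [hs] at this
    rw [← liftMap_apply, pi_eq_sum_univ' v, map_sum, ← bscLin_apply, map_sum]
    refine Finset.sum_eq_zero fun i _ => ?_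
    rw [map_smul, map_smul, bscLin_apply, h1, smul_zero]
  · rintro H _ ⟨v, rfl⟩
    rw [e]
    exact H _

/-- The compactified configuration set is the curve of Borel's construction. -/
theorem compactConfig_thePod : thePod.compactConfig = borelCurve theLift := by
  ext p
  simp only [Pod.compactConfig, borelCurve, Xinv, Set.mem_ofPred_eq, forall_legs_iff,
    forall_theLift_iff, and_assoc]

theorem legPoint_injective : Function.Injective thePod.legPoint := by
  intro i j h
  rw [Pod.legPoint, Pod.legPoint, Projectivization.mk_eq_mk_iff'] at h
  obtain ⟨c, hc⟩ := h
  rw [legVector_toComplex_thePod, legVector_toComplex_thePod] at hc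
  have e (a b) := congrFun (congrFun (congrArg Prod.fst hc) a) b
  have a0 (p) : legA p 0 = 1 := by obtain ⟨k, s⟩ := p; fin_cases s <;> rfl
  have b0 (p) : legB p 0 = 1 := by obtain ⟨k, s⟩ := p; fin_cases s <;> rfl
  have a1 (p : Fin 10 × Fin 2) : legA p 1 = node p.1 (![0, 3] p.2) := by
    obtain ⟨k, s⟩ := p; fin_cases s <;> rfl
  have e0 := e 0 0
  have e1 := e 1 0
  simp [legOver, Matrix.vecMulVec_apply, a0, b0] at e0 e1
  rw [e0, one_mul, a1, a1] at e1
  exact legIndex_injective (node_first_injective (by exact_mod_cast e1.symm))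

theorem thePod_first_legs (k : Fin 6) :
    thePod.base (Fin.castLE (by norm_num) k) = exBase k ∧
      thePod.platform (Fin.castLE (by norm_num) k) = exPlatform k ∧
      thePod.length (Fin.castLE (by norm_num) k) ^ 2 = exSqLength k := by
  have n0 := node_rational 0
  have n1 := node_rational 1
  have n2 := node_rational 2
  simp only [show Fin.castAdd 7 (0 : Fin 3) = 0 from rfl, show Fin.castAdd 7 (1 : Fin 3) = 1 from rfl,
    show Fin.castAdd 7 (2 : Fin 3) = 2 from rfl] at n0 n1 n2
  refine ⟨?_, ?_, ?_⟩
  · ext j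
    fin_cases k <;> fin_cases j <;>
      simp [thePod, legIndex, legB, nodeA, nodeB, n0, n1, n2, rationalNode, exBase,
        Matrix.vecTail]
  · ext j
    fin_cases k <;> fin_cases j <;>
      simp [thePod, legIndex, legA, nodeA, nodeB, n0, n1, n2, rationalNode, exPlatform,
        Matrix.vecTail]
  · simp only [thePod]
    rw [Real.sq_sqrt (nodeSqLength_pos _).le]
    fin_cases k <;>
      simp [legIndex, nodeSqLength, n0, n1, n2, rationalNode, exSqLength, webLift, liftCoeff,
        nodeParam] <;> norm_num

/-! ### The curve at infinity -/

/-- The conclusion is the product of the hypothesis with its conjugate `P - σ Q`. -/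
theorem conj_aux {P Q σ : ℂ} (hσ : σ ^ 2 = -1) (h : P + σ * Q = 0) : P ^ 2 + Q ^ 2 = 0 := by
  linear_combination (P - σ * Q) * h + Q ^ 2 * hσ

/-- The curve does not meet the linear subspace `h = m₁₁ = 0`. -/
theorem borelCurve_avoids {h r : ℂ} {M : Matrix (Fin 3) (Fin 3) ℂ} {x : Fin 3 → ℂ}
    (hX : IsInX (h, M, x, x, r)) (hM : M = Mᵀ) (htr : M.trace + h = 0)
    (hv : ∀ v : Fin 4 → ℂ, bsc (h, M, x, x, r) (web v, webLift v) = 0) (hh : h = 0)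
    (h00 : M 0 0 = 0) : M = 0 ∧ x = 0 ∧ r = 0 := by
  subst hh
  obtain ⟨h1, -, -, -, hMx, hxx, -⟩ := hX
  have s (i j) : M i j = M j i := congrFun (congrFun hM i) j
  have g (i j) := congrFun (congrFun h1 i) j
  have g00 := g 0 0
  have g11 := g 1 1
  have g22 := g 2 2
  have mx (i) := congrFun hMx i
  have mx1 := mx 1
  simp [Matrix.mul_apply, Fin.sum_univ_three, s 1 0, s 2 0, s 2 1, h00] at g00 g11 g22
  simp [Matrix.mulVec, dotProduct, Fin.sum_univ_three, s 1 0] at mx1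
  simp [dotProduct, Fin.sum_univ_three] at hxx
  have hm22 : M 2 2 = -M 1 1 := by
    simp [Matrix.trace, Fin.sum_univ_three, h00] at htr
    linear_combination htr
  rw [hm22] at g22
  have m01 : M 0 1 = 0 := by
    have : M 0 1 ^ 2 = 0 := by linear_combination (g00 + g11 - g22) / 2
    simpa using this
  have m02 : M 0 2 = 0 := by
    have : M 0 2 ^ 2 = 0 := by linear_combination (g00 - g11 + g22) / 2
    simpa using this
  rw [m01] at g11 mx1
  have b0 := hv ![1, 0, 0, 0]
  have b1 := hv ![0, 1, 0, 0]
  have b2 := hv ![0, 0, 1, 0]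
  simp [bsc, web, webForm, Fin.sum_univ_three, s 1 0, s 2 0, s 2 1, h00, m01, m02, hm22]
    at b0 b1 b2
  have key : M 1 1 = 0 := by
    by_contra hp
    -- the block of `M` is `p (1, σ; σ, -1)`, with `σ² = -1`
    obtain ⟨σ, hσ⟩ : ∃ σ, M 1 2 = σ * M 1 1 := ⟨M 1 2 / M 1 1, by field_simp⟩
    have hσ2 : σ ^ 2 = -1 := by
      have : M 1 1 ^ 2 * (σ ^ 2 + 1) = 0 := by rw [hσ] at g11; linear_combination g11
      have := (mul_eq_zero.1 this).resolve_left (pow_ne_zero 2 hp)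
      linear_combination this
    have hx1 : x 1 = -σ * x 2 := by
      have : M 1 1 * (x 1 + σ * x 2) = 0 := by rw [hσ] at mx1; linear_combination mx1
      have := (mul_eq_zero.1 this).resolve_left hp
      linear_combination this
    have hx0 : x 0 = 0 := by
      have : x 0 ^ 2 = 0 := by rw [hx1] at hxx; linear_combination hxx - x 2 ^ 2 * hσ2
      simpa using this
    rw [hσ, hx0] at b1
    rw [hσ, hx1] at b2
    have hPQ := conj_aux (σ := σ)
      (P := (webCoeff 0 1 : ℂ) * (webCoeff 3 2 - webCoeff 5 2)
        - (webCoeff 0 2 * (webCoeff 3 1 - webCoeff 5 1) + 2 * webCoeff 4 1))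
      (Q := (webCoeff 0 1 : ℂ) * (2 * webCoeff 4 2)
        - (2 * webCoeff 0 2 * webCoeff 4 1 - (webCoeff 3 1 - webCoeff 5 1))) hσ2 (by
        refine (mul_eq_zero.1 (?_ : M 1 1 * _ = 0)).resolve_left hp
        linear_combination (-(webCoeff 0 1 : ℂ) / 2) * b2 + ((webCoeff 0 2 : ℂ) - σ) / 2 * b1
          - 2 * M 1 1 * webCoeff 4 1 * hσ2)
    have hq : ((webCoeff 0 1 * (webCoeff 3 2 - webCoeff 5 2)
        - (webCoeff 0 2 * (webCoeff 3 1 - webCoeff 5 1) + 2 * webCoeff 4 1)) ^ 2 +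
        (webCoeff 0 1 * (2 * webCoeff 4 2)
        - (2 * webCoeff 0 2 * webCoeff 4 1 - (webCoeff 3 1 - webCoeff 5 1))) ^ 2 : ℚ) = 0 := by
      exact_mod_cast hPQ
    revert hq
    decide +kernel
  have m12 : M 1 2 = 0 := by
    have : M 1 2 ^ 2 = 0 := by rw [key] at g11; linear_combination g11
    simpa using this
  rw [key, m12] at b0 b1 b2
  have hx2 : x 2 = 0 := by
    have e0 : x 0 = -webCoeff 0 1 * x 2 := by linear_combination -b1 / 4
    have e1 : x 1 = -webCoeff 0 2 * x 2 := by linear_combination -b2 / 4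
    rw [e0, e1] at hxx
    have : x 2 ^ 2 * ((webCoeff 0 1 ^ 2 + webCoeff 0 2 ^ 2 + 1 : ℚ) : ℂ) = 0 := by
      push_cast; linear_combination hxx
    refine eq_zero_of_pow_eq_zero ((mul_eq_zero.1 this).resolve_right ?_)
    have : (webCoeff 0 1 ^ 2 + webCoeff 0 2 ^ 2 + 1 : ℚ) ≠ 0 := by positivity
    exact_mod_cast this
  rw [hx2] at b0 b1 b2
  refine ⟨?_, ?_, ?_⟩
  · ext i j; fin_cases i <;> fin_cases j <;> simp [s 1 0, s 2 0, s 2 1, h00, m01, m02, key, m12, hm22]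
  · funext i
    fin_cases i
    · show x 0 = 0
      linear_combination -b1 / 4
    · show x 1 = 0
      linear_combination -b2 / 4
    · exact hx2
  · linear_combination b0

/-! ### Configurations as half-turns -/

/-- The coordinates `(1, M, x, y, r)` of a direct isometry. -/
def Pose.toMotion (σ : Pose) : MotionSpace ℝ :=
  (1, Matrix.of σ.1, -((Matrix.of σ.1)ᵀ *ᵥ σ.2), σ.2, σ.2 ⬝ᵥ σ.2)

/-- The bilinear sphere condition at a direct isometry is the sphere condition. -/
theorem bsc_toMotion {σ : Pose} (hσ : σ ∈ SE3) (a b : E3) (d : ℝ) :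
    bsc σ.toMotion (legVector a b d) = ‖σ.act a - b‖ ^ 2 - d ^ 2 := by
  obtain ⟨M, y⟩ := σ
  have horth := (Matrix.mem_orthogonalGroup_iff' _ _).1 (Matrix.mem_specialOrthogonalGroup_iff.1 hσ).1
  have g (i j) := congrFun (congrFun horth i) j
  have g00 := g 0 0
  have g11 := g 1 1
  have g22 := g 2 2
  have g01 := g 0 1
  have g02 := g 0 2
  have g12 := g 1 2
  simp [Matrix.mul_apply, Fin.sum_univ_three] at g00 g11 g22 g01 g02 g12
  simp [bsc, Pose.toMotion, legVector, EuclideanSpace.norm_sq_eq, Pose.act, Fin.sum_univ_three,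
    Matrix.mulVec, dotProduct]
  linear_combination -(a 0 ^ 2) * g00 - (a 1 ^ 2) * g11 - (a 2 ^ 2) * g22 - 2 * (a 0 * a 1) * g01
    - 2 * (a 0 * a 2) * g02 - 2 * (a 1 * a 2) * g12

theorem Pod.mem_config_iff {n : ℕ} (P : Pod n) (σ : Pose) :
    σ ∈ P.config ↔ σ ∈ SE3 ∧
      ∀ i, bsc σ.toMotion (legVector (P.platform i) (P.base i) (P.length i)) = 0 := by
  refine and_congr_right fun hσ => forall_congr' fun i => ?_
  rw [bsc_toMotion hσ, sub_eq_zero, sq_eq_sq₀ (norm_nonneg _) (P.length_pos i).le]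

/-- The configurations are the involutions in `SE(3)` that satisfy the conditions of the lifted web.
-/
theorem mem_config_thePod_iff (σ : Pose) :
    σ ∈ thePod.config ↔ σ ∈ SE3 ∧ Matrix.of σ.1 = (Matrix.of σ.1)ᵀ ∧
      -((Matrix.of σ.1)ᵀ *ᵥ σ.2) = σ.2 ∧ ∀ v, bsc σ.toMotion (web v, webLift v) = 0 := by
  rw [Pod.mem_config_iff]
  refine and_congr_right fun _ => ?_
  have e (i) : legVector (thePod.platform i) (thePod.base i) (thePod.length i) =
      legOver (RingHom.id ℝ) (legIndex i) := by
    rw [legVector_thePod]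
    simp [legOver]
  constructor
  · intro H
    exact involutory_of_legs (RingHom.id ℝ) fun p => by
      obtain ⟨i, rfl⟩ := legIndex_surjective p
      rw [← e]
      exact H i
  · rintro ⟨hM, hx, hv⟩ i
    rw [e]
    simp only [Pose.toMotion, hx] at hv ⊢
    exact bsc_legOver _ hM hv _

/-- The half-turn around a line of direction `u` followed by the translation by `y`; for `y`
orthogonal to `u` this is the half-turn around the line through `y / 2` of direction `u`. -/
noncomputable def turn (u y : Fin 3 → ℝ) : Pose :=
  (fun i j => 2 * u i * u j / (u ⬝ᵥ u) - (if i = j then 1 else 0), y)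

theorem turn_eq_halfTurn {u y : Fin 3 → ℝ} (h : u ⬝ᵥ y = 0) :
    turn u y = halfTurn (fun i => y i / 2) u := by
  refine Prod.ext rfl ?_
  have : (fun i => y i / 2) ⬝ᵥ u = 0 := by
    simp [dotProduct, Fin.sum_univ_three] at h ⊢
    linear_combination h / 2
  funext i
  simp [halfTurn, turn, this]
  ring

theorem dot_self_eq (u : Fin 3 → ℝ) : u ⬝ᵥ u = u 0 ^ 2 + u 1 ^ 2 + u 2 ^ 2 := by
  simp [dotProduct, Fin.sum_univ_three]
  ring

theorem dot_self_pos {u : Fin 3 → ℝ} (hu : u ≠ 0) : 0 < u 0 ^ 2 + u 1 ^ 2 + u 2 ^ 2 := by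
  rw [← dot_self_eq]
  have := Matrix.dotProduct_star_self_pos_iff.2 hu
  simpa using this

theorem turn_mem_SE3 {u : Fin 3 → ℝ} (hu : u ≠ 0) (y : Fin 3 → ℝ) : turn u y ∈ SE3 := by
  have hs := (dot_self_pos hu).ne'
  rw [SE3, Set.mem_ofPred_eq, Matrix.mem_specialOrthogonalGroup_iff, Matrix.mem_orthogonalGroup_iff]
  simp only [turn, dot_self_eq]
  constructor
  · ext i j
    rw [Matrix.mul_apply, Fin.sum_univ_three]
    fin_cases i <;> fin_cases j <;> simp <;> field_simp <;> ring
  · rw [Matrix.det_fin_three]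
    simp
    field_simp
    ring

theorem turn_symm (u y : Fin 3 → ℝ) : Matrix.of (turn u y).1 = (Matrix.of (turn u y).1)ᵀ := by
  ext i j
  simp only [turn, Matrix.of_apply, Matrix.transpose_apply, eq_comm (a := i)]
  ring

theorem turn_fixes {u y : Fin 3 → ℝ} (h : u ⬝ᵥ y = 0) : -((Matrix.of (turn u y).1)ᵀ *ᵥ y) = y := by
  rw [← turn_symm]
  have h' : u 0 * y 0 + u 1 * y 1 + u 2 * y 2 = 0 := by
    simpa [dotProduct, Fin.sum_univ_three] using h
  funext i
  simp only [turn, Pi.neg_apply, Matrix.mulVec, dotProduct, Fin.sum_univ_three, Matrix.of_apply]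
  fin_cases i <;> simp
  · linear_combination (-2 * u 0 / (u 0 * u 0 + u 1 * u 1 + u 2 * u 2)) * h'
  · linear_combination (-2 * u 1 / (u 0 * u 0 + u 1 * u 1 + u 2 * u 2)) * h'
  · linear_combination (-2 * u 2 / (u 0 * u 0 + u 1 * u 1 + u 2 * u 2)) * h'

/-- A symmetric direct isometry matrix of trace `-1` that maps `y` to `-y` is a half-turn, as all
`2 × 2` minors of `M + 1` vanish. -/
theorem exists_turn {σ : Pose} (hσ : σ ∈ SE3) (hM : Matrix.of σ.1 = (Matrix.of σ.1)ᵀ)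
    (hy : -((Matrix.of σ.1)ᵀ *ᵥ σ.2) = σ.2) (htr : (Matrix.of σ.1).trace + 1 = 0) :
    ∃ u : Fin 3 → ℝ, u ≠ 0 ∧ (u 0 = 1 ∨ u 0 = 0) ∧ u ⬝ᵥ σ.2 = 0 ∧ σ = turn u σ.2 := by
  obtain ⟨M, y⟩ := σ
  obtain ⟨horth, hdet⟩ := Matrix.mem_specialOrthogonalGroup_iff.1 hσ
  rw [Matrix.mem_orthogonalGroup_iff] at horth
  have s (i j) : M i j = M j i := congrFun (congrFun hM i) j
  have htr' : M 0 0 + M 1 1 + M 2 2 + 1 = 0 := by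
    simpa [Matrix.trace, Fin.sum_univ_three] using htr
  -- the adjugate of `M` is its transpose
  have hadj : (Matrix.of M).adjugate = Matrix.of M := by
    have h2 : Matrix.of M * Matrix.of M = 1 := by
      have h1 : Matrix.of M * (Matrix.of M)ᵀ = 1 := horth
      rwa [← hM] at h1
    calc (Matrix.of M).adjugate = (Matrix.of M).adjugate * (Matrix.of M * Matrix.of M) := by
          rw [h2, mul_one]
      _ = Matrix.of M := by
          rw [← mul_assoc, Matrix.adjugate_mul]
          simp only at hdet
          rw [hdet, one_smul, one_mul]
  have g (i j) := congrFun (congrFun hadj i) j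
  have g00 := g 0 0
  have g11 := g 1 1
  have g22 := g 2 2
  have g01 := g 0 1
  have g02 := g 0 2
  have g12 := g 1 2
  simp [Matrix.adjugate_fin_three, s 1 0, s 2 0, s 2 1] at g00 g11 g22 g01 g02 g12
  set N : Fin 3 → Fin 3 → ℝ := fun i j => M i j + if i = j then 1 else 0 with hN
  have hminor : ∀ i j k, N j k * N i i = N i j * N i k := by
    intro i j k
    fin_cases i <;> fin_cases j <;> fin_cases k <;> simp [hN, s 1 0, s 2 0, s 2 1] <;>
      first
      | ring1
      | linear_combination g00 + htr'
      | linear_combination g11 + htr'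
      | linear_combination g22 + htr'
      | linear_combination -g01
      | linear_combination -g02
      | linear_combination -g12
  obtain ⟨i, hi, hi0⟩ : ∃ i, N i i ≠ 0 ∧ (i = 0 ∨ N 0 0 = 0) := by
    by_cases h0 : N 0 0 = 0
    · by_cases h1 : N 1 1 = 0
      · refine ⟨2, fun h2 => ?_, Or.inr h0⟩
        simp [hN] at h0 h1 h2
        linarith
      · exact ⟨1, h1, Or.inr h0⟩
    · exact ⟨0, h0, Or.inl rfl⟩
  have hsum : N i 0 ^ 2 + N i 1 ^ 2 + N i 2 ^ 2 = 2 * N i i := by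
    have h0 := hminor i 0 0
    have h1 := hminor i 1 1
    have h2 := hminor i 2 2
    have : N 0 0 + N 1 1 + N 2 2 = 2 := by simp [hN]; linarith
    linear_combination -h0 - h1 - h2 + N i i * this
  have hu : (fun j => N i j / N i i) ≠ 0 := fun h => by
    have := congrFun h i
    simp [hi] at this
  refine ⟨fun j => N i j / N i i, hu, ?_, ?_, ?_⟩
  · rcases hi0 with rfl | h0
    · left
      exact div_self hi
    · right
      have := hminor i 0 0
      rw [h0, zero_mul] at this
      have : N i 0 = 0 := by simpa using this.symm
      simp only
      rw [this, zero_div]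
  · have : N i 0 * y 0 + N i 1 * y 1 + N i 2 * y 2 = 0 := by
      have := congrFun hy i
      simp only [Pi.neg_apply, Matrix.mulVec, dotProduct, Fin.sum_univ_three, Matrix.transpose_apply,
        Matrix.of_apply, s 0 i, s 1 i, s 2 i] at this
      fin_cases i <;> simp [hN] at this ⊢ <;> linarith
    simp only [dotProduct, Fin.sum_univ_three]
    field_simp
    linarith
  · refine Prod.ext ?_ rfl
    funext j k
    have hs := (dot_self_pos hu).ne'
    simp only [turn, dot_self_eq]
    rw [eq_sub_iff_add_eq, eq_div_iff hs]
    change N j k * _ = _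
    have : N j k * N i i = N i j * N i k := hminor i j k
    field_simp
    rw [hsum]
    linear_combination 2 * this

/-! ### The plane sextic of directions -/

section Forms

variable {R : Type} [CommRing R] [Algebra ℝ R]

/-- The quadratic form `|u|²`. -/
def normForm (u : Fin 3 → R) : R := u 0 ^ 2 + u 1 ^ 2 + u 2 ^ 2

/-- The quadratic form in the direction `u` of a half-turn given by those terms of the sphere
condition of `w` that do not involve the translation, multiplied by `|u|²`. -/
def legConic (w : LegSpace ℝ) (u : Fin 3 → R) : R :=
  algebraMap ℝ R (w.2 + 2 * (w.1 1 1 + w.1 2 2 + w.1 3 3)) * normForm u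
    - 4 * ∑ i : Fin 3, ∑ j : Fin 3, algebraMap ℝ R (w.1 i.succ j.succ) * (u i * u j)

/-- The `k`-th basis vector of the lifted web. -/
noncomputable def liftBasis (k : Fin 4) : LegSpace ℝ := liftMap (Pi.single k 1)

/-- The linear form whose vanishing makes the linear equations for the translation `y` of a
half-turn of direction `u` dependent. -/
def deltaForm (u : Fin 3 → R) : R :=
  u 2 - algebraMap ℝ R (webCoeff 0 1) * u 0 - algebraMap ℝ R (webCoeff 0 2) * u 1

/-- The numerators, with denominator `4 Δ(u) |u|²`, of the solution `y` of the linear equations. -/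
noncomputable def numForm (u : Fin 3 → R) : Fin 3 → R :=
  let c := u 0 * legConic (liftBasis 1) u + u 1 * legConic (liftBasis 2) u
  ![deltaForm u * legConic (liftBasis 1) u + algebraMap ℝ R (webCoeff 0 1) * c,
    deltaForm u * legConic (liftBasis 2) u + algebraMap ℝ R (webCoeff 0 2) * c,
    -c]

/-- The sextic form that vanishes on the directions of the configurations. -/
noncomputable def sexticForm (u : Fin 3 → R) : R :=
  numForm u 0 ^ 2 + numForm u 1 ^ 2 + numForm u 2 ^ 2
    - 16 * algebraMap ℝ R (webCoeff 0 0) * numForm u 2 * deltaForm u * normForm u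
    + 16 * legConic (liftBasis 0) u * deltaForm u ^ 2 * normForm u

/-- The cubic form given by the sphere condition of `w` along the curve, for `w` without entry `00`.
-/
noncomputable def legCubic (w : LegSpace ℝ) (u : Fin 3 → R) : R :=
  legConic w u * deltaForm u
    - ∑ i : Fin 3, algebraMap ℝ R ((w.1 i.succ 0 + w.1 0 i.succ) / 2) * numForm u i

variable {S : Type} [CommRing S] [Algebra ℝ S] (φ : R →ₐ[ℝ] S)

theorem map_normForm (u : Fin 3 → R) : φ (normForm u) = normForm fun i => φ (u i) := by
  simp [normForm]

theorem map_legConic (w : LegSpace ℝ) (u : Fin 3 → R) :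
    φ (legConic w u) = legConic w fun i => φ (u i) := by
  simp only [legConic, map_sub, map_mul, map_sum, map_normForm, AlgHom.commutes, map_ofNat]

theorem map_deltaForm (u : Fin 3 → R) : φ (deltaForm u) = deltaForm fun i => φ (u i) := by
  simp only [deltaForm, map_sub, map_mul, AlgHom.commutes]

theorem map_numForm (u : Fin 3 → R) (k : Fin 3) :
    φ (numForm u k) = numForm (fun i => φ (u i)) k := by
  fin_cases k <;>
    simp [numForm, map_legConic, map_deltaForm]

theorem map_sexticForm (u : Fin 3 → R) : φ (sexticForm u) = sexticForm fun i => φ (u i) := by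
  simp only [sexticForm, map_sub, map_add, map_mul, map_pow, map_numForm, map_legConic,
    map_deltaForm, map_normForm, AlgHom.commutes, map_ofNat]

theorem map_legCubic (w : LegSpace ℝ) (u : Fin 3 → R) :
    φ (legCubic w u) = legCubic w fun i => φ (u i) := by
  simp only [legCubic, map_sub, map_mul, map_sum, map_numForm, map_legConic, map_deltaForm,
    AlgHom.commutes]

end Forms

theorem bsc_turn {u y : Fin 3 → ℝ} (hu : u ≠ 0) (h : u ⬝ᵥ y = 0) (w : LegSpace ℝ) :
    normForm u * bsc (turn u y).toMotion w = normForm u * (w.1 0 0 * (y 0 ^ 2 + y 1 ^ 2 + y 2 ^ 2)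
      - 2 * ∑ i : Fin 3, (w.1 i.succ 0 + w.1 0 i.succ) * y i) + legConic w u := by
  have hs := (dot_self_pos hu).ne'
  obtain ⟨z, l⟩ := w
  simp only [Pose.toMotion]
  rw [show (turn u y).2 = y from rfl, turn_fixes h]
  simp only [bsc, turn, legConic, normForm, Fin.sum_univ_three, dotProduct,
    Matrix.of_apply, Algebra.algebraMap_self, RingHom.id_apply]
  simp
  field_simp
  ring

/-- The equations for the translation `y` of a configuration with direction `u`. -/
theorem turn_mem_config_iff {u y : Fin 3 → ℝ} (hu : u ≠ 0) (h : u ⬝ᵥ y = 0) :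
    turn u y ∈ thePod.config ↔
      4 * normForm u * (y 0 + webCoeff 0 1 * y 2) = legConic (liftBasis 1) u ∧
      4 * normForm u * (y 1 + webCoeff 0 2 * y 2) = legConic (liftBasis 2) u ∧
      normForm u * (y 0 ^ 2 + y 1 ^ 2 + y 2 ^ 2 - 4 * webCoeff 0 0 * y 2)
        + legConic (liftBasis 0) u = 0 := by
  have hs : normForm u ≠ 0 := (dot_self_pos hu).ne'
  rw [mem_config_thePod_iff]
  have e0 : normForm u * bsc (turn u y).toMotion (liftBasis 0) = normForm u *
      (y 0 ^ 2 + y 1 ^ 2 + y 2 ^ 2 - 4 * webCoeff 0 0 * y 2) + legConic (liftBasis 0) u := by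
    rw [bsc_turn hu h]
    congr 2
    simp [liftBasis, web, webForm, Fin.sum_univ_three]
    ring
  have e1 : normForm u * bsc (turn u y).toMotion (liftBasis 1) = normForm u *
      (-4 * (y 0 + webCoeff 0 1 * y 2)) + legConic (liftBasis 1) u := by
    rw [bsc_turn hu h]
    congr 2
    simp [liftBasis, web, webForm, Fin.sum_univ_three]
    ring
  have e2 : normForm u * bsc (turn u y).toMotion (liftBasis 2) = normForm u *
      (-4 * (y 1 + webCoeff 0 2 * y 2)) + legConic (liftBasis 2) u := by
    rw [bsc_turn hu h]
    congr 2
    simp [liftBasis, web, webForm, Fin.sum_univ_three]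
    ring
  have e3 : normForm u * bsc (turn u y).toMotion (liftBasis 3) = 0 := by
    rw [bsc_turn hu h]
    simp [legConic, liftBasis, web, webForm, webLift, Fin.sum_univ_three, normForm]
    ring
  constructor
  · rintro ⟨-, -, -, H⟩
    have H' (k : Fin 4) : bsc (turn u y).toMotion (liftBasis k) = 0 := H (Pi.single k 1)
    rw [H'] at e0 e1 e2
    exact ⟨by linear_combination e1, by linear_combination e2, by linear_combination -e0⟩
  · rintro ⟨h1, h2, h0⟩
    refine ⟨turn_mem_SE3 hu y, turn_symm u y, turn_fixes h, fun v => ?_⟩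
    have b (k : Fin 4) : bsc (turn u y).toMotion (liftBasis k) = 0 := by
      refine (mul_eq_zero.1 ?_).resolve_left hs
      fin_cases k
      · exact e0.trans (by linear_combination h0)
      · exact e1.trans (by linear_combination -h1)
      · exact e2.trans (by linear_combination -h2)
      · exact e3
    rw [← liftMap_apply, pi_eq_sum_univ' v, map_sum, ← bscLin_apply, map_sum]
    refine Finset.sum_eq_zero fun i _ => ?_
    rw [map_smul, map_smul, bscLin_apply]
    exact (congrArg _ (b i)).trans (smul_zero _)

theorem numForm_eq {u y : Fin 3 → ℝ} (h : u ⬝ᵥ y = 0)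
    (h1 : 4 * normForm u * (y 0 + webCoeff 0 1 * y 2) = legConic (liftBasis 1) u)
    (h2 : 4 * normForm u * (y 1 + webCoeff 0 2 * y 2) = legConic (liftBasis 2) u) (k : Fin 3) :
    numForm u k = 4 * deltaForm u * normForm u * y k := by
  have h' : u 0 * y 0 + u 1 * y 1 + u 2 * y 2 = 0 := by
    simpa [dotProduct, Fin.sum_univ_three] using h
  fin_cases k <;>
    simp only [numForm, ← h1, ← h2, deltaForm, Algebra.algebraMap_self, RingHom.id_apply,
      Fin.zero_eta, Fin.mk_one, Fin.reduceFinMk, Matrix.cons_val]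
  · linear_combination 4 * normForm u * webCoeff 0 1 * h'
  · linear_combination 4 * normForm u * webCoeff 0 2 * h'
  · linear_combination -4 * normForm u * h'

theorem sexticForm_eq_zero {u y : Fin 3 → ℝ} (hu : u ≠ 0) (h : u ⬝ᵥ y = 0)
    (hc : turn u y ∈ thePod.config) : sexticForm u = 0 := by
  obtain ⟨h1, h2, h0⟩ := (turn_mem_config_iff hu h).1 hc
  have n := numForm_eq h h1 h2
  simp only [sexticForm, n, Algebra.algebraMap_self, RingHom.id_apply]
  linear_combination 16 * deltaForm u ^ 2 * normForm u * h0

/-- Over every direction on the sextic with `Δ ≠ 0` there is a configuration. -/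
theorem turn_numForm_mem_config {u : Fin 3 → ℝ} (hu : u ≠ 0) (hΔ : deltaForm u ≠ 0)
    (hF : sexticForm u = 0) :
    u ⬝ᵥ (fun k => numForm u k / (4 * deltaForm u * normForm u)) = 0 ∧
    turn u (fun k => numForm u k / (4 * deltaForm u * normForm u)) ∈ thePod.config := by
  have hs : normForm u ≠ 0 := (dot_self_pos hu).ne'
  have hdot : u ⬝ᵥ (fun k => numForm u k / (4 * deltaForm u * normForm u)) = 0 := by
    simp only [dotProduct, Fin.sum_univ_three]
    rw [mul_div_assoc', mul_div_assoc', mul_div_assoc', ← add_div, ← add_div, div_eq_zero_iff]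
    left
    simp only [numForm, deltaForm, Algebra.algebraMap_self, RingHom.id_apply, Matrix.cons_val]
    ring
  refine ⟨hdot, (turn_mem_config_iff hu hdot).2 ⟨?_, ?_, ?_⟩⟩
  · field_simp
    simp only [numForm, Algebra.algebraMap_self, RingHom.id_apply, Matrix.cons_val]
    ring
  · field_simp
    simp only [numForm, Algebra.algebraMap_self, RingHom.id_apply, Matrix.cons_val]
    ring
  · have : 16 * deltaForm u ^ 2 * normForm u *
        (normForm u * ((numForm u 0 / (4 * deltaForm u * normForm u)) ^ 2
          + (numForm u 1 / (4 * deltaForm u * normForm u)) ^ 2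
          + (numForm u 2 / (4 * deltaForm u * normForm u)) ^ 2
          - 4 * webCoeff 0 0 * (numForm u 2 / (4 * deltaForm u * normForm u)))
          + legConic (liftBasis 0) u) = sexticForm u := by
      simp only [sexticForm, Algebra.algebraMap_self, RingHom.id_apply]
      field_simp
      ring
    rw [hF] at this
    exact (mul_eq_zero.1 this).resolve_left (by positivity)

/-- The sphere condition of `w` along the curve. -/
theorem legCubic_eq {u y : Fin 3 → ℝ} (hu : u ≠ 0) (h : u ⬝ᵥ y = 0)
    (hc : turn u y ∈ thePod.config) {w : LegSpace ℝ} (hw : w.1 0 0 = 0) :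
    legCubic w u = deltaForm u * (normForm u * bsc (turn u y).toMotion w) := by
  obtain ⟨h1, h2, h0⟩ := (turn_mem_config_iff hu h).1 hc
  have n := numForm_eq h h1 h2
  rw [bsc_turn hu h, hw]
  simp only [legCubic, n, Algebra.algebraMap_self, RingHom.id_apply, Fin.sum_univ_three]
  ring

open MvPolynomial (eval pderiv)
open scoped Topology

/-- The factor between the integral sextic and `sexticForm`. -/
def sexticScale : ℚ :=
  1605915199217606584261372887975876263556245093049031310340218545429209196647855147161250000 / 16

theorem eval_sextic (x y : ℝ) : eval ![y, x] sextic = sexticScale * sexticForm ![1, x, y] := by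
  rw [sextic, eval_ofTriangle]
  simp [triangle, Finset.sum_filter, Finset.sum_product, Finset.sum_range_succ, sexticCoeff,
    sexticData]
  simp [sexticForm, numForm, deltaForm, legConic, liftBasis, web, webForm, webLift,
    Fin.sum_univ_three, normForm, liftCoeff, webCoeff, sexticScale]
  ring

theorem eval_sextic_eq_zero_iff (x y : ℝ) :
    eval ![y, x] sextic = 0 ↔ sexticForm ![1, x, y] = 0 := by
  rw [eval_sextic, mul_eq_zero, or_iff_right]
  norm_num [sexticScale]

/-- The directions of configurations in the plane `u₀ = 0` are finite in number. -/
theorem finite_sexticForm_at_infinity : {s : ℝ | sexticForm ![0, s, 1] = 0}.Finite := by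
  set P : Polynomial ℝ := sexticForm ![0, Polynomial.X, 1] with hP
  have he (s : ℝ) : P.eval s = sexticForm ![0, s, 1] := by
    have := map_sexticForm (Polynomial.aeval s : Polynomial ℝ →ₐ[ℝ] ℝ) ![0, Polynomial.X, 1]
    rw [hP, ← Polynomial.coe_aeval_eq_eval]
    refine this.trans ?_
    congr 1
    funext i
    fin_cases i <;> simp
  have hP0 : P ≠ 0 := by
    intro h
    have := he 0
    rw [h] at this
    simp [sexticForm, numForm, deltaForm, legConic, liftBasis, web, webForm, webLift,
      Fin.sum_univ_three, normForm, liftCoeff, webCoeff] at this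
    norm_num at this
  refine (Polynomial.finite_setOfPred_isRoot hP0).subset fun s hs => ?_
  exact (he s).trans hs

/-! ### Finiteness of the fibres over the directions -/

/-- Only finitely many configurations have a given direction, even where the linear equations for
the translation are dependent. -/
theorem finite_fibre {u : Fin 3 → ℝ} (hu : u ≠ 0) :
    {y : Fin 3 → ℝ | u ⬝ᵥ y = 0 ∧ turn u y ∈ thePod.config}.Finite := by
  have hs : normForm u ≠ 0 := (dot_self_pos hu).ne'
  set a0 : ℝ := ((webCoeff 0 0 : ℚ) : ℝ)
  set a1 : ℝ := ((webCoeff 0 1 : ℚ) : ℝ)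
  set a2 : ℝ := ((webCoeff 0 2 : ℚ) : ℝ)
  set A := legConic (liftBasis 1) u / (4 * normForm u)
  set B := legConic (liftBasis 2) u / (4 * normForm u)
  set κ := legConic (liftBasis 0) u / normForm u
  have key : ∀ y ∈ {y : Fin 3 → ℝ | u ⬝ᵥ y = 0 ∧ turn u y ∈ thePod.config},
      y 0 = A - a1 * y 2 ∧ y 1 = B - a2 * y 2 ∧
        (A - a1 * y 2) ^ 2 + (B - a2 * y 2) ^ 2 + y 2 ^ 2 - 4 * a0 * y 2 + κ = 0 := by
    rintro y ⟨h, hc⟩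
    obtain ⟨h1, h2, h0⟩ := (turn_mem_config_iff hu h).1 hc
    have e1 : y 0 = A - a1 * y 2 := by
      rw [eq_sub_iff_add_eq, eq_div_iff (by simpa using hs)]
      linear_combination h1
    have e2 : y 1 = B - a2 * y 2 := by
      rw [eq_sub_iff_add_eq, eq_div_iff (by simpa using hs)]
      linear_combination h2
    refine ⟨e1, e2, ?_⟩
    rw [← e1, ← e2]
    refine (mul_eq_zero.1 ?_).resolve_left hs
    rw [mul_add, mul_div_cancel₀ _ hs]
    exact h0
  open Polynomial in
  set P : Polynomial ℝ := (C A - C a1 * Polynomial.X) ^ 2 + (C B - C a2 * Polynomial.X) ^ 2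
    + Polynomial.X ^ 2 - C (4 * a0) * Polynomial.X + C κ with hP
  have hP0 : P ≠ 0 := by
    intro h
    have e (s : ℝ) : (A - a1 * s) ^ 2 + (B - a2 * s) ^ 2 + s ^ 2 - 4 * a0 * s + κ = 0 := by
      have := congrArg (Polynomial.eval s) h
      simpa [hP] using this
    nlinarith [e 1, e (-1), e 0, sq_nonneg a1, sq_nonneg a2]
  refine Set.Finite.of_finite_image (f := fun y => y 2)
    ((Polynomial.finite_setOfPred_isRoot hP0).subset ?_) ?_
  · rintro _ ⟨y, hy, rfl⟩
    have := (key y hy).2.2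
    simpa [hP, Polynomial.IsRoot] using this
  · intro y hy y' hy' h
    obtain ⟨h0, h1, -⟩ := key y hy
    obtain ⟨h0', h1', -⟩ := key y' hy'
    simp only at h
    rw [h] at h0 h1
    funext i
    fin_cases i
    · exact h0.trans h0'.symm
    · exact h1.trans h1'.symm
    · exact h

theorem turn_smul {c : ℝ} (hc : c ≠ 0) (u y : Fin 3 → ℝ) : turn (c • u) y = turn u y := by
  refine Prod.ext ?_ rfl
  funext i j
  simp only [turn, Pi.smul_apply, smul_eq_mul, smul_dotProduct, dotProduct_smul]
  congr 1
  rw [show 2 * (c * u i) * (c * u j) = (c * c) * (2 * u i * u j) by ring, ← mul_assoc c c,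
    mul_div_mul_left _ _ (mul_ne_zero hc hc)]

theorem exists_turn_of_mem_config {σ : Pose} (hσ : σ ∈ thePod.config) :
    ∃ u : Fin 3 → ℝ, u ≠ 0 ∧ (u 0 = 1 ∨ u 0 = 0) ∧ u ⬝ᵥ σ.2 = 0 ∧ σ = turn u σ.2 := by
  obtain ⟨h1, h2, h3, h4⟩ := (mem_config_thePod_iff σ).1 hσ
  refine exists_turn h1 h2 h3 ?_
  have := h4 ![0, 0, 0, 1]
  rw [Pose.toMotion, bsc_matE] at this
  linarith

theorem dir_ne_zero (x y : ℝ) : (![1, x, y] : Fin 3 → ℝ) ≠ 0 := fun h => by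
  simpa using congrFun h 0

/-- All but finitely many configurations have their direction outside of a given finite set of
directions, and outside of the plane `u₀ = 0`. -/
theorem finite_config_of_finite_directions {D : Set (ℝ × ℝ)} (hD : D.Finite) :
    {σ ∈ thePod.config | ∀ p : ℝ × ℝ, ![1, p.1, p.2] ⬝ᵥ σ.2 = 0 →
      σ = turn ![1, p.1, p.2] σ.2 → p ∈ D}.Finite := by
  set T : Set (Fin 3 → ℝ) := (fun p : ℝ × ℝ => ![1, p.1, p.2]) '' D ∪
    ((fun s : ℝ => ![0, s, 1]) '' {s : ℝ | sexticForm ![0, s, 1] = 0} ∪ {![0, 1, 0]}) with hT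
  have hTfin : T.Finite :=
    (hD.image _).union ((finite_sexticForm_at_infinity.image _).union (Set.finite_singleton _))
  have hT0 : ∀ u ∈ T, u ≠ 0 := by
    rintro u (⟨p, -, rfl⟩ | ⟨s, -, rfl⟩ | rfl)
    · exact dir_ne_zero _ _
    · intro h; simpa using congrFun h 2
    · intro h; simpa using congrFun h 1
  have hcover : ∀ σ ∈ {σ ∈ thePod.config | ∀ p : ℝ × ℝ, ![1, p.1, p.2] ⬝ᵥ σ.2 = 0 →
      σ = turn ![1, p.1, p.2] σ.2 → p ∈ D}, ∃ u ∈ T, u ⬝ᵥ σ.2 = 0 ∧ σ = turn u σ.2 := by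
    rintro σ ⟨hσ, hp⟩
    obtain ⟨u, hu, h01, hdot, hu'⟩ := exists_turn_of_mem_config hσ
    rcases h01 with h1 | h0
    · have hu1 : u = ![1, u 1, u 2] := by funext i; fin_cases i <;> simp [h1]
      rw [hu1] at hdot hu'
      exact ⟨_, Or.inl ⟨(u 1, u 2), hp (u 1, u 2) hdot hu', rfl⟩, hdot, hu'⟩
    · by_cases h2 : u 2 = 0
      · have h1 : u 1 ≠ 0 := by
          intro h1
          apply hu
          funext i; fin_cases i <;> simp [h0, h1, h2]
        have hu1 : u = u 1 • ![0, 1, 0] := by funext i; fin_cases i <;> simp [h0, h2]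
        rw [hu1, smul_dotProduct, smul_eq_zero, or_iff_right h1] at hdot
        rw [hu1, turn_smul h1] at hu'
        exact ⟨_, Or.inr (Or.inr rfl), hdot, hu'⟩
      · have hu1 : u = u 2 • ![0, u 1 / u 2, 1] := by
          funext i; fin_cases i <;> simp [h0]
          field_simp
        rw [hu1, smul_dotProduct, smul_eq_zero, or_iff_right h2] at hdot
        rw [hu1, turn_smul h2] at hu'
        refine ⟨_, Or.inr (Or.inl ⟨u 1 / u 2, ?_, rfl⟩), hdot, hu'⟩
        exact sexticForm_eq_zero (fun h => by simpa using congrFun h 2) hdot (hu' ▸ hσ)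
  refine (hTfin.biUnion fun u hu => ((finite_fibre (hT0 u hu)).image (turn u))).subset ?_
  intro σ hσ
  obtain ⟨u, hu, hdot, he⟩ := hcover σ hσ
  simp only [Set.mem_iUnion]
  exact ⟨u, hu, σ.2, ⟨hdot, he ▸ hσ.1⟩, he.symm⟩

/-! ### The dimension of the configuration set -/

/-- A level set of a strictly differentiable function of two variables is locally a Lipschitz
graph where the second partial derivative does not vanish. -/
theorem exists_nhds_dimH_le_one {f : ℝ × ℝ → ℝ} {f' : ℝ × ℝ →L[ℝ] ℝ} {p : ℝ × ℝ}
    (hf : HasStrictFDerivAt f f' p) (h : f' (0, 1) ≠ 0) :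
    ∃ t ∈ 𝓝 p, dimH (t ∩ {q | f q = 0}) ≤ 1 := by
  set c := |f' (0, 1)| with hc
  have hc0 : 0 < c := abs_pos.2 h
  have hev := hf.isLittleO.def (half_pos hc0)
  rw [nhds_prod_eq] at hev
  obtain ⟨t, ht, H⟩ := Filter.mem_prod_same_iff.1 hev
  refine ⟨t, ht, ?_⟩
  set s := t ∩ {q | f q = 0} with hs
  set L : ℝ := 2 * |f' (1, 0)| / c + 1 with hL
  have hL1 : 1 ≤ L := by
    have : 0 ≤ 2 * |f' (1, 0)| / c := by positivity
    linarith
  have hanti : AntilipschitzWith L.toNNReal fun q : s => (q : ℝ × ℝ).1 := by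
    refine AntilipschitzWith.of_le_mul_dist fun q q' => ?_
    rw [Real.coe_toNNReal _ (by linarith)]
    have h1 := H (Set.mk_mem_prod q.2.1 q'.2.1)
    have h2 : f q = 0 := q.2.2
    have h3 : f q' = 0 := q'.2.2
    simp only [Set.mem_ofPred_eq, h2, h3] at h1
    have e : f' ((q : ℝ × ℝ) - q') = ((q : ℝ × ℝ).1 - (q' : ℝ × ℝ).1) * f' (1, 0)
        + ((q : ℝ × ℝ).2 - (q' : ℝ × ℝ).2) * f' (0, 1) := by
      rw [← smul_eq_mul, ← smul_eq_mul, ← map_smul, ← map_smul, ← map_add]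
      congr 1
      ext <;> simp
    rw [e, sub_self, zero_sub, norm_neg, Real.norm_eq_abs, Prod.norm_def, Prod.fst_sub,
      Prod.snd_sub, Real.norm_eq_abs, Real.norm_eq_abs] at h1
    rw [Subtype.dist_eq, Prod.dist_eq, Real.dist_eq, Real.dist_eq]
    set dx := (q : ℝ × ℝ).1 - (q' : ℝ × ℝ).1
    set dy := (q : ℝ × ℝ).2 - (q' : ℝ × ℝ).2
    have h4 : |dy| * c - |dx| * |f' (1, 0)| ≤ |dx * f' (1, 0) + dy * f' (0, 1)| := by
      have := abs_sub_abs_le_abs_sub (dy * f' (0, 1)) (-(dx * f' (1, 0)))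
      rw [abs_neg, abs_mul, abs_mul, sub_neg_eq_add, add_comm (dy * _)] at this
      exact this
    have h5 : max |dx| |dy| ≤ |dx| + |dy| :=
      max_le (le_add_of_nonneg_right (abs_nonneg _)) (le_add_of_nonneg_left (abs_nonneg _))
    refine max_le (le_mul_of_one_le_left (abs_nonneg _) hL1) ?_
    have h6 : |dy| * c ≤ (2 * |f' (1, 0)| + c) * |dx| := by nlinarith
    rw [hL, div_add_one hc0.ne', div_mul_eq_mul_div, le_div_iff₀ hc0]
    exact h6
  calc dimH s = dimH ((fun q : s => (q : ℝ × ℝ)) '' Set.univ) := by simp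
    _ = dimH (Set.univ : Set s) := isometry_subtype_coe.dimH_image _
    _ ≤ dimH ((fun q : s => (q : ℝ × ℝ).1) '' Set.univ) := hanti.le_dimH_image _
    _ ≤ dimH (Set.univ : Set ℝ) := dimH_mono (Set.subset_univ _)
    _ = 1 := Real.dimH_univ

theorem hasStrictFDerivAt_sextic (p : ℝ × ℝ) :
    ∃ f' : ℝ × ℝ →L[ℝ] ℝ, HasStrictFDerivAt (fun q : ℝ × ℝ => eval ![q.2, q.1] sextic) f' p ∧
      f' (0, 1) = eval ![p.2, p.1] (pderiv 0 sextic) := by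
  have hcd : ContDiff ℝ 1 fun q : ℝ × ℝ => eval ![q.2, q.1] sextic := by
    simp only [sextic, eval_ofTriangle]
    fun_prop
  refine ⟨_, hcd.contDiffAt.hasStrictFDerivAt one_ne_zero, ?_⟩
  have h1 : HasDerivAt (fun s : ℝ => eval ![s, p.1] sextic)
      (fderiv ℝ (fun q : ℝ × ℝ => eval ![q.2, q.1] sextic) p (0, 1)) p.2 := by
    have h2 : HasDerivAt (fun s : ℝ => (p.1, s)) ((0 : ℝ), (1 : ℝ)) p.2 :=
      (hasDerivAt_const p.2 p.1).prodMk (hasDerivAt_id p.2)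
    have h3 : HasFDerivAt (fun q : ℝ × ℝ => eval ![q.2, q.1] sextic)
        (fderiv ℝ (fun q : ℝ × ℝ => eval ![q.2, q.1] sextic) p) ((fun s : ℝ => (p.1, s)) p.2) :=
      ((hcd.differentiable one_ne_zero) p).hasFDerivAt
    exact h3.comp_hasDerivAt p.2 h2
  refine h1.unique ?_
  rw [sextic, eval_pderiv_zero_ofTriangle]
  simp only [eval_ofTriangle]
  refine HasDerivAt.fun_sum fun m _ => ?_
  refine ((hasDerivAt_pow m.2 p.2).const_mul (p.1 ^ m.1)).const_mul _

/-- The configuration with direction `(1, x, y)`. -/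
noncomputable def solve (p : ℝ × ℝ) : Pose :=
  turn ![1, p.1, p.2] fun k => numForm ![1, p.1, p.2] k /
    (4 * deltaForm ![1, p.1, p.2] * normForm ![1, p.1, p.2])

theorem contDiffAt_solve {p : ℝ × ℝ} (hp : deltaForm ![1, p.1, p.2] ≠ 0) :
    ContDiffAt ℝ 1 solve p := by
  have hs := (dot_self_pos (dir_ne_zero p.1 p.2)).ne'
  have hn : normForm ![1, p.1, p.2] ≠ 0 := hs
  have hv (k : Fin 3) : ContDiff ℝ 1 fun q : ℝ × ℝ => (![1, q.1, q.2] : Fin 3 → ℝ) k := by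
    fin_cases k <;> simp <;> fun_prop
  have hconic (w : LegSpace ℝ) : ContDiff ℝ 1 fun q : ℝ × ℝ => legConic w ![1, q.1, q.2] := by
    simp only [legConic, normForm]
    fun_prop
  have hdelta : ContDiff ℝ 1 fun q : ℝ × ℝ => deltaForm ![1, q.1, q.2] := by
    simp only [deltaForm]
    fun_prop
  have hnorm : ContDiff ℝ 1 fun q : ℝ × ℝ => normForm ![1, q.1, q.2] := by
    simp only [normForm]
    fun_prop
  have hnum (k : Fin 3) : ContDiff ℝ 1 fun q : ℝ × ℝ => numForm ![1, q.1, q.2] k := by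
    fin_cases k <;> simp only [numForm, Fin.zero_eta, Fin.mk_one, Fin.reduceFinMk,
      Matrix.cons_val] <;> fun_prop
  refine ContDiffAt.prodMk ?_ ?_
  · refine contDiffAt_pi.2 fun i => contDiffAt_pi.2 fun j => ?_
    simp only [dot_self_eq]
    refine ContDiffAt.sub (ContDiffAt.div ?_ ?_ ?_) contDiffAt_const
    · exact ((contDiff_const.mul (hv i)).mul (hv j)).contDiffAt
    · exact hnorm.contDiffAt
    · exact hs
  · refine contDiffAt_pi.2 fun k => ?_
    refine ContDiffAt.div (hnum k).contDiffAt ?_ ?_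
    · exact ((contDiff_const.mul hdelta).mul hnorm).contDiffAt
    · simp [hp, hn]

theorem linear_ne_zero : (MvPolynomial.X 0 - MvPolynomial.C (webCoeff 0 1 : ℝ)
    - MvPolynomial.C (webCoeff 0 2 : ℝ) * MvPolynomial.X 1 : MvPolynomial (Fin 2) ℝ) ≠ 0 := by
  intro h
  have h1 := congrArg (eval ![(1 : ℝ), 0]) h
  have h2 := congrArg (eval ![(0 : ℝ), 0]) h
  simp at h1 h2
  simp [h2] at h1

/-- Only finitely many points of the sextic lie on the line `Δ = 0` or are zeros of the derivative
with respect to `y`. -/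
theorem finite_bad_directions :
    {p : ℝ × ℝ | eval ![p.2, p.1] sextic = 0 ∧ (deltaForm ![1, p.1, p.2] = 0 ∨
      eval ![p.2, p.1] (pderiv 0 sextic) = 0)}.Finite := by
  have h1 := finite_common_zeros linear_ne_zero (by
    refine lt_of_le_of_lt (b := 1) ?_ (by norm_num)
    refine (MvPolynomial.totalDegree_sub _ _).trans (max_le ?_ ?_)
    · refine (MvPolynomial.totalDegree_sub _ _).trans (max_le ?_ ?_)
      · simp
      · simp
    · refine (MvPolynomial.totalDegree_mul _ _).trans ?_
      simp)
  have h2 := finite_common_zeros (q := pderiv 0 sextic) (by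
      intro h
      apply eval_pderiv_sextic_initial
      rw [h, map_zero]) (by
    refine lt_of_le_of_lt (totalDegree_pderiv_le _ _) ?_
    rw [totalDegree_sextic]
    norm_num)
  refine (h1.union h2).subset ?_
  rintro p ⟨h, h' | h'⟩
  · refine Or.inl ⟨h, ?_⟩
    simpa [deltaForm] using h'
  · exact Or.inr ⟨h, h'⟩

/-- Up to finitely many configurations, the configuration set is the image, under the locally
Lipschitz map `solve`, of a part of the sextic that is locally a Lipschitz graph. -/
theorem dimH_config_le : dimH thePod.config ≤ 1 := by
  set G : Set (ℝ × ℝ) := {p | eval ![p.2, p.1] sextic = 0 ∧ deltaForm ![1, p.1, p.2] ≠ 0 ∧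
    eval ![p.2, p.1] (pderiv 0 sextic) ≠ 0} with hG
  have hGdim : dimH G ≤ 1 := by
    by_contra! hlt
    obtain ⟨p, hp, H⟩ := exists_mem_nhdsWithin_lt_dimH_of_lt_dimH hlt
    obtain ⟨f', hf, hf'⟩ := hasStrictFDerivAt_sextic p
    obtain ⟨t, ht, hle⟩ := exists_nhds_dimH_le_one hf (by rw [hf']; exact hp.2.2)
    refine (H (t ∩ G) (Filter.inter_mem (mem_nhdsWithin_of_mem_nhds ht) self_mem_nhdsWithin)).not_ge ?_
    exact (dimH_mono (Set.inter_subset_inter_right _ fun q hq => hq.1)).trans hle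
  have himage : dimH (solve '' G) ≤ 1 := by
    refine (dimH_image_le_of_locally_lipschitzOn fun p hp => ?_).trans hGdim
    obtain ⟨K, t, ht, hK⟩ := (contDiffAt_solve hp.2.1).exists_lipschitzOnWith
    exact ⟨K, t, mem_nhdsWithin_of_mem_nhds ht, hK⟩
  have hcover : thePod.config ⊆ {σ ∈ thePod.config | ∀ p : ℝ × ℝ, ![1, p.1, p.2] ⬝ᵥ σ.2 = 0 →
      σ = turn ![1, p.1, p.2] σ.2 → p ∈ {p : ℝ × ℝ | eval ![p.2, p.1] sextic = 0 ∧
        (deltaForm ![1, p.1, p.2] = 0 ∨ eval ![p.2, p.1] (pderiv 0 sextic) = 0)}} ∪ solve '' G := by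
    intro σ hσ
    by_cases hb : ∀ p : ℝ × ℝ, ![1, p.1, p.2] ⬝ᵥ σ.2 = 0 →
        σ = turn ![1, p.1, p.2] σ.2 → p ∈ {p : ℝ × ℝ | eval ![p.2, p.1] sextic = 0 ∧
        (deltaForm ![1, p.1, p.2] = 0 ∨ eval ![p.2, p.1] (pderiv 0 sextic) = 0)}
    · exact Or.inl ⟨hσ, hb⟩
    · right
      push Not at hb
      obtain ⟨p, hdot, he, hp⟩ := hb
      have hu := dir_ne_zero p.1 p.2
      rw [he] at hσ
      have h0 := (eval_sextic_eq_zero_iff _ _).2 (sexticForm_eq_zero hu hdot hσ)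
      have hp' : deltaForm ![1, p.1, p.2] ≠ 0 ∧ eval ![p.2, p.1] (pderiv 0 sextic) ≠ 0 := by
        constructor
        · intro h; exact hp ⟨h0, Or.inl h⟩
        · intro h; exact hp ⟨h0, Or.inr h⟩
      refine ⟨p, ⟨h0, hp'⟩, ?_⟩
      rw [he, solve]
      congr 1
      obtain ⟨h1, h2, -⟩ := (turn_mem_config_iff hu hdot).1 hσ
      funext k
      have hn : normForm ![1, p.1, p.2] ≠ 0 := (dot_self_pos hu).ne'
      rw [numForm_eq hdot h1 h2]
      have := hp'.1
      field_simp
  refine (dimH_mono hcover).trans ?_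
  rw [dimH_union, dimH_finite (finite_config_of_finite_directions finite_bad_directions)]
  simpa using himage

/-- The sextic changes its sign on a vertical segment through the rational point. -/
theorem sextic_sign_change :
    0 < eval ![(79 / 100 : ℝ), 7003716944 / 10000000000] sextic ∧
      eval ![(81 / 100 : ℝ), 7003716944 / 10000000000] sextic < 0 := by
  rw [sextic, eval_ofTriangle, eval_ofTriangle]
  have h1 : 0 < ∑ m ∈ triangle 6, (sexticCoeff m.1 m.2 : ℚ) *
      ((7003716944 / 10000000000) ^ m.1 * (79 / 100) ^ m.2) := by decide +kernel
  have h2 : ∑ m ∈ triangle 6, (sexticCoeff m.1 m.2 : ℚ) *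
      ((7003716944 / 10000000000) ^ m.1 * (81 / 100) ^ m.2) < 0 := by decide +kernel
  rw [← Rat.cast_lt (K := ℝ)] at h1 h2
  push_cast at h1 h2
  exact ⟨h1, h2⟩

/-- The projection of the configuration set to the first coordinate of the direction `(1, x, y)`
covers a neighbourhood of the value of the initial configuration, because the sextic changes its
sign on vertical segments there. -/
theorem one_le_dimH_config : 1 ≤ dimH thePod.config := by
  have hc (y : ℝ) : Continuous fun x : ℝ => eval ![y, x] sextic := by
    simp only [sextic, eval_ofTriangle]
    fun_prop
  have hc' (x : ℝ) : Continuous fun y : ℝ => eval ![y, x] sextic := by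
    simp only [sextic, eval_ofTriangle]
    fun_prop
  set I : Set ℝ := {x | 0 < eval ![(79 / 100 : ℝ), x] sextic} ∩
    {x | eval ![(81 / 100 : ℝ), x] sextic < 0} ∩ Set.Ioo 0 1 with hI
  have hIopen : IsOpen I :=
    ((isOpen_lt continuous_const (hc _)).inter (isOpen_lt (hc _) continuous_const)).inter isOpen_Ioo
  have hImem : (7003716944 / 10000000000 : ℝ) ∈ I :=
    ⟨sextic_sign_change, by norm_num, by norm_num⟩
  have hdimI : dimH I = 1 := by
    rw [Real.dimH_of_mem_nhds (hIopen.mem_nhds hImem)]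
    simp
  set proj : Pose → ℝ := fun σ => σ.1 0 1 / (σ.1 0 0 + 1) with hproj
  set S := {σ ∈ thePod.config | σ.1 0 0 + 1 ≠ 0} with hS
  have hsub : I ⊆ proj '' S := by
    rintro x ⟨⟨h1, h2⟩, h3, h4⟩
    obtain ⟨y, ⟨hy1, hy2⟩, hy⟩ : (0 : ℝ) ∈ (fun y => eval ![y, x] sextic) ''
        Set.Icc (79 / 100) (81 / 100) :=
      intermediate_value_Icc' (by norm_num) (hc' x).continuousOn ⟨h2.le, h1.le⟩
    have hΔ : deltaForm ![1, x, y] ≠ 0 := by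
      simp [deltaForm, webCoeff]
      intro h
      linarith
    have hu := dir_ne_zero x y
    have hn : normForm ![1, x, y] ≠ 0 := (dot_self_pos hu).ne'
    have hmem := (turn_numForm_mem_config hu hΔ ((eval_sextic_eq_zero_iff _ _).1 hy)).2
    have e0 : (solve (x, y)).1 0 0 + 1 = 2 / normForm ![1, x, y] := by
      simp only [solve, turn, dot_self_eq, normForm]
      simp
    have e1 : (solve (x, y)).1 0 1 = 2 * x / normForm ![1, x, y] := by
      simp only [solve, turn, dot_self_eq, normForm]
      simp
    refine ⟨solve (x, y), ⟨hmem, ?_⟩, ?_⟩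
    · rw [e0]
      exact div_ne_zero two_ne_zero hn
    · simp only [hproj]
      rw [e0, e1]
      field_simp
  rw [← hdimI]
  refine (dimH_mono hsub).trans ((dimH_image_le_of_locally_lipschitzOn fun σ hσ => ?_).trans
    (dimH_mono fun σ hσ => hσ.1))
  have hcd : ContDiffAt ℝ 1 proj σ := by
    refine ContDiffAt.div ?_ ?_ hσ.2
    · fun_prop
    · fun_prop
  obtain ⟨K, t, ht, hK⟩ := hcd.exists_lipschitzOnWith
  exact ⟨K, t, mem_nhdsWithin_of_mem_nhds ht, hK⟩

theorem mobility_thePod : thePod.mobility = 1 := le_antisymm dimH_config_le one_le_dimH_config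

theorem infinite_config_thePod : thePod.config.Infinite := fun h => by
  have := one_le_dimH_config
  rw [dimH_finite h] at this
  simp at this

/-! ### Legs that vanish on the curve -/

theorem totalDegree_legConic_le (w : LegSpace ℝ) :
    (legConic w (![1, MvPolynomial.X 1, MvPolynomial.X 0] : Fin 3 → MvPolynomial (Fin 2) ℝ)).totalDegree
      ≤ 2 := by
  have hu (i : Fin 3) : ((![1, MvPolynomial.X 1, MvPolynomial.X 0] :
      Fin 3 → MvPolynomial (Fin 2) ℝ) i).totalDegree ≤ 1 := by
    fin_cases i <;> simp
  have huu (i j : Fin 3) : ((![1, MvPolynomial.X 1, MvPolynomial.X 0] :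
      Fin 3 → MvPolynomial (Fin 2) ℝ) i * (![1, MvPolynomial.X 1, MvPolynomial.X 0] :
      Fin 3 → MvPolynomial (Fin 2) ℝ) j).totalDegree ≤ 2 :=
    (MvPolynomial.totalDegree_mul _ _).trans (add_le_add (hu i) (hu j))
  have hC (c : ℝ) (p : MvPolynomial (Fin 2) ℝ) (hp : p.totalDegree ≤ 2) :
      (algebraMap ℝ (MvPolynomial (Fin 2) ℝ) c * p).totalDegree ≤ 2 := by
    refine (MvPolynomial.totalDegree_mul _ _).trans ?_
    rw [MvPolynomial.algebraMap_eq, MvPolynomial.totalDegree_C, zero_add]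
    exact hp
  refine (MvPolynomial.totalDegree_sub _ _).trans (max_le (hC _ _ ?_) ?_)
  · rw [normForm, pow_two, pow_two, pow_two]
    exact (MvPolynomial.totalDegree_add _ _).trans (max_le ((MvPolynomial.totalDegree_add _ _).trans
      (max_le (huu _ _) (huu _ _))) (huu _ _))
  · rw [show (4 : MvPolynomial (Fin 2) ℝ) = algebraMap ℝ _ 4 from (map_ofNat _ 4).symm]
    refine hC _ _ ?_
    refine MvPolynomial.totalDegree_finsetSum_le fun i _ =>
      MvPolynomial.totalDegree_finsetSum_le fun j _ => hC _ _ (huu i j)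

theorem totalDegree_legCubic_le (w : LegSpace ℝ) :
    (legCubic w (![1, MvPolynomial.X 1, MvPolynomial.X 0] : Fin 3 → MvPolynomial (Fin 2) ℝ)).totalDegree
      ≤ 3 := by
  have hmul {p q : MvPolynomial (Fin 2) ℝ} {m n k : ℕ} (hp : p.totalDegree ≤ m)
      (hq : q.totalDegree ≤ n) (h : m + n ≤ k) : (p * q).totalDegree ≤ k :=
    (MvPolynomial.totalDegree_mul _ _).trans ((add_le_add hp hq).trans h)
  have hadd {p q : MvPolynomial (Fin 2) ℝ} {k : ℕ} (hp : p.totalDegree ≤ k)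
      (hq : q.totalDegree ≤ k) : (p + q).totalDegree ≤ k :=
    (MvPolynomial.totalDegree_add _ _).trans (max_le hp hq)
  have hsub {p q : MvPolynomial (Fin 2) ℝ} {k : ℕ} (hp : p.totalDegree ≤ k)
      (hq : q.totalDegree ≤ k) : (p - q).totalDegree ≤ k :=
    (MvPolynomial.totalDegree_sub _ _).trans (max_le hp hq)
  have hC (c : ℝ) : (algebraMap ℝ (MvPolynomial (Fin 2) ℝ) c).totalDegree ≤ 0 := by
    rw [MvPolynomial.algebraMap_eq, MvPolynomial.totalDegree_C]
  set u : Fin 3 → MvPolynomial (Fin 2) ℝ := ![1, MvPolynomial.X 1, MvPolynomial.X 0] with hu'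
  have hu (i : Fin 3) : (u i).totalDegree ≤ 1 := by
    fin_cases i <;> simp [hu']
  have hΔ : (deltaForm u).totalDegree ≤ 1 :=
    hsub (hsub (hu _) (hmul (hC _) (hu _) le_rfl)) (hmul (hC _) (hu _) le_rfl)
  have hc : (u 0 * legConic (liftBasis 1) u + u 1 * legConic (liftBasis 2) u).totalDegree ≤ 3 :=
    hadd (hmul (hu _) (totalDegree_legConic_le _) le_rfl)
      (hmul (hu _) (totalDegree_legConic_le _) le_rfl)
  have hN (k : Fin 3) : (numForm u k).totalDegree ≤ 3 := by
    fin_cases k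
    · exact hadd (hmul hΔ (totalDegree_legConic_le _) le_rfl) (hmul (hC _) hc le_rfl)
    · exact hadd (hmul hΔ (totalDegree_legConic_le _) le_rfl) (hmul (hC _) hc le_rfl)
    · exact (MvPolynomial.totalDegree_neg _).le.trans hc
  exact hsub (hmul (totalDegree_legConic_le _) hΔ le_rfl)
    (MvPolynomial.totalDegree_finsetSum_le fun i _ => hmul (hC _) (hN i) le_rfl)

theorem eval_legCubic (w : LegSpace ℝ) (x y : ℝ) :
    eval ![y, x] (legCubic w (![1, MvPolynomial.X 1, MvPolynomial.X 0] :
      Fin 3 → MvPolynomial (Fin 2) ℝ)) = legCubic w ![1, x, y] := by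
  have := map_legCubic (MvPolynomial.aeval ![y, x]) w
    (![1, MvPolynomial.X 1, MvPolynomial.X 0] : Fin 3 → MvPolynomial (Fin 2) ℝ)
  rw [← MvPolynomial.coe_aeval_eq_eval]
  refine this.trans ?_
  congr 1
  funext i
  fin_cases i <;> simp

/-- The cubic of a leg with vanishing entries `00, 01, 02, 11` is only zero if the leg is zero: on
the line `Δ = 0` only the term with the entry `03` remains, and the complementary factor of `Δ` is a
conic. -/
theorem eq_zero_of_legCubic {w : LegSpace ℝ} (hs : w.1.IsSymm) (h00 : w.1 0 0 = 0)
    (h01 : w.1 0 1 = 0) (h02 : w.1 0 2 = 0) (h11 : w.1 1 1 = 0)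
    (h : ∀ x y : ℝ, legCubic w ![1, x, y] = 0) : w = 0 := by
  obtain ⟨z, l⟩ := w
  have s (i j) : z i j = z j i := hs.apply j i
  simp only at h00 h01 h02 h11
  have h03 : z 0 3 = 0 := by
    have := h 0 (webCoeff 0 1)
    have hΔ : deltaForm ![1, 0, ((webCoeff 0 1 : ℚ) : ℝ)] = 0 := by simp [deltaForm]
    simp only [legCubic, hΔ, mul_zero, zero_sub, Fin.sum_univ_three] at this
    have hN : numForm ![1, 0, ((webCoeff 0 1 : ℚ) : ℝ)] 2 ≠ 0 := by
      simp [numForm, legConic, liftBasis, web, webForm, webLift, Fin.sum_univ_three, normForm,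
        liftCoeff, webCoeff]
      norm_num
    simp [s 1 0, s 2 0, s 3 0, h01, h02, hN] at this
    exact this
  have hconic (x y : ℝ) (hΔ : deltaForm ![1, x, y] ≠ 0) : legConic (z, l) ![1, x, y] = 0 := by
    have := h x y
    simp [legCubic, Fin.sum_univ_three, s 1 0, s 2 0, s 3 0, h01, h02, h03, hΔ] at this
    exact this
  have e1 := hconic 0 0 (by simp [deltaForm, webCoeff])
  have e2 := hconic 1 0 (by simp [deltaForm, webCoeff]; norm_num)
  have e3 := hconic (-1) 0 (by simp [deltaForm, webCoeff]; norm_num)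
  have e4 := hconic 0 1 (by simp [deltaForm, webCoeff]; norm_num)
  have e5 := hconic 0 (-1) (by simp [deltaForm, webCoeff]; norm_num)
  have e6 := hconic 1 1 (by simp [deltaForm, webCoeff]; norm_num)
  simp [legConic, Fin.sum_univ_three, normForm, h11, s 2 1, s 3 1, s 3 2]
    at e1 e2 e3 e4 e5 e6
  have h12 : z 1 2 = 0 := by linarith
  have h13 : z 1 3 = 0 := by linarith
  have h22 : z 2 2 = 0 := by linarith
  have h33 : z 3 3 = 0 := by linarith
  have h23 : z 2 3 = 0 := by linarith
  have hl : l = 0 := by linarith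
  refine Prod.ext ?_ hl
  ext i j
  fin_cases i <;> fin_cases j <;>
    simp [h00, h01, h02, h03, h11, h12, h13, h22, h23, h33, s 1 0, s 2 0, s 3 0, s 2 1, s 3 1, s 3 2]

/-- A symmetric leg vector that satisfies its sphere condition at infinitely many configurations
belongs to the lifted web. -/
theorem exists_liftMap_of_infinite {w : LegSpace ℝ} (hs : w.1.IsSymm)
    (h : {σ ∈ thePod.config | bsc σ.toMotion w = 0}.Infinite) : ∃ v, w = liftMap v := by
  set v : Fin 4 → ℝ := ![w.1 0 0, w.1 0 1, w.1 0 2, w.1 1 1] with hv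
  set w' := w - liftMap v with hw'
  have hz (i j) : w'.1 i j = w.1 i j - web v i j := rfl
  have hs' : w'.1.IsSymm := by
    ext i j
    rw [Matrix.transpose_apply, hz, hz, hs.apply, (web_isSymm v).apply]
  have hb (σ : Pose) (hσ : σ ∈ thePod.config) : bsc σ.toMotion w' = bsc σ.toMotion w := by
    have := ((mem_config_thePod_iff σ).1 hσ).2.2.2 v
    rw [← bscLin_apply, hw', map_sub, bscLin_apply, bscLin_apply, liftMap_apply, this, sub_zero]
  have h00 : w'.1 0 0 = 0 := by simp [hz, web, hv]
  suffices hw0 : w' = 0 from ⟨v, sub_eq_zero.1 hw0⟩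
  refine eq_zero_of_legCubic hs' h00 (by simp [hz, web, hv]) (by simp [hz, web, hv])
    (by simp [hz, web, hv]) ?_
  by_contra hne
  push Not at hne
  obtain ⟨x, y, hxy⟩ := hne
  have hfin := finite_common_zeros
    (q := legCubic w' ![1, MvPolynomial.X 1, MvPolynomial.X 0]) (by
      intro h0
      apply hxy
      rw [← eval_legCubic, h0, map_zero])
    (lt_of_le_of_lt (totalDegree_legCubic_le _) (by norm_num))
  refine h ((finite_config_of_finite_directions hfin).subset ?_)
  rintro σ ⟨hσ, h0⟩
  refine ⟨hσ, fun p hdot he => ?_⟩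
  have hu := dir_ne_zero p.1 p.2
  have hσ' := hσ
  rw [he] at hσ'
  refine ⟨(eval_sextic_eq_zero_iff _ _).2 (sexticForm_eq_zero hu hdot hσ'), ?_⟩
  rw [eval_legCubic, legCubic_eq hu hdot hσ' h00, ← he, hb σ hσ, h0, mul_zero, mul_zero]

theorem toMotion_of_mem_config {σ : Pose} (hσ : σ ∈ thePod.config) :
    σ.toMotion = (1, Matrix.of σ.1, σ.2, σ.2, σ.2 ⬝ᵥ σ.2) := by
  rw [Pose.toMotion, ((mem_config_thePod_iff σ).1 hσ).2.2.1]

/-- On the configurations, the sphere conditions of `z` and of its symmetric part are equivalent. -/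
theorem exists_liftMap_of_infinite' {z : Mat4 ℝ} {l : ℝ}
    (h : {σ ∈ thePod.config | bsc σ.toMotion (z, l) = 0}.Infinite) :
    ∃ v, (z + zᵀ, 2 * l) = liftMap v := by
  refine exists_liftMap_of_infinite (by ext i j; simp [add_comm]) (h.mono ?_)
  rintro σ ⟨hσ, h0⟩
  refine ⟨hσ, ?_⟩
  have hM := ((mem_config_thePod_iff σ).1 hσ).2.1
  rw [toMotion_of_mem_config hσ] at h0 ⊢
  rw [show ((z + zᵀ, 2 * l) : LegSpace ℝ) = (z, l) + (zᵀ, l) from Prod.ext rfl (two_mul l),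
    ← bscLin_apply, map_add, bscLin_apply, bscLin_apply, bsc_transpose hM, h0, add_zero]

/-! ### Legs over the nodes -/

/-- The symmetric product of two points determines the two points up to order. -/
theorem vecMulVec_of_symProd_eq {K : Type} [Field K] [CharZero K] {a b α β : Fin 4 → K} {c : K}
    (hα : α 0 = 1) (hβ : β 0 = 1) (hαβ : α 1 ≠ β 1) (hc : c ≠ 0)
    (h : symProd a b = c • symProd α β) :
    Matrix.vecMulVec a b = c • Matrix.vecMulVec α β ∨
      Matrix.vecMulVec a b = c • Matrix.vecMulVec β α := by
  have e (i j) : a i * b j + b i * a j = c * (α i * β j + β i * α j) :=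
    congrFun (congrFun h i) j
  have hab : a 0 * b 0 = c := by
    have := e 0 0
    rw [hα, hβ] at this
    refine mul_left_cancel₀ (two_ne_zero (α := K)) ?_
    linear_combination this
  have ha : a 0 ≠ 0 := left_ne_zero_of_mul (hab ▸ hc)
  have hb : b 0 ≠ 0 := right_ne_zero_of_mul (hab ▸ hc)
  obtain ⟨A, hA⟩ : ∃ A : Fin 4 → K, a = a 0 • A := ⟨(a 0)⁻¹ • a, (smul_inv_smul₀ ha a).symm⟩
  obtain ⟨B, hB⟩ : ∃ B : Fin 4 → K, b = b 0 • B := ⟨(b 0)⁻¹ • b, (smul_inv_smul₀ hb b).symm⟩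
  have hAi (i) : a i = a 0 * A i := congrFun hA i
  have hBi (i) : b i = b 0 * B i := congrFun hB i
  have hA0 : A 0 = 1 := mul_left_cancel₀ ha (by rw [← hAi, mul_one])
  have hB0 : B 0 = 1 := mul_left_cancel₀ hb (by rw [← hBi, mul_one])
  have e' (i j) : A i * B j + B i * A j = α i * β j + β i * α j := by
    refine mul_left_cancel₀ hc ?_
    rw [← e, hAi i, hAi j, hBi i, hBi j, ← hab]
    ring
  have hsum (j) : A j + B j = α j + β j := by
    have := e' 0 j
    rw [hA0, hB0, hα, hβ] at this
    linear_combination this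
  have hfin {γ δ : Fin 4 → K} (hγδ : γ 1 ≠ δ 1) (hs : ∀ j, A j + B j = γ j + δ j)
      (he : ∀ i j, A i * B j + B i * A j = γ i * δ j + δ i * γ j) (h1 : A 1 = γ 1) :
      Matrix.vecMulVec a b = c • Matrix.vecMulVec γ δ := by
    have hB1 : B 1 = δ 1 := by linear_combination hs 1 - h1
    have hAγ (j) : A j = γ j := by
      have := he 1 j
      rw [h1, hB1] at this
      refine mul_left_cancel₀ (sub_ne_zero.2 hγδ) ?_
      linear_combination γ 1 * hs j - this
    have hBδ (j) : B j = δ j := by linear_combination hs j - hAγ j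
    ext i j
    simp only [Matrix.vecMulVec_apply, Matrix.smul_apply, smul_eq_mul]
    rw [hAi i, hBi j, hAγ, hBδ, ← hab]
    ring
  have hprod : (A 1 - α 1) * (A 1 - β 1) = 0 := by
    refine mul_left_cancel₀ (two_ne_zero (α := K)) ?_
    linear_combination -e' 1 1 + 2 * A 1 * hsum 1
  rcases mul_eq_zero.1 hprod with h1 | h1
  · exact Or.inl (hfin hαβ hsum e' (sub_eq_zero.1 h1))
  · exact Or.inr (hfin hαβ.symm (fun j => (hsum j).trans (add_comm _ _))
      (fun i j => (e' i j).trans (by ring)) (sub_eq_zero.1 h1))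

/-- A complex leg vector of the Segre cone whose symmetric part lies over the web is a multiple of
one of the twenty legs. -/
theorem exists_leg_of_symProd {a b : Fin 4 → ℂ} {l : ℂ} {v : Fin 4 → ℂ} (hv : v ≠ 0)
    (h : symProd a b = web v) (hl : 2 * l = webLift v) :
    ∃ p, ∃ c : ℂ, c ≠ 0 ∧ v = c • nodeParamC p.1 ∧
      (Matrix.vecMulVec a b, l) = c • legOver Complex.ofRealHom p := by
  obtain ⟨k, c, hc, rfl⟩ := exists_node_of_minorsVanish hv (h ▸ minorsVanish_symProd a b)
  have hl' : l = c * ((webLift (nodeParam k) / 2 : ℝ) : ℂ) := by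
    have e : webLift (c • nodeParamC k) = c * ((webLift (nodeParam k) : ℝ) : ℂ) := by
      rw [ofReal_webLift]
      simp [webLift, nodeParamC]
      ring
    rw [e] at hl
    push_cast
    linear_combination hl / 2
  rw [web_smul, web_nodeParamC] at h
  rcases vecMulVec_of_symProd_eq (by simp [nodeA]) (by simp [nodeB])
    (by exact_mod_cast nodeA_one_ne k) hc h with h' | h'
  · refine ⟨(k, 0), c, hc, rfl, Prod.ext ?_ hl'⟩
    rw [h']
    ext i j
    simp [legOver, legA, legB, Matrix.vecMulVec_apply]
  · refine ⟨(k, 1), c, hc, rfl, Prod.ext ?_ hl'⟩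
    rw [h']
    ext i j
    simp [legOver, legA, legB, Matrix.vecMulVec_apply]

/-! ### The complex curve -/

/-- The complex coordinates of a configuration. -/
noncomputable def motionC (σ : Pose) : MotionSpace ℂ :=
  (1, (Matrix.of σ.1).map (fun t => (t : ℂ)), fun i => (σ.2 i : ℂ), fun i => (σ.2 i : ℂ),
    ((σ.2 ⬝ᵥ σ.2 : ℝ) : ℂ))

theorem bsc_motionC_toComplex {σ : Pose} (hσ : σ ∈ thePod.config) (w : LegSpace ℝ) :
    bsc (motionC σ) w.toComplex = ((bsc σ.toMotion w : ℝ) : ℂ) := by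
  rw [toMotion_of_mem_config hσ]
  simp [bsc, motionC, LegSpace.toComplex, Fin.sum_univ_three]

theorem isInX_smul {v : MotionSpace ℂ} (h : IsInX v) (c : ℂ) : IsInX (c • v) := by
  obtain ⟨k, M, x, y, r⟩ := v
  obtain ⟨h1, h2, h3, h4, h5, h6, h7⟩ := h
  refine ⟨?_, ?_, ?_, ?_, ?_, ?_, ?_⟩
  · simp only [Matrix.transpose_smul, Matrix.smul_mul, Matrix.mul_smul, h1, smul_smul, smul_eq_mul]
    congr 1; ring
  · simp only [Matrix.transpose_smul, Matrix.smul_mul, Matrix.mul_smul, h2, smul_smul, smul_eq_mul]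
    congr 1; ring
  · simp only [Matrix.det_smul, h3, smul_eq_mul, Fintype.card_fin]
    ring
  · simp only [Matrix.transpose_smul, Matrix.smul_mulVec, Matrix.mulVec_smul, smul_eq_mul]
    rw [mul_smul, smul_comm k c x, ← smul_add, ← smul_add, h4, smul_zero, smul_zero]
  · simp only [Matrix.smul_mulVec, Matrix.mulVec_smul, smul_eq_mul]
    rw [mul_smul, smul_comm k c y, ← smul_add, ← smul_add, h5, smul_zero, smul_zero]
  · simp only [smul_dotProduct, dotProduct_smul, h6, smul_eq_mul]
    ring
  · simp only [smul_dotProduct, dotProduct_smul, h7, smul_eq_mul]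
    ring

theorem isInX_motionC {σ : Pose} (hσ : σ ∈ thePod.config) : IsInX (motionC σ) := by
  obtain ⟨h1, hM, hy, -⟩ := (mem_config_thePod_iff σ).1 hσ
  obtain ⟨horth, hdet⟩ := Matrix.mem_specialOrthogonalGroup_iff.1 h1
  rw [Matrix.mem_orthogonalGroup_iff] at horth
  have horth' : Matrix.of σ.1 * (Matrix.of σ.1)ᵀ = 1 := horth
  rw [← hM] at hy horth'
  have hMM : ∀ A : Matrix (Fin 3) (Fin 3) ℝ, A.map (fun t => (t : ℂ)) =
    Complex.ofRealHom.mapMatrix A := fun _ => rfl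
  have hsymm : ((Matrix.of σ.1).map (fun t => (t : ℂ)))ᵀ =
      (Matrix.of σ.1).map (fun t => (t : ℂ)) := by
    rw [← Matrix.transpose_map, ← hM]
  have hsq : (Matrix.of σ.1).map (fun t => (t : ℂ)) * (Matrix.of σ.1).map (fun t => (t : ℂ)) =
      1 := by
    rw [hMM, ← map_mul, horth', map_one]
  have hmv : (Matrix.of σ.1).map (fun t => (t : ℂ)) *ᵥ (fun i => (σ.2 i : ℂ)) =
      -fun i => (σ.2 i : ℂ) := by
    funext i
    have e := congrFun hy i
    simp only [Pi.neg_apply, Matrix.mulVec, dotProduct, Matrix.map_apply] at e ⊢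
    rw [← e]
    push_cast
    simp
  have hdot : (fun i => (σ.2 i : ℂ)) ⬝ᵥ (fun i => (σ.2 i : ℂ)) = ((σ.2 ⬝ᵥ σ.2 : ℝ) : ℂ) := by
    simp [dotProduct]
  refine ⟨?_, ?_, ?_, ?_, ?_, ?_, ?_⟩
  · rw [hsymm, hsq, one_pow, one_smul]
  · rw [hsymm, hsq, one_pow, one_smul]
  · rw [hMM, ← RingHom.map_det, hdet, map_one, one_pow]
  · rw [hsymm, hmv, one_smul, neg_add_cancel]
  · rw [hmv, one_smul, neg_add_cancel]
  · rw [hdot, mul_one]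
  · rw [hdot, mul_one]

theorem motionC_ne_zero (σ : Pose) : motionC σ ≠ 0 := fun h => by
  have := congrArg Prod.fst h
  simp [motionC] at this

/-- The point of projective space given by a configuration. -/
noncomputable def motionPoint (σ : Pose) : ℙ ℂ (MotionSpace ℂ) :=
  Projectivization.mk ℂ (motionC σ) (motionC_ne_zero σ)

theorem rep_motionPoint (σ : Pose) : ∃ c : ℂ, c ≠ 0 ∧ (motionPoint σ).rep = c • motionC σ := by
  obtain ⟨c, hc⟩ := Projectivization.exists_smul_eq_mk_rep ℂ (motionC σ) (motionC_ne_zero σ)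
  exact ⟨c, c.ne_zero, hc.symm⟩

theorem bsc_smul_left (c : ℂ) (p : MotionSpace ℂ) (w : LegSpace ℂ) :
    bsc (c • p) w = c * bsc p w := by
  obtain ⟨h, M, x, y, r⟩ := p
  obtain ⟨z, l⟩ := w
  simp [bsc, Fin.sum_univ_three]
  ring

theorem motionPoint_mem {σ : Pose} (hσ : σ ∈ thePod.config) :
    motionPoint σ ∈ borelCurve theLift := by
  rw [← compactConfig_thePod]
  obtain ⟨c, -, hc⟩ := rep_motionPoint σ
  refine ⟨?_, fun i => ?_⟩
  · have hX : IsInX (motionPoint σ).rep := by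
      rw [hc]
      exact isInX_smul (isInX_motionC hσ) c
    exact hX
  · rw [hc, bsc_smul_left, bsc_motionC_toComplex hσ, ((Pod.mem_config_iff _ _).1 hσ).2 i]
    simp

theorem motionPoint_injective : Function.Injective motionPoint := by
  intro σ τ h
  rw [motionPoint, motionPoint, Projectivization.mk_eq_mk_iff'] at h
  obtain ⟨c, hc⟩ := h
  have h0 := congrArg Prod.fst hc
  simp [motionC] at h0
  rw [h0, one_smul] at hc
  refine Prod.ext ?_ ?_
  · funext i j
    have := congrFun (congrFun (congrArg (fun p => p.2.1) hc) i) j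
    simp only [motionC, Matrix.map_apply, Matrix.of_apply] at this
    exact_mod_cast this.symm
  · funext i
    have := congrFun (congrArg (fun p => p.2.2.1) hc) i
    simp only [motionC] at this
    exact_mod_cast this.symm

theorem isOneDimensional_borelCurve : IsOneDimensional (borelCurve theLift) := by
  refine ⟨(infinite_config_thePod.image motionPoint_injective.injOn).mono ?_, ?_⟩
  · rintro _ ⟨σ, hσ, rfl⟩
    exact motionPoint_mem hσ
  · refine ⟨LinearMap.fst ℂ _ _, (LinearMap.proj 0).comp ((LinearMap.proj 0).comp
      ((LinearMap.fst ℂ (Matrix (Fin 3) (Fin 3) ℂ) _).comp (LinearMap.snd ℂ ℂ _))), ?_⟩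
    rintro p ⟨⟨hX, hinv⟩, hG⟩ ⟨h0, h00⟩
    rw [forall_theLift_iff] at hG
    have hne := p.rep_nonzero
    change IsInX p.rep at hX
    revert hX hinv hG h0 h00 hne
    generalize p.rep = v
    obtain ⟨h, M, x, y, r⟩ := v
    rintro hG ⟨hM, rfl, htr⟩ h0 h00 hne hX
    change h = 0 at h0
    change M 0 0 = 0 at h00
    obtain ⟨rfl, rfl, rfl⟩ := borelCurve_avoids hX hM htr hG h0 h00
    subst h0
    exact hne rfl

/-! ### The leg set of the curve -/

theorem legSpace_re_im (w : LegSpace ℂ) :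
    w = LegSpace.toComplex (w.1.map Complex.re, w.2.re) +
      Complex.I • LegSpace.toComplex (w.1.map Complex.im, w.2.im) := by
  refine Prod.ext ?_ ?_
  · ext i j
    simp only [LegSpace.toComplex, Prod.fst_add, Prod.smul_fst, Matrix.add_apply,
      Matrix.smul_apply, Matrix.map_apply, smul_eq_mul]
    rw [mul_comm]
    exact (Complex.re_add_im _).symm
  · simp only [LegSpace.toComplex, Prod.snd_add, Prod.smul_snd, smul_eq_mul]
    rw [mul_comm]
    exact (Complex.re_add_im _).symm

theorem bsc_motionC_eq_zero {σ : Pose} (hσ : σ ∈ thePod.config) {w : LegSpace ℂ}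
    (h : bsc (motionC σ) w = 0) : bsc σ.toMotion (w.1.map Complex.re, w.2.re) = 0 ∧
      bsc σ.toMotion (w.1.map Complex.im, w.2.im) = 0 := by
  rw [legSpace_re_im w, ← bscLin_apply, map_add, map_smul, bscLin_apply, bscLin_apply,
    bsc_motionC_toComplex hσ, bsc_motionC_toComplex hσ, smul_eq_mul, mul_comm] at h
  constructor
  · simpa using congrArg Complex.re h
  · simpa using congrArg Complex.im h

/-- The symmetric part of a leg that vanishes on the curve belongs to the complex lifted web. -/
theorem exists_liftMap_of_bsc_eq_zero {z : Mat4 ℂ} {l : ℂ}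
    (h : ∀ σ ∈ thePod.config, bsc (motionC σ) (z, l) = 0) :
    ∃ v : Fin 4 → ℂ, z + zᵀ = web v ∧ 2 * l = webLift v := by
  obtain ⟨v, hv⟩ := exists_liftMap_of_infinite' (z := z.map Complex.re) (l := l.re)
    (infinite_config_thePod.mono fun σ hσ => ⟨hσ, (bsc_motionC_eq_zero hσ (h σ hσ)).1⟩)
  obtain ⟨v', hv'⟩ := exists_liftMap_of_infinite' (z := z.map Complex.im) (l := l.im)
    (infinite_config_thePod.mono fun σ hσ => ⟨hσ, (bsc_motionC_eq_zero hσ (h σ hσ)).2⟩)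
  have e1 : z.map Complex.re + (z.map Complex.re)ᵀ = web v := congrArg Prod.fst hv
  have e2 : 2 * l.re = webLift v := congrArg Prod.snd hv
  have e1' : z.map Complex.im + (z.map Complex.im)ᵀ = web v' := congrArg Prod.fst hv'
  have e2' : 2 * l.im = webLift v' := congrArg Prod.snd hv'
  have hlin : liftMap ((fun i => (v i : ℂ)) + Complex.I • fun i => (v' i : ℂ)) =
      LegSpace.toComplex (liftMap v) + Complex.I • LegSpace.toComplex (liftMap v') := by
    rw [map_add, map_smul]
    congr 1
    · exact (Prod.ext (map_ofReal_web v) (ofReal_webLift v)).symm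
    · congr 1
      exact (Prod.ext (map_ofReal_web v') (ofReal_webLift v')).symm
  have htot : (z + zᵀ, 2 * l) = liftMap ((fun i => (v i : ℂ)) + Complex.I • fun i => (v' i : ℂ)) := by
    rw [hlin, legSpace_re_im (z + zᵀ, 2 * l), ← hv, ← hv']
    have hre : ((z + zᵀ).map Complex.re, (2 * l).re) =
        (z.map Complex.re + (z.map Complex.re)ᵀ, 2 * l.re) :=
      Prod.ext (by ext i j; simp) (by simp)
    have him : ((z + zᵀ).map Complex.im, (2 * l).im) =
        (z.map Complex.im + (z.map Complex.im)ᵀ, 2 * l.im) :=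
      Prod.ext (by ext i j; simp) (by simp)
    simp only [hre, him]
  exact ⟨_, congrArg Prod.fst htot, congrArg Prod.snd htot⟩

theorem add_transpose_vecMulVec {K : Type} [Field K] (a b : Fin 4 → K) :
    Matrix.vecMulVec a b + (Matrix.vecMulVec a b)ᵀ = symProd a b := by
  ext i j
  simp [symProd_apply, Matrix.vecMulVec_apply, mul_comm]

theorem vecMulVec_eq_zero_of_symProd {K : Type} [Field K] [CharZero K] {a b : Fin 4 → K}
    (h : symProd a b = 0) : Matrix.vecMulVec a b = 0 := by
  have e (i j) : a i * b j + b i * a j = 0 := congrFun (congrFun h i) j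
  have d (i) : a i * b i = 0 := by
    have := e i i
    refine mul_left_cancel₀ (two_ne_zero (α := K)) ?_
    linear_combination this
  ext i j
  rw [Matrix.vecMulVec_apply, Matrix.zero_apply]
  rcases mul_eq_zero.1 (d i) with hi | hi
  · rw [hi, zero_mul]
  · have := e i j
    rw [hi, zero_mul, add_zero] at this
    exact this

theorem rep_legPoint (i : Fin 20) :
    ∃ c : ℂ, c ≠ 0 ∧ (thePod.legPoint i).rep = c • legOver Complex.ofRealHom (legIndex i) := by
  obtain ⟨c, hc⟩ := Projectivization.exists_smul_eq_mk_rep ℂ _ (legVector_toComplex_ne_zero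
    (thePod.platform i) (thePod.base i) (thePod.length i))
  refine ⟨c, c.ne_zero, ?_⟩
  rw [← legVector_toComplex_thePod]
  exact hc.symm

/-- On the configurations, the sphere condition of a complex leg splits into those of its real and
imaginary parts, so that its symmetric part lies over the complex web. -/
theorem legSet_borelCurve : legSet (borelCurve theLift) = Set.range thePod.legPoint := by
  ext q
  constructor
  · rintro ⟨⟨a, b, hab⟩, hq⟩
    have hb : ∀ σ ∈ thePod.config, bsc (motionC σ) (q.rep.1, q.rep.2) = 0 := fun σ hσ => by
      obtain ⟨c, hc, hrep⟩ := rep_motionPoint σ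
      have := hq _ (motionPoint_mem hσ)
      rw [hrep, bsc_smul_left] at this
      exact (mul_eq_zero.1 this).resolve_left hc
    obtain ⟨v, hv, hl⟩ := exists_liftMap_of_bsc_eq_zero hb
    rw [hab, add_transpose_vecMulVec] at hv
    have hv0 : v ≠ 0 := by
      rintro rfl
      apply q.rep_nonzero
      refine Prod.ext ?_ ?_
      · rw [hab]
        exact vecMulVec_eq_zero_of_symProd (hv.trans (webMap (K := ℂ)).map_zero)
      · simpa [webLift] using hl
    obtain ⟨p, c, hc, -, hleg⟩ := exists_leg_of_symProd hv0 hv hl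
    obtain ⟨i, rfl⟩ := legIndex_surjective p
    refine ⟨i, ?_⟩
    rw [← q.mk_rep, Pod.legPoint, Projectivization.mk_eq_mk_iff']
    refine ⟨c⁻¹, ?_⟩
    rw [legVector_toComplex_thePod, inv_smul_eq_iff₀ hc, ← hleg, ← hab]
  · rintro ⟨i, rfl⟩
    obtain ⟨c, hc, hrep⟩ := rep_legPoint i
    refine ⟨?_, fun p hp => ?_⟩
    · refine ⟨c • fun j => (legA (legIndex i) j : ℂ), fun j => (legB (legIndex i) j : ℂ), ?_⟩
      rw [hrep]
      ext j k
      simp [legOver, Matrix.vecMulVec_apply, mul_assoc]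
    · rw [← compactConfig_thePod] at hp
      rw [hrep, ← bscLin_apply, map_smul, bscLin_apply, ← legVector_toComplex_thePod, hp.2 i,
        smul_zero]

theorem isBorelFrom_thePod : thePod.IsBorelFrom theWeb :=
  ⟨theLift, isBorelLift_theLift, isOneDimensional_borelCurve, legSet_borelCurve,
    legPoint_injective, compactConfig_thePod⟩

/-! ### Maximality of the icosapod -/

/-- A leg whose sphere condition holds at infinitely many configurations is one of the twenty. -/
theorem exists_leg_of_infinite {a b : E3} {d : ℝ} (hd : 0 < d)
    (h : {σ ∈ thePod.config | bsc σ.toMotion (legVector a b d) = 0}.Infinite) :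
    ∃ i, thePod.platform i = a ∧ thePod.base i = b ∧ thePod.length i = d := by
  obtain ⟨v, hv⟩ := exists_liftMap_of_infinite' h
  have hz : symProd (Matrix.vecCons 1 a.ofLp) (Matrix.vecCons 1 b.ofLp) = web v :=
    (add_transpose_vecMulVec _ _).symm.trans (congrArg Prod.fst hv)
  have hl : 2 * (‖a‖ ^ 2 + ‖b‖ ^ 2 - d ^ 2) = webLift v := congrArg Prod.snd hv
  have hv0 : v 0 = 2 := by
    have := congrFun (congrFun hz 0) 0
    simp [symProd_apply, web] at this
    linarith
  obtain ⟨p, c, -, hc, hleg⟩ := exists_leg_of_symProd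
    (a := fun i => ((Matrix.vecCons 1 a.ofLp i : ℝ) : ℂ))
    (b := fun i => ((Matrix.vecCons 1 b.ofLp i : ℝ) : ℂ)) (v := fun i => (v i : ℂ))
    (l := ((‖a‖ ^ 2 + ‖b‖ ^ 2 - d ^ 2 : ℝ) : ℂ))
    (fun h => by
      have := congrFun h 0
      simp [hv0] at this)
    (by
      rw [← map_ofReal_web, ← hz]
      ext i j
      simp [symProd_apply])
    (by rw [← ofReal_webLift, ← hl]; push_cast; ring)
  have hc1 : c = 1 := by
    have := congrFun hc 0
    simp only [hv0, Pi.smul_apply, nodeParamC, nodeParam, Matrix.cons_val_zero, smul_eq_mul] at this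
    refine mul_right_cancel₀ (two_ne_zero (α := ℂ)) ?_
    rw [one_mul]
    exact_mod_cast this.symm
  rw [hc1, one_smul] at hleg
  obtain ⟨i, hi⟩ := legIndex_surjective p
  rw [← hi, ← legVector_toComplex_thePod, legVector_thePod] at hleg
  have e (j k) : Matrix.vecCons 1 a.ofLp j * Matrix.vecCons 1 b.ofLp k =
      legA (legIndex i) j * legB (legIndex i) k := by
    have := congrFun (congrFun (congrArg Prod.fst hleg) j) k
    simp only [LegSpace.toComplex, Matrix.vecMulVec_apply, Matrix.map_apply] at this
    exact_mod_cast this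
  have el : ‖a‖ ^ 2 + ‖b‖ ^ 2 - d ^ 2 = webLift (nodeParam (legIndex i).1) / 2 := by
    have := congrArg Prod.snd hleg
    simp only [LegSpace.toComplex] at this
    exact_mod_cast this
  have hA0 : legA (legIndex i) 0 = 1 := by rw [← cons_vecTail_legA]; rfl
  have hB0 : legB (legIndex i) 0 = 1 := by rw [← cons_vecTail_legB]; rfl
  have ha : thePod.platform i = a := by
    ext j
    have := e j.succ 0
    rw [hB0, mul_one, Matrix.cons_val_succ, Matrix.cons_val_zero, mul_one] at this
    exact this.symm
  have hb : thePod.base i = b := by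
    ext j
    have := e 0 j.succ
    rw [hA0, one_mul, Matrix.cons_val_succ, Matrix.cons_val_zero, one_mul] at this
    exact this.symm
  refine ⟨i, ha, hb, ?_⟩
  have h2 := congrArg Prod.snd (legVector_thePod i)
  simp only [legVector, ha, hb] at h2
  have h3 : thePod.length i ^ 2 = d ^ 2 := by linarith
  exact (sq_eq_sq₀ (thePod.length_pos i).le hd.le).1 h3

theorem config_addLeg_subset (a b : E3) (d : ℝ) (hd : 0 < d) :
    (thePod.addLeg a b d hd).config ⊆
      {σ ∈ thePod.config | bsc σ.toMotion (legVector a b d) = 0} := by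
  rintro σ ⟨hσ, h⟩
  refine ⟨⟨hσ, fun i => ?_⟩, ?_⟩
  · simpa [Pod.addLeg] using h i.castSucc
  · have := h (Fin.last 20)
    simp only [Pod.addLeg, Fin.snoc_last] at this
    rw [bsc_toMotion hσ, this, sub_self]

theorem isMobileIcosapod_thePod : thePod.IsMobileIcosapod := by
  refine ⟨mobility_thePod, fun a b d hd hne hmob => ?_⟩
  have hinf : {σ ∈ thePod.config | bsc σ.toMotion (legVector a b d) = 0}.Infinite := by
    intro hfin
    have h1 : (1 : ℝ≥0∞) ≤ dimH (thePod.addLeg a b d hd).config := hmob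
    rw [dimH_finite (hfin.subset (config_addLeg_subset a b d hd))] at h1
    simp at h1
  obtain ⟨i, hi⟩ := exists_leg_of_infinite hd hinf
  exact hne i hi

theorem exists_halfTurn_of_mem_config {σ : Pose} (hσ : σ ∈ thePod.config) :
    ∃ q u : Fin 3 → ℝ, u ≠ 0 ∧ σ = halfTurn q u := by
  obtain ⟨u, hu, -, hdot, he⟩ := exists_turn_of_mem_config hσ
  exact ⟨_, u, hu, he.trans (turn_eq_halfTurn hdot)⟩

theorem exInitial_mem_config : exInitial ∈ thePod.config := by
  set u : Fin 3 → ℝ := ![1, 7003716944 / 10000000000, 8 / 10] with hu'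
  have hu : u ≠ 0 := fun h => by simpa [hu'] using congrFun h 0
  obtain ⟨y, hy⟩ : ∃ y, exInitial = turn u y := ⟨_, Prod.ext rfl rfl⟩
  have hy2 : y = exInitial.2 := by rw [hy]; rfl
  have hdot : u ⬝ᵥ y = 0 := by
    rw [hy2]
    simp [hu', exInitial, halfTurn, dotProduct, Fin.sum_univ_three]
    norm_num
  rw [hy, turn_mem_config_iff hu hdot, hy2]
  refine ⟨?_, ?_, ?_⟩ <;>
  · simp [hu', exInitial, halfTurn, normForm, legConic, liftBasis, web, webForm, webLift,
      Fin.sum_univ_three, liftCoeff, webCoeff]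
    norm_num

end Icosapod

theorem mainTheorem2 :
    ∃ (A : Submodule ℝ (Icosapod.Mat4 ℝ)) (P : Icosapod.Pod 20),
      -- a quartic spectrahedron of type (10, 0) containing `E`
      Icosapod.IsQuarticSpectrahedron A ∧ Icosapod.matE ∈ A ∧ Icosapod.HasType A 10 0 ∧
      -- a mobile icosapod obtained from it by Borel's construction
      P.IsBorelFrom A ∧ P.IsMobileIcosapod ∧
      -- all configurations are rotations by 180 degrees around lines
      (∀ σ ∈ P.config, ∃ q u : Fin 3 → ℝ, u ≠ 0 ∧ σ = Icosapod.halfTurn q u) ∧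
      -- the explicit data of the first six legs, and an explicit configuration
      (∀ k : Fin 6,
        P.base (Fin.castLE (by norm_num) k) = Icosapod.exBase k ∧
        P.platform (Fin.castLE (by norm_num) k) = Icosapod.exPlatform k ∧
        P.length (Fin.castLE (by norm_num) k) ^ 2 = Icosapod.exSqLength k) ∧
      Icosapod.exInitial ∈ P.config :=
  ⟨Icosapod.theWeb, Icosapod.thePod, Icosapod.isQuarticSpectrahedron_theWeb,
    ⟨_, Icosapod.web_matE⟩, Icosapod.hasType_theWeb, Icosapod.isBorelFrom_thePod,
    Icosapod.isMobileIcosapod_thePod, fun _ hσ => Icosapod.exists_halfTurn_of_mem_config hσ,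
    Icosapod.thePod_first_legs, Icosapod.exInitial_mem_config⟩
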